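/- Let $\Omega\subset\mathbb R^2$ be a bounded domain (open and connected) whose boundary $\Gamma$ is of class $C^1$, let $k\ge 2$ be an integer, $\nu>0$, and let $\mathbf b:\mathbb R^2\to\mathbb R^2$ be a continuous field that is divergence-free (in the sense of distributions). A mesh $\mathcal T_h$ is a finite set of nondegenerate closed triangles, any two different ones of which meet in the empty set, in a common vertex or in a common edge. Let $\Omega_h$ be the interior of $\bigcup_{T\in\mathcal T_h}T$, let $\Gamma_h=\partial\Omega_h$, and let $h=\max_{T\in\mathcal T_h} h_T$ with $h_T=\operatorname{diam}T$. The mesh fits $\Omega$ if all its vertices located on $\Gamma_h$ lie on $\Gamma$ and every triangle has at most one edge contained in $\Gamma_h$. It is $\sigma$-regular if $h_T\le\sigma\rho_T$ for all $T\in\mathcal T_h$, where $\rho_T$ is the diameter of the largest disk contained in $T$. Let $\mathcal S_h$ be the set of triangles having one edge $e_T\subset\Gamma_h$, and for $T\in\mathcal S_h$ let $O_T$ be the vertex of $T$ opposite to $e_T$. The test space $V_h$ consists of the continuous functions on $\overline{\Omega}_h$ that vanish on $\Gamma_h$ and whose restriction to every $T\in\mathcal T_h$ is a polynomial of degree at most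 $k$. The trial space $W_h$ consists of the continuous functions $w$ on $\overline{\Omega}_h$ that vanish at the vertices of the mesh located on $\Gamma_h$, whose restriction to every $T\in\mathcal T_h$ is a polynomial $w_T$ of degree at most $k$, and for which, for every $T\in\mathcal S_h$, the polynomial $w_T$ (extended to $\mathbb R^2$) vanishes at the points $P$ defined as follows: for each of the $k-1$ points $M$ that subdivide $e_T$ into $k$ segments of equal length, $P$ is the intersection nearest to $M$ of $\Gamma$ with the straight line through $O_T$ and $M$. Set $$a_h(w,v)=\int_{\Omega_h}\big[\nu\,\nabla w\cdot\nabla v+(\mathbf b\cdot\nabla w)\,v\big],\qquad F_h(v)=\int_{\Omega_h} f\,v,\qquad \|\cdot\|_{0,h}=\|\cdot\|_{L^2(\Omega_h)} .$$ Then for every $\sigma$ there is $h_0>0$ (depending only on $\Omega,k,\nu,\mathbf b,\sigma$) such that, for every $\sigma$-regular mesh $\mathcal T_h$ that fits $\Omega$ and satisfies $h\le h_0$: 1. for every $f\in L^2(\Omega_h)$ there is exactly one $u_h\in W_h$ such that $a_h(u_h,v)=F_h(v)$ for all $v\in V_h$; 2. for all $w\in W_h\setminus\{0\}$, $$\sup_{v\in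 V_h\setminus\{0\}}\frac{a_h(w,v)}{\|\nabla w\|_{0,h}\,\|\nabla v\|_{0,h}}\ \ge\ \alpha:=\frac{2\nu}{5}>0 .$$ -/

import Mathlib

noncomputable section

/-- The Euclidean plane. -/
abbrev Plane : Type := EuclideanSpace ℝ (Fin 2)

/-- The boundary of `Ω` is of class `C¹`: near each of its boundary points, and in suitable
orthogonal Cartesian coordinates, `Ω` is the region lying above the graph of a `C¹` function. -/
def HasC1Boundary (Ω : Set Plane) : Prop :=
  ∀ x ∈ frontier Ω, ∃ r : ℝ, 0 < r ∧ ∃ (R : Plane ≃ₗᵢ[ℝ] Plane) (g : ℝ → ℝ), ContDiff ℝ 1 g ∧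
    ∀ y ∈ Metric.ball x r, (y ∈ Ω ↔ g (R y 0) < R y 1)

/-- The field `b` is divergence-free in the sense of distributions on the whole plane. -/
def IsSolenoidal (b : Plane → Plane) : Prop :=
  ∀ φ : Plane → ℝ, ContDiff ℝ (⊤ : ℕ∞) φ → HasCompactSupport φ →
    ∫ x, inner ℝ (b x) (gradient φ x) = 0

/-- A finite mesh of straight-edged (nondegenerate, closed) triangles. A triangle is given by the
set of its three vertices; the triangle itself is their convex hull. Two different triangles meet
in the convex hull of their common vertices, i.e. in nothing, in a common vertex or in a
common edge. -/
structure TriMesh where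
  elements : Finset (Finset Plane)
  card_eq : ∀ T ∈ elements, T.card = 3
  indep : ∀ T ∈ elements, AffineIndependent ℝ ((↑) : T → Plane)
  conforming : ∀ S ∈ elements, ∀ T ∈ elements,
    convexHull ℝ (S : Set Plane) ∩ convexHull ℝ (T : Set Plane)
      = convexHull ℝ ((S : Set Plane) ∩ (T : Set Plane))

/-- The closed triangle with vertex set `T`. -/
def tri (T : Finset Plane) : Set Plane := convexHull ℝ (T : Set Plane)

/-- The edge of the triangle `T` that is opposite to its vertex `O`. -/
def oppEdge (T : Finset Plane) (O : Plane) : Set Plane := convexHull ℝ ((T : Set Plane) \ {O})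

/-- The diameter of the largest disk contained in the triangle `T`. -/
def inDiam (T : Finset Plane) : ℝ :=
  sSup {d : ℝ | ∃ c : Plane, Metric.closedBall c (d / 2) ⊆ tri T}

/-- The point `P` is an intersection, nearest to `M`, of the set `Γ` with the straight line passing
through `O` and `M`. -/
def IsNearestIntersection (Γ : Set Plane) (O M P : Plane) : Prop :=
  P ∈ Γ ∧ P ∈ line[ℝ, O, M] ∧ ∀ Q ∈ Γ, Q ∈ line[ℝ, O, M] → dist M P ≤ dist M Q

/-- On the triangle `T` the function `w` is given by the polynomial `p`, of degree at most `k`. -/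
def IsPolyOn (k : ℕ) (T : Finset Plane) (w : Plane → ℝ) (p : MvPolynomial (Fin 2) ℝ) : Prop :=
  p.totalDegree ≤ k ∧ ∀ x ∈ tri T, w x = MvPolynomial.eval (fun i => x i) p

theorem IsPolyOn.zero (k : ℕ) (T : Finset Plane) : IsPolyOn k T 0 0 :=
  ⟨by simp, by simp⟩

theorem IsPolyOn.add {k : ℕ} {T : Finset Plane} {v w : Plane → ℝ} {p q : MvPolynomial (Fin 2) ℝ}
    (hv : IsPolyOn k T v p) (hw : IsPolyOn k T w q) : IsPolyOn k T (v + w) (p + q) :=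
  ⟨(MvPolynomial.totalDegree_add p q).trans (max_le hv.1 hw.1),
    fun x hx => by simp [hv.2 x hx, hw.2 x hx]⟩

theorem IsPolyOn.smul {k : ℕ} {T : Finset Plane} {v : Plane → ℝ} {p : MvPolynomial (Fin 2) ℝ}
    (c : ℝ) (hv : IsPolyOn k T v p) : IsPolyOn k T (c • v) (c • p) :=
  ⟨(MvPolynomial.totalDegree_smul_le c p).trans hv.1,
    fun x hx => by simp [hv.2 x hx, MvPolynomial.smul_eval]⟩

namespace TriMesh

/-- The union of the closed triangles of the mesh. -/
def carrier (𝒯 : TriMesh) : Set Plane := ⋃ T ∈ 𝒯.elements, tri T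

/-- The open polygonal set `Ω_h`. -/
def domain (𝒯 : TriMesh) : Set Plane := interior 𝒯.carrier

/-- The boundary `Γ_h` of `Ω_h`. -/
def bdry (𝒯 : TriMesh) : Set Plane := frontier 𝒯.domain

/-- The mesh size `h`, the largest of the diameters of the triangles. -/
def size (𝒯 : TriMesh) : ℝ :=
  sSup ((fun T : Finset Plane => Metric.diam (tri T)) '' (𝒯.elements : Set (Finset Plane)))

/-- Every triangle satisfies `h_T ≤ σ ρ_T`, where `h_T` is its diameter and `ρ_T` the diameter of
its inscribed disk. -/
def IsShapeRegular (𝒯 : TriMesh) (σ : ℝ) : Prop :=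
  ∀ T ∈ 𝒯.elements, Metric.diam (tri T) ≤ σ * inDiam T

/-- The mesh fits `Ω`: the mesh vertices located on `Γ_h` lie on the boundary of `Ω`, and no
triangle has two edges contained in `Γ_h`. -/
structure Fits (𝒯 : TriMesh) (Ω : Set Plane) : Prop where
  vertex_mem : ∀ T ∈ 𝒯.elements, ∀ A ∈ T, A ∈ 𝒯.bdry → A ∈ frontier Ω
  one_edge : ∀ T ∈ 𝒯.elements, ∀ O ∈ T, ∀ O' ∈ T,
    oppEdge T O ⊆ 𝒯.bdry → oppEdge T O' ⊆ 𝒯.bdry → O = O'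

/-- The boundary nodes attached to `T`: if the edge `AB` of `T = OAB` is contained in `Γ_h`, they are
the nearest intersections with `Γ` of the lines joining `O` to the `k - 1` points `M` that
subdivide `AB` into `k` segments of equal length. -/
def nodes (𝒯 : TriMesh) (Γ : Set Plane) (k : ℕ) (T : Finset Plane) : Set Plane :=
  {P | ∃ O A B : Plane, (T : Set Plane) = {O, A, B} ∧ oppEdge T O ⊆ 𝒯.bdry ∧
    ∃ i : ℕ, 0 < i ∧ i < k ∧
      IsNearestIntersection Γ O (AffineMap.lineMap A B ((i : ℝ) / (k : ℝ))) P}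

/-- The test space `V_h`: the standard Lagrange space of continuous functions, piecewise polynomial
of degree at most `k`, that vanish on `Γ_h` (extended by zero outside `Ω_h`). -/
def testSpace (𝒯 : TriMesh) (k : ℕ) : Submodule ℝ (Plane → ℝ) where
  carrier := {v | ContinuousOn v 𝒯.carrier ∧ (∀ x, x ∉ 𝒯.domain → v x = 0) ∧
    ∀ T ∈ 𝒯.elements, ∃ p, IsPolyOn k T v p}
  zero_mem' := ⟨continuousOn_const, fun _ _ => rfl, fun T _ => ⟨0, IsPolyOn.zero k T⟩⟩
  add_mem' := by
    rintro v w ⟨hv, hv0, hvp⟩ ⟨hw, hw0, hwp⟩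
    refine ⟨hv.add hw, fun x hx => by simp [hv0 x hx, hw0 x hx], fun T hT => ?_⟩
    obtain ⟨p, hp⟩ := hvp T hT
    obtain ⟨q, hq⟩ := hwp T hT
    exact ⟨p + q, hp.add hq⟩
  smul_mem' := by
    rintro c v ⟨hv, hv0, hvp⟩
    refine ⟨hv.const_smul c, fun x hx => by simp [hv0 x hx], fun T hT => ?_⟩
    obtain ⟨p, hp⟩ := hvp T hT
    exact ⟨c • p, hp.smul c⟩

/-- The trial space `W_h`: continuous functions that vanish at the mesh vertices on `Γ_h` and are
given in each triangle `T` by a polynomial of degree at most `k` which, extended beyond `T`,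
vanishes at the boundary nodes attached to `T`. Only the values in the closed polygon matter; so
that each element is a single function on the plane, it is given the value zero elsewhere. -/
def trialSpace (𝒯 : TriMesh) (Γ : Set Plane) (k : ℕ) : Submodule ℝ (Plane → ℝ) where
  carrier := {w | ContinuousOn w 𝒯.carrier ∧ (∀ x, x ∉ 𝒯.carrier → w x = 0) ∧
    (∀ T ∈ 𝒯.elements, ∀ A ∈ T, A ∈ 𝒯.bdry → w A = 0) ∧
    ∀ T ∈ 𝒯.elements, ∃ p, IsPolyOn k T w p ∧
      ∀ P ∈ 𝒯.nodes Γ k T, MvPolynomial.eval (fun i => P i) p = 0}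
  zero_mem' := ⟨continuousOn_const, fun _ _ => rfl, fun _ _ _ _ _ => rfl,
    fun T _ => ⟨0, IsPolyOn.zero k T, by simp⟩⟩
  add_mem' := by
    rintro v w ⟨hv, hv0, hva, hvp⟩ ⟨hw, hw0, hwa, hwp⟩
    refine ⟨hv.add hw, fun x hx => by simp [hv0 x hx, hw0 x hx],
      fun T hT A hA hAb => by simp [hva T hT A hA hAb, hwa T hT A hA hAb], fun T hT => ?_⟩
    obtain ⟨p, hp, hp0⟩ := hvp T hT
    obtain ⟨q, hq, hq0⟩ := hwp T hT
    exact ⟨p + q, hp.add hq, fun P hP => by simp [hp0 P hP, hq0 P hP]⟩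
  smul_mem' := by
    rintro c v ⟨hv, hv0, hva, hvp⟩
    refine ⟨hv.const_smul c, fun x hx => by simp [hv0 x hx],
      fun T hT A hA hAb => by simp [hva T hT A hA hAb], fun T hT => ?_⟩
    obtain ⟨p, hp, hp0⟩ := hvp T hT
    exact ⟨c • p, hp.smul c, fun P hP => by simp [hp0 P hP, MvPolynomial.smul_eval]⟩

/-- The bilinear form `a_h`. The functions it is applied to are polynomial in each triangle, so
their pointwise gradient exists off the edges, which form a set of measure zero. -/
def form (𝒯 : TriMesh) (ν : ℝ) (b : Plane → Plane) (w v : Plane → ℝ) : ℝ :=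
  ∫ x in 𝒯.domain,
    (ν * inner ℝ (gradient w x) (gradient v x) + inner ℝ (b x) (gradient w x) * v x)

/-- The linear functional `F_h`. -/
def load (𝒯 : TriMesh) (f v : Plane → ℝ) : ℝ := ∫ x in 𝒯.domain, f x * v x

/-- The norm of the gradient of `w` in `L²(Ω_h)`. -/
def gradNorm (𝒯 : TriMesh) (w : Plane → ℝ) : ℝ :=
  Real.sqrt (∫ x in 𝒯.domain, ‖gradient w x‖ ^ 2)

end TriMesh

end

noncomputable section

open MeasureTheory Set Filter Topology
open scoped NNReal Convolution

/-! A trial function `w` is almost a test function. In a boundary triangle with apex `O` and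
boundary edge `AB`, let `c` be the polynomial of degree `k` that is homogeneous with respect to `O`,
vanishes on the edges `OA` and `OB`, and takes the values of `w` at the `k - 1` points `M`
subdividing `AB`; elsewhere `c = 0`. On `AB` both `w` and `c` have degree at most `k` and agree at
`k + 1` points, so `v = w - c` vanishes on `Γ_h` and belongs to `V_h`.

The correction is small. Near `Γ` the `C¹` boundary is almost straight at the scale of a triangle,
so the node on the line `OM` is `O + (1 + s)(M - O)` with `|s| ≤ ε`, where `ε` is arbitrary once `h`
is small, uniformly by compactness (`HasC1Boundary.exists_isNearestIntersection`). As `w` vanishes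
at the node, the mean value theorem and an inverse inequality for polynomials bound `w(M)`, whence
`‖∇c‖ ≤ C ε ‖∇w‖` (`exists_edgeCorrection_estimate`, `TriMesh.exists_gradNorm_correction_le`).

For the inf-sup bound, `v` itself is the test function. Since `b` is divergence-free, `∫ (b·∇v) v =
½ ∫ b·∇(v²) = 0`, so `a_h(v, v) = ν ‖∇v‖²`. Poincaré's inequality gives `|a_h(c, v)| ≤ (ν + 2RB)
‖∇c‖ ‖∇v‖`, where `R` bounds the polygon and `B` bounds `b`. With `‖∇v‖ ≥ ‖∇w‖ - ‖∇c‖`, the quotient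
is at least `ν - Cε(2ν + 2RB)`, and `ε` is chosen so that the loss is at most `3ν/5`.

The inf-sup bound makes the discrete operator injective. Unique solvability then needs only `dim V_h
≤ dim W_h`, which holds because `w ↦ w - c` maps onto `V_h`: homogeneity gives `c(O + (1 + s)(M -
O)) = (1 + s)^k c(M)`, so the node conditions can be solved one at a time
(`TriMesh.exists_trialSpace_sub_correction_eq`). -/

/-! ### Gluing Lipschitz bounds over finite closed covers -/

theorem abs_sub_le_of_finset_isClosed_cover {ι : Type*} {F : ℝ → ℝ} {K : ι → Set ℝ} {b L : ℝ}
    (s : Finset ι) (hK : ∀ i ∈ s, IsClosed (K i)) :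
    ∀ a ≤ b, Icc a b ⊆ ⋃ i ∈ s, K i →
      (∀ i ∈ s, ∀ x ∈ K i ∩ Icc a b, ∀ y ∈ K i ∩ Icc a b, |F x - F y| ≤ L * |x - y|) →
      |F b - F a| ≤ L * (b - a) := by
  classical
  induction s using Finset.strongInduction with
  | H s ih =>
    intro a hab hcov hF
    obtain ⟨i, hi, hai⟩ : ∃ i ∈ s, a ∈ K i := by
      simpa using hcov (left_mem_Icc.2 hab)
    have hcpt : IsCompact (K i ∩ Icc a b) := isCompact_Icc.inter_left (hK i hi)
    -- `t` is the last point of the interval in `K i`. Beyond `t` the remaining sets cover, and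
    -- since they are closed they cover `t` too, so induction on the index set applies to `[t, b]`.
    obtain ⟨t, ⟨hti, hta, htb⟩, htmax⟩ := hcpt.exists_isGreatest ⟨a, hai, left_mem_Icc.2 hab⟩
    have h1 := hF i hi t ⟨hti, hta, htb⟩ a ⟨hai, left_mem_Icc.2 hab⟩
    rw [abs_of_nonneg (sub_nonneg.2 hta)] at h1
    rcases htb.eq_or_lt with rfl | htb'
    · exact h1
    have hcov' : Icc t b ⊆ ⋃ j ∈ s.erase i, K j := by
      have hcl : IsClosed (⋃ j ∈ s.erase i, K j) :=
        isClosed_biUnion_finset fun j hj => hK j (Finset.mem_of_mem_erase hj)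
      rw [← closure_Ioc htb'.ne]
      refine hcl.closure_subset_iff.2 fun x hx => ?_
      obtain ⟨j, hj, hxj⟩ : ∃ j ∈ s, x ∈ K j := by
        simpa using hcov ⟨hta.trans hx.1.le, hx.2⟩
      have hji : j ≠ i := by
        rintro rfl
        exact (htmax ⟨hxj, hta.trans hx.1.le, hx.2⟩).not_gt hx.1
      simp only [mem_iUnion]
      exact ⟨j, Finset.mem_erase.2 ⟨hji, hj⟩, hxj⟩
    have h2 := ih (s.erase i) (Finset.erase_ssubset hi)
      (fun j hj => hK j (Finset.mem_of_mem_erase hj)) t htb hcov'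
      (fun j hj x hx y hy => hF j (Finset.mem_of_mem_erase hj) x ⟨hx.1, hta.trans hx.2.1, hx.2.2⟩
        y ⟨hy.1, hta.trans hy.2.1, hy.2.2⟩)
    have : F b - F a = (F b - F t) + (F t - F a) := by ring
    rw [this]
    refine (abs_add_le _ _).trans ?_
    linarith

/-- A function on a normed space that is Lipschitz on each member of a finite closed cover is
Lipschitz. -/
theorem lipschitzWith_of_finset_isClosed_cover {E ι : Type*} [NormedAddCommGroup E]
    [NormedSpace ℝ E] {f : E → ℝ} {K : ι → Set E} {C : ℝ≥0} (s : Finset ι)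
    (hK : ∀ i ∈ s, IsClosed (K i)) (hcov : ∀ x, ∃ i ∈ s, x ∈ K i)
    (hf : ∀ i ∈ s, LipschitzOnWith C f (K i)) : LipschitzWith C f := by
  refine LipschitzWith.of_dist_le_mul fun x y => ?_
  -- Along the segment from `y` to `x` the cover restricts to a finite closed cover of `[0, 1]`.
  have hc : Continuous fun t : ℝ => AffineMap.lineMap y x t :=
    AffineMap.lineMap_continuous
  have h := abs_sub_le_of_finset_isClosed_cover (F := fun t => f (AffineMap.lineMap y x t))
    (K := fun i => (fun t : ℝ => AffineMap.lineMap y x t) ⁻¹' K i) (b := 1)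
    (L := C * dist x y) s (fun i hi => (hK i hi).preimage hc) 0 zero_le_one
    (fun t _ => by simpa using hcov _)
    (fun i hi u hu v hv => by
      have := (hf i hi).dist_le_mul _ hu.1 _ hv.1
      rw [Real.dist_eq, dist_lineMap_lineMap, Real.dist_eq, dist_comm y x] at this
      calc _ ≤ _ := this
        _ = _ := by ring)
  simpa [Real.dist_eq] using h

/-! ### Divergence-free fields tested against Lipschitz functions -/

theorem inner_gradient_eq_fderiv (f : Plane → ℝ) (x e : Plane) :
    inner ℝ e (gradient f x) = fderiv ℝ f x e := by
  rw [real_inner_comm, gradient, InnerProductSpace.toDual_symm_apply]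

theorem norm_gradient_eq_norm_fderiv (f : Plane → ℝ) (x : Plane) :
    ‖gradient f x‖ = ‖fderiv ℝ f x‖ := by
  rw [gradient, LinearIsometryEquiv.norm_map]

theorem measurable_gradient (f : Plane → ℝ) : Measurable (gradient f) :=
  (InnerProductSpace.toDual ℝ Plane).symm.continuous.measurable.comp (measurable_fderiv ℝ f)

/-- For a Lipschitz function, the derivative of a mollification is the mollification of the
derivative. -/
theorem fderiv_convolution_of_lipschitz {φ ρ : Plane → ℝ} {C D : ℝ≥0} (hφ : LipschitzWith C φ)
    (hρ : LipschitzWith D ρ) (hρ1 : ContDiff ℝ 1 ρ) (hρc : HasCompactSupport ρ) (x : Plane) :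
    fderiv ℝ (ρ ⋆[ContinuousLinearMap.lsmul ℝ ℝ, volume] φ) x
      = (ρ ⋆[ContinuousLinearMap.lsmul ℝ ℝ, volume] (fderiv ℝ φ)) x := by
  have hloc : LocallyIntegrable φ (volume : Measure Plane) := hφ.continuous.locallyIntegrable
  have hlocd : LocallyIntegrable (fderiv ℝ φ) (volume : Measure Plane) := by
    refine (continuous_const (y := (C : ℝ))).locallyIntegrable.mono
      (measurable_fderiv ℝ φ).aestronglyMeasurable (Eventually.of_forall fun y => ?_)
    simpa using norm_fderiv_le_of_lipschitz ℝ hφ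
  rw [(hρc.hasFDerivAt_convolution_left _ hρ1 hloc x).fderiv]
  ext e
  have hex1 : ConvolutionExistsAt (fderiv ℝ ρ) φ x
      ((ContinuousLinearMap.lsmul ℝ ℝ).precompL Plane) volume :=
    (hρc.fderiv ℝ).convolutionExists_left _ (hρ1.continuous_fderiv one_ne_zero) hloc x
  have hex2 : ConvolutionExistsAt ρ (fderiv ℝ φ) x (ContinuousLinearMap.lsmul ℝ ℝ) volume :=
    hρc.convolutionExists_left _ hρ1.continuous hlocd x
  rw [convolution, convolution, ContinuousLinearMap.integral_apply hex1,
    ContinuousLinearMap.integral_apply hex2]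
  have hφx : LipschitzWith C fun t => φ (x - t) := by
    have := hφ.comp ((LipschitzWith.const (α := Plane) x).sub LipschitzWith.id)
    simpa [Function.comp_def] using this
  -- The direction is `-e` because `t ↦ φ (x - t)` reverses the sign of derivatives.
  have key := hφx.integral_lineDeriv_mul_eq (μ := volume) hρ hρc (-e)
  rw [neg_neg] at key
  have h1 : ∀ t, ((ContinuousLinearMap.lsmul ℝ ℝ).precompL Plane (fderiv ℝ ρ t)) (φ (x - t)) e
      = lineDeriv ℝ ρ t e * φ (x - t) := fun t => by
    rw [(hρ1.differentiable one_ne_zero t).lineDeriv_eq_fderiv]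
    simp [ContinuousLinearMap.precompL_apply]
  simp_rw [h1]
  rw [← key]
  have hae : ∀ᵐ t ∂(volume : Measure Plane), DifferentiableAt ℝ φ (x - t) := by
    have := hφ.ae_differentiableAt (μ := volume)
    exact (Measure.measurePreserving_sub_left volume x).quasiMeasurePreserving.ae this
  refine integral_congr_ae ?_
  filter_upwards [hae] with t ht
  have h2 : HasFDerivAt (fun t => φ (x - t)) (-(fderiv ℝ φ (x - t))) t := by
    have := ht.hasFDerivAt.comp t ((hasFDerivAt_id t).const_sub x)
    simpa [Function.comp_def] using this
  rw [(h2.hasLineDerivAt (-e)).lineDeriv]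
  simp [mul_comm]

/-- Mollifications of `φ` are admissible smooth test functions. Their derivatives are bounded by
`C`, live in one fixed ball and converge almost everywhere to that of `φ`, so dominated convergence
applies. This is needed for `φ = v²` with `v` piecewise polynomial, which is only Lipschitz. -/
theorem IsSolenoidal.integral_gradient_eq_zero {b : Plane → Plane} (hb : Continuous b)
    (hdiv : IsSolenoidal b) {φ : Plane → ℝ} {C : ℝ≥0} (hφ : LipschitzWith C φ)
    (hφc : HasCompactSupport φ) : ∫ x, inner ℝ (b x) (gradient φ x) = 0 := by
  -- The outer radius is at most `1`, which confines all supports to the ball of radius `R + 1`; the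
  -- fixed ratio `2` of the radii is what the almost everywhere convergence theorem requires.
  let β : ℕ → ContDiffBump (0 : Plane) := fun n =>
    ⟨1 / (n + 2 : ℝ), 2 / (n + 2 : ℝ), by positivity, by gcongr; norm_num⟩
  let ρ : ℕ → Plane → ℝ := fun n => (β n).normed volume
  let ψ : ℕ → Plane → ℝ := fun n => ρ n ⋆[ContinuousLinearMap.lsmul ℝ ℝ, volume] φ
  have hρs : ∀ n, ContDiff ℝ (⊤ : ℕ∞) (ρ n) := fun n => (β n).contDiff_normed
  have hρc : ∀ n, HasCompactSupport (ρ n) := fun n => (β n).hasCompactSupport_normed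
  have hρL : ∀ n, ∃ D, LipschitzWith D (ρ n) := fun n =>
    ContDiff.lipschitzWith_of_hasCompactSupport (hρc n) (hρs n) (by simp)
  have hloc : LocallyIntegrable φ (volume : Measure Plane) := hφ.continuous.locallyIntegrable
  have hlocd : LocallyIntegrable (fderiv ℝ φ) (volume : Measure Plane) := by
    refine (continuous_const (y := (C : ℝ))).locallyIntegrable.mono
      (measurable_fderiv ℝ φ).aestronglyMeasurable (Eventually.of_forall fun y => ?_)
    simpa using norm_fderiv_le_of_lipschitz ℝ hφ
  have hψs : ∀ n, ContDiff ℝ (⊤ : ℕ∞) (ψ n) := fun n =>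
    (hρc n).contDiff_convolution_left _ (hρs n) hloc
  have hψc : ∀ n, HasCompactSupport (ψ n) := fun n => (hρc n).convolution _ hφc
  have hder : ∀ n x, fderiv ℝ (ψ n) x
      = (ρ n ⋆[ContinuousLinearMap.lsmul ℝ ℝ, volume] (fderiv ℝ φ)) x := fun n x => by
    obtain ⟨D, hD⟩ := hρL n
    exact fderiv_convolution_of_lipschitz hφ hD ((hρs n).of_le (by simp)) (hρc n) x
  have hbd : ∀ n x, ‖fderiv ℝ (ψ n) x‖ ≤ C := fun n x => by
    rw [hder n x, convolution]
    refine (norm_integral_le_of_norm_le (g := fun t => ρ n t * C)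
      (((hρs n).continuous.integrable_of_hasCompactSupport (hρc n)).mul_const _)
      (Eventually.of_forall fun t => ?_)).trans ?_
    · have h0 : 0 ≤ ρ n t := (β n).nonneg_normed t
      simp only [ContinuousLinearMap.lsmul_apply, norm_smul, Real.norm_of_nonneg h0]
      gcongr
      exact norm_fderiv_le_of_lipschitz ℝ hφ
    · rw [integral_mul_const, (β n).integral_normed, one_mul]
  obtain ⟨R, hR⟩ := hφc.isCompact.isBounded.subset_closedBall (0 : Plane)
  have hsupp : ∀ n x, x ∉ Metric.closedBall (0 : Plane) (R + 1) → fderiv ℝ (ψ n) x = 0 := by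
    intro n x hx
    have h1 : tsupport (ψ n) ⊆ Metric.closedBall (0 : Plane) (R + 1) := by
      refine closure_minimal ?_ Metric.isClosed_closedBall
      refine (support_convolution_subset (L := ContinuousLinearMap.lsmul ℝ ℝ)).trans ?_
      rintro _ ⟨u, hu, v, hv, rfl⟩
      rw [(β n).support_normed_eq] at hu
      have hu' : ‖u‖ < 2 / (n + 2 : ℝ) := by simpa using hu
      have hv' : ‖v‖ ≤ R := by simpa using hR (subset_tsupport _ hv)
      have : (2 : ℝ) / (n + 2) ≤ 1 := by
        rw [div_le_one (by positivity)]; linarith [n.cast_nonneg (α := ℝ)]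
      simp only [Metric.mem_closedBall, dist_zero_right]
      calc ‖u + v‖ ≤ ‖u‖ + ‖v‖ := norm_add_le _ _
        _ ≤ R + 1 := by linarith
    by_contra h
    exact hx (h1 (support_fderiv_subset ℝ h))
  have hlim : ∀ᵐ x ∂(volume : Measure Plane),
      Tendsto (fun n => fderiv ℝ (ψ n) x) atTop (𝓝 (fderiv ℝ φ x)) := by
    have h := ContDiffBump.ae_convolution_tendsto_right_of_locallyIntegrable (φ := β)
      (l := atTop) (K := 2) (μ := (volume : Measure Plane)) (g := fderiv ℝ φ) ?_ ?_ hlocd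
    · simpa only [hder] using h
    · have : Tendsto (fun n : ℕ => (n : ℝ) + 2) atTop atTop :=
        tendsto_atTop_add_const_right _ _ tendsto_natCast_atTop_atTop
      exact this.const_div_atTop 2
    · refine Eventually.of_forall fun n => ?_
      change 2 / ((n : ℝ) + 2) ≤ 2 * (1 / ((n : ℝ) + 2))
      exact le_of_eq (by ring)
  obtain ⟨B, hB⟩ := (isCompact_closedBall (0 : Plane) (R + 1)).exists_bound_of_continuousOn
    hb.continuousOn
  have hdom : Tendsto (fun n => ∫ x, fderiv ℝ (ψ n) x (b x)) atTop
      (𝓝 (∫ x, fderiv ℝ φ x (b x))) := by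
    refine tendsto_integral_of_dominated_convergence
      ((Metric.closedBall (0 : Plane) (R + 1)).indicator fun _ => (C : ℝ) * B) ?_ ?_ ?_ ?_
    · intro n
      exact ((((hψs n).continuous_fderiv (by simp)).clm_apply hb)).aestronglyMeasurable
    · rw [integrable_indicator_iff Metric.isClosed_closedBall.measurableSet]
      exact integrableOn_const (isCompact_closedBall _ _).measure_lt_top.ne
    · intro n
      refine Eventually.of_forall fun x => ?_
      by_cases hx : x ∈ Metric.closedBall (0 : Plane) (R + 1)
      · rw [indicator_of_mem hx]
        exact ((fderiv ℝ (ψ n) x).le_opNorm _).trans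
          (mul_le_mul (hbd n x) (hB x hx) (norm_nonneg _) C.2)
      · rw [indicator_of_notMem hx, hsupp n x hx]
        simp
    · filter_upwards [hlim] with x hx
      exact ((ContinuousLinearMap.apply ℝ ℝ (b x)).continuous.tendsto _).comp hx
  have hzero : ∀ n, ∫ x, fderiv ℝ (ψ n) x (b x) = 0 := fun n => by
    simpa only [inner_gradient_eq_fderiv] using hdiv (ψ n) (hψs n) (hψc n)
  simp only [hzero] at hdom
  simp only [inner_gradient_eq_fderiv]
  exact (tendsto_nhds_unique hdom tendsto_const_nhds)

/-! ### Cauchy–Schwarz and Poincaré inequalities -/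

/-- The Cauchy–Schwarz inequality for integrals. -/
theorem integral_mul_le_sqrt_mul_sqrt {α : Type*} {m : MeasurableSpace α} {μ : Measure α}
    {f g : α → ℝ} (hf : MemLp f 2 μ) (hg : MemLp g 2 μ) :
    ∫ x, |f x| * |g x| ∂μ ≤ Real.sqrt (∫ x, f x ^ 2 ∂μ) * Real.sqrt (∫ x, g x ^ 2 ∂μ) := by
  have h := integral_mul_norm_le_Lp_mul_Lq (μ := μ) (f := f) (g := g) (p := 2) (q := 2)
    (by constructor <;> norm_num) (by simpa using hf) (by simpa using hg)
  simpa [Real.sqrt_eq_rpow] using h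

theorem LipschitzWith.sq_of_bounded {v : Plane → ℝ} {C B : ℝ≥0} (hv : LipschitzWith C v)
    (hB : ∀ x, |v x| ≤ B) : LipschitzWith (2 * B * C) fun x => v x ^ 2 := by
  refine LipschitzWith.of_dist_le_mul fun x y => ?_
  have h1 := hv.dist_le_mul x y
  rw [Real.dist_eq] at h1 ⊢
  have h2 : v x ^ 2 - v y ^ 2 = (v x + v y) * (v x - v y) := by ring
  have h3 : |v x + v y| ≤ 2 * B := (abs_add_le _ _).trans (by linarith [hB x, hB y])
  rw [h2, abs_mul]
  calc |v x + v y| * |v x - v y| ≤ (2 * B) * (C * dist x y) := by gcongr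
    _ = _ := by push_cast; ring

theorem LipschitzWith.exists_bound_of_hasCompactSupport {v : Plane → ℝ} {C : ℝ≥0}
    (hv : LipschitzWith C v) (hvc : HasCompactSupport v) : ∃ B : ℝ≥0, ∀ x, |v x| ≤ B := by
  obtain ⟨B, hB⟩ := hv.continuous.bounded_above_of_compact_support hvc
  exact ⟨B.toNNReal, fun x => (hB x).trans (Real.le_coe_toNNReal B)⟩

theorem gradient_sq_eq {v : Plane → ℝ} {x : Plane} (h : DifferentiableAt ℝ v x) :
    gradient (fun y => v y ^ 2) x = (2 * v x) • gradient v x := by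
  have h1 := (h.hasGradientAt.hasFDerivAt).pow 2
  have : HasGradientAt (fun y => v y ^ 2) ((2 * v x) • gradient v x) x := by
    rw [hasGradientAt_iff_hasFDerivAt]
    simpa using h1
  exact this.gradient

theorem LipschitzWith.memLp_two_of_hasCompactSupport {v : Plane → ℝ} {C : ℝ≥0}
    (hv : LipschitzWith C v) (hvc : HasCompactSupport v) : MemLp v 2 volume :=
  hv.continuous.memLp_of_hasCompactSupport hvc

theorem LipschitzWith.memLp_two_norm_gradient {v : Plane → ℝ} {C : ℝ≥0}
    (hv : LipschitzWith C v) (hvc : HasCompactSupport v) :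
    MemLp (fun x => ‖gradient v x‖) 2 (volume : Measure Plane) := by
  have hcpt : IsCompact (tsupport v) := hvc
  have h0 : (fun x => ‖gradient v x‖) = (tsupport v).indicator fun x => ‖gradient v x‖ := by
    refine (indicator_eq_self.2 fun x hx => ?_).symm
    refine support_fderiv_subset ℝ (f := v) ?_
    simpa [norm_gradient_eq_norm_fderiv] using hx
  rw [h0, memLp_indicator_iff_restrict hcpt.measurableSet]
  have : IsFiniteMeasure (volume.restrict (tsupport v)) :=
    ⟨by simpa using hcpt.measure_lt_top⟩
  refine MemLp.of_bound (measurable_gradient v).norm.aestronglyMeasurable C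
    (Eventually.of_forall fun x => ?_)
  rw [norm_norm, norm_gradient_eq_norm_fderiv]
  exact norm_fderiv_le_of_lipschitz ℝ hv

/-- A Poincaré inequality for Lipschitz functions with bounded support. -/
theorem integral_sq_le_of_lipschitz {v : Plane → ℝ} {C : ℝ≥0} (hv : LipschitzWith C v)
    (hvc : HasCompactSupport v) {R : ℝ} (hR : 0 ≤ R) (hs : ∀ x, v x ≠ 0 → ‖x‖ ≤ R) :
    Real.sqrt (∫ x, v x ^ 2) ≤ 2 * R * Real.sqrt (∫ x, ‖gradient v x‖ ^ 2) := by
  obtain ⟨B, hB⟩ := hv.exists_bound_of_hasCompactSupport hvc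
  have hcoord : LipschitzWith 1 fun x : Plane => x 0 :=
    LipschitzWith.of_dist_le_mul fun x y => by
      simpa [dist_eq_norm] using PiLp.norm_apply_le (x - y) 0
  have hsqc : HasCompactSupport fun x => v x ^ 2 :=
    hvc.comp_left (g := fun t : ℝ => t ^ 2) (by simp)
  set e : Plane := EuclideanSpace.single 0 1 with he
  have hen : ‖e‖ = 1 := by simp [he]
  -- The coordinate `x 0` has derivative `1` along `e`, so `∫ v²` equals the integral of `x 0`
  -- against minus the derivative of `v²`. Since `|x 0| ≤ R` where `v ≠ 0`, Cauchy–Schwarz bounds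
  -- this by `2R ‖v‖ ‖∇v‖`, and one factor `‖v‖` cancels.
  have key := hcoord.integral_lineDeriv_mul_eq (μ := volume) (hv.sq_of_bounded hB) hsqc e
  have h1 : ∀ x : Plane, lineDeriv ℝ (fun x : Plane => x 0) x e = 1 := fun x => by
    have := (EuclideanSpace.proj 0 : Plane →L[ℝ] ℝ).hasFDerivAt (x := x)
    simpa [he] using (this.hasLineDerivAt e).lineDeriv
  simp only [h1, one_mul] at key
  have hint : Integrable fun x => |v x| * |‖gradient v x‖| :=
    (hv.memLp_two_of_hasCompactSupport hvc).abs.integrable_mul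
      (hv.memLp_two_norm_gradient hvc).abs
  have h2 : ∫ x, v x ^ 2 ≤ 2 * R * ∫ x, |v x| * |‖gradient v x‖| := by
    rw [key, ← integral_const_mul]
    refine (Real.le_norm_self _).trans (norm_integral_le_of_norm_le (hint.const_mul (2 * R)) ?_)
    filter_upwards [hv.ae_differentiableAt (μ := volume)] with x hx
    have hd : DifferentiableAt ℝ (fun y => v y ^ 2) x := hx.pow 2
    rw [hd.lineDeriv_eq_fderiv, ← inner_gradient_eq_fderiv, gradient_sq_eq hx, inner_smul_right,
      norm_mul, norm_mul, norm_mul]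
    have h3 : ‖inner ℝ (-e) (gradient v x)‖ ≤ ‖gradient v x‖ := by
      simpa [hen] using norm_inner_le_norm (𝕜 := ℝ) (-e) (gradient v x)
    by_cases hvx : v x = 0
    · simp [hvx]
    have h4 : ‖x 0‖ ≤ R := (PiLp.norm_apply_le x 0).trans (hs x hvx)
    simp only [abs_norm, Real.norm_ofNat, Real.norm_eq_abs (v x)]
    calc 2 * |v x| * ‖inner ℝ (-e) (gradient v x)‖ * ‖x 0‖
        ≤ 2 * |v x| * ‖gradient v x‖ * R := by gcongr
      _ = _ := by ring
  have h3 := integral_mul_le_sqrt_mul_sqrt (hv.memLp_two_of_hasCompactSupport hvc)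
    (hv.memLp_two_norm_gradient hvc)
  have ha : Real.sqrt (∫ x, v x ^ 2) ^ 2 = ∫ x, v x ^ 2 :=
    Real.sq_sqrt (integral_nonneg fun x => sq_nonneg _)
  have h0 := Real.sqrt_nonneg (∫ x, v x ^ 2)
  have hd0 := Real.sqrt_nonneg (∫ x, ‖gradient v x‖ ^ 2)
  rw [← ha] at h2
  generalize Real.sqrt (∫ x, v x ^ 2) = a at *
  generalize Real.sqrt (∫ x, ‖gradient v x‖ ^ 2) = d at *
  have h4 : a * a ≤ a * (2 * R * d) := by
    calc a * a = a ^ 2 := by ring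
      _ ≤ _ := h2
      _ ≤ 2 * R * (a * d) := by gcongr
      _ = _ := by ring
  rcases h0.eq_or_lt with rfl | h0
  · positivity
  · exact le_of_mul_le_mul_left h4 h0

/-! ### Polynomials as functions on the plane -/

/-- The function on the plane given by a polynomial in the two coordinates. -/
def evalFun (p : MvPolynomial (Fin 2) ℝ) (x : Plane) : ℝ := MvPolynomial.eval (fun i => x i) p

theorem hasFDerivAt_evalFun (p : MvPolynomial (Fin 2) ℝ) (x : Plane) :
    HasFDerivAt (evalFun p)
      (∑ i, evalFun (MvPolynomial.pderiv i p) x •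
        (EuclideanSpace.proj i : Plane →L[ℝ] ℝ)) x := by
  induction p using MvPolynomial.induction_on with
  | C a =>
    have : evalFun (MvPolynomial.C a) = fun _ => a := by ext; simp [evalFun]
    rw [this]
    simpa [evalFun] using hasFDerivAt_const a x
  | add p q hp hq =>
    have : evalFun (p + q) = fun y => evalFun p y + evalFun q y := by ext; simp [evalFun]
    rw [this]
    refine (hp.add hq).congr_fderiv ?_
    rw [← Finset.sum_add_distrib]
    refine Finset.sum_congr rfl fun i _ => ?_
    rw [← add_smul]
    simp [evalFun]
  | mul_X p j hp =>
    have : evalFun (p * MvPolynomial.X j) = fun y => evalFun p y *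
        (EuclideanSpace.proj j : Plane →L[ℝ] ℝ) y := by ext; simp [evalFun]
    rw [this]
    refine (hp.mul (EuclideanSpace.proj j : Plane →L[ℝ] ℝ).hasFDerivAt).congr_fderiv ?_
    ext v
    fin_cases j <;>
      simp [evalFun, Fin.sum_univ_two, Derivation.leibniz, MvPolynomial.pderiv_X] <;>
      ring

theorem contDiff_evalFun (p : MvPolynomial (Fin 2) ℝ) : ContDiff ℝ (⊤ : ℕ∞) (evalFun p) := by
  have h := AnalyticOnNhd.eval_continuousLinearMap' (𝕜 := ℝ)
    (fun i => (EuclideanSpace.proj i : Plane →L[ℝ] ℝ)) p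
  exact (contDiffOn_univ.1 (h.contDiffOn uniqueDiffOn_univ))

theorem continuous_evalFun (p : MvPolynomial (Fin 2) ℝ) : Continuous (evalFun p) :=
  (contDiff_evalFun p).continuous

theorem differentiable_evalFun (p : MvPolynomial (Fin 2) ℝ) : Differentiable ℝ (evalFun p) :=
  fun x => (hasFDerivAt_evalFun p x).differentiableAt

theorem continuous_gradient_evalFun (p : MvPolynomial (Fin 2) ℝ) :
    Continuous (gradient (evalFun p)) :=
  (InnerProductSpace.toDual ℝ Plane).symm.continuous.comp
    ((contDiff_evalFun p).continuous_fderiv (by simp))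

theorem norm_sq_gradient_evalFun (p : MvPolynomial (Fin 2) ℝ) (x : Plane) :
    ‖gradient (evalFun p) x‖ ^ 2
      = evalFun (MvPolynomial.pderiv 0 p) x ^ 2 + evalFun (MvPolynomial.pderiv 1 p) x ^ 2 := by
  have h : ∀ i, gradient (evalFun p) x i = evalFun (MvPolynomial.pderiv i p) x := fun i => by
    have h1 := inner_gradient_eq_fderiv (evalFun p) x (EuclideanSpace.single i 1)
    rw [(hasFDerivAt_evalFun p x).fderiv, EuclideanSpace.inner_single_left] at h1
    fin_cases i <;> simpa [Fin.sum_univ_two] using h1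
  rw [EuclideanSpace.norm_sq_eq]
  simp [Fin.sum_univ_two, h]

theorem totalDegree_pderiv_le (i : Fin 2) (p : MvPolynomial (Fin 2) ℝ) :
    (MvPolynomial.pderiv i p).totalDegree ≤ p.totalDegree := by
  conv_lhs => rw [p.as_sum, map_sum]
  refine MvPolynomial.totalDegree_finsetSum_le fun s hs => ?_
  rw [MvPolynomial.pderiv_monomial]
  refine (MvPolynomial.totalDegree_monomial_le _ _).trans ?_
  refine le_trans ?_ (MvPolynomial.le_totalDegree hs)
  rw [Finsupp.sum_fintype _ _ (by simp), Finsupp.sum_fintype _ _ (by simp)]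
  exact Finset.sum_le_sum fun j _ => by simp

theorem totalDegree_bind₁_le {f : Fin 2 → MvPolynomial (Fin 2) ℝ}
    (hf : ∀ i, (f i).totalDegree ≤ 1) (p : MvPolynomial (Fin 2) ℝ) :
    (MvPolynomial.bind₁ f p).totalDegree ≤ p.totalDegree := by
  conv_lhs => rw [p.as_sum, map_sum]
  refine MvPolynomial.totalDegree_finsetSum_le fun s hs => ?_
  rw [MvPolynomial.bind₁_monomial]
  refine (MvPolynomial.totalDegree_mul _ _).trans ?_
  rw [MvPolynomial.totalDegree_C, zero_add]
  refine (MvPolynomial.totalDegree_finsetProd _ _).trans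
    (le_trans ?_ (MvPolynomial.le_totalDegree hs))
  refine Finset.sum_le_sum fun j _ => ?_
  refine (MvPolynomial.totalDegree_pow _ _).trans ?_
  simpa using Nat.mul_le_mul_left (s j) (hf j)

/-- The restriction of a polynomial to a line is a univariate polynomial. -/
theorem exists_polynomial_lineMap (p : MvPolynomial (Fin 2) ℝ) (A B : Plane) :
    ∃ q : Polynomial ℝ, q.natDegree ≤ p.totalDegree ∧
      ∀ t : ℝ, q.eval t = evalFun p (AffineMap.lineMap A B t) := by
  let f : Fin 2 → Polynomial ℝ := fun i => Polynomial.C (A i) + Polynomial.C (B i - A i) * Polynomial.X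
  refine ⟨MvPolynomial.aeval f p, ?_, fun t => ?_⟩
  · conv_lhs => rw [p.as_sum, map_sum]
    refine Polynomial.natDegree_sum_le_of_forall_le _ _ fun s hs => ?_
    rw [MvPolynomial.aeval_monomial]
    refine (Polynomial.natDegree_C_mul_le _ _).trans ?_
    refine le_trans ?_ (MvPolynomial.le_totalDegree hs)
    refine (Polynomial.natDegree_prod_le _ _).trans (Finset.sum_le_sum fun j _ => ?_)
    refine Polynomial.natDegree_pow_le.trans ?_
    have : (f j).natDegree ≤ 1 := by
      simp only [f]
      compute_degree
    simpa using Nat.mul_le_mul_left (s j) this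
  · have h1 : (Polynomial.evalRingHom t).comp (MvPolynomial.aeval f).toRingHom
        = MvPolynomial.eval (fun i => (AffineMap.lineMap A B t : Plane) i) := by
      ext i
      · simp
      · simp [f, AffineMap.lineMap_apply]
        ring
    exact congrArg (fun g => g p) h1

theorem exists_affine_substitution (p : MvPolynomial (Fin 2) ℝ) (c : Plane) (r : ℝ) :
    ∃ q : MvPolynomial (Fin 2) ℝ, q.totalDegree ≤ p.totalDegree ∧
      ∀ y, evalFun q y = evalFun p (c + r • y) := by
  refine ⟨MvPolynomial.bind₁ (fun i => MvPolynomial.C (c i) + MvPolynomial.C r * MvPolynomial.X i) p,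
    totalDegree_bind₁_le (fun i => ?_) p, fun y => ?_⟩
  · refine (MvPolynomial.totalDegree_add _ _).trans (max_le (by simp) ?_)
    refine (MvPolynomial.totalDegree_mul _ _).trans (by simp)
  · simp only [evalFun]
    rw [MvPolynomial.eval, MvPolynomial.eval₂Hom_bind₁]
    exact congrArg (fun g => MvPolynomial.eval₂Hom (RingHom.id ℝ) g p) (funext fun i => by simp)

theorem evalFun_injective_of_eqOn_ball {p : MvPolynomial (Fin 2) ℝ} {r : ℝ} (hr : 0 < r)
    {c : Plane} (h : ∀ x ∈ Metric.ball c r, evalFun p x = 0) : p = 0 := by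
  -- The open square of half-width `r / 2` lies in the disk, and a product of infinite sets
  -- determines a polynomial.
  refine MvPolynomial.funext_set (fun i => Ioo (c i - r / 2) (c i + r / 2))
    (fun i => Ioo_infinite (by linarith)) fun x hx => ?_
  have := h (WithLp.toLp 2 x) ?_
  · simpa [evalFun] using this
  · rw [Metric.mem_ball, EuclideanSpace.dist_eq, Real.sqrt_lt' hr]
    have h0 := hx 0 (mem_univ _)
    have h1 := hx 1 (mem_univ _)
    simp only [Fin.sum_univ_two, Real.dist_eq, sq_abs]
    simp only [mem_Ioo] at h0 h1
    nlinarith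

/-! ### Inverse inequalities for polynomials of bounded degree -/

/-- Linear maps on a finite-dimensional normed space are bounded. Taking the inner product as a
`Core` keeps the `L²` norm on polynomials local to the proof, without a global instance. -/
theorem InnerProductSpace.Core.exists_norm_sq_le {E F : Type*} [AddCommGroup E] [Module ℝ E]
    [FiniteDimensional ℝ E] [NormedAddCommGroup F] [NormedSpace ℝ F]
    (core : InnerProductSpace.Core ℝ E) (L : E →ₗ[ℝ] F) :
    ∃ C : ℝ, 0 ≤ C ∧ ∀ x, ‖L x‖ ^ 2 ≤ C * core.inner x x := by
  let _ : NormedAddCommGroup E := core.toNormedAddCommGroup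
  let _ : InnerProductSpace ℝ E := InnerProductSpace.ofCore core.toCore
  refine ⟨‖L.toContinuousLinearMap‖ ^ 2, sq_nonneg _, fun x => ?_⟩
  have h : core.inner x x = ‖x‖ ^ 2 := real_inner_self_eq_norm_sq x
  rw [h, ← mul_pow]
  gcongr
  exact L.toContinuousLinearMap.le_opNorm x

/-- On polynomials of bounded degree, the `L²` norm over the unit disk controls the values in any
larger disk. -/
theorem exists_sq_evalFun_le_integral (k : ℕ) (R : ℝ) : ∃ C : ℝ, 0 ≤ C ∧
    ∀ p : MvPolynomial (Fin 2) ℝ, p.totalDegree ≤ k → ∀ y ∈ Metric.closedBall (0 : Plane) R,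
      evalFun p y ^ 2 ≤ C * ∫ x in Metric.closedBall (0 : Plane) 1, evalFun p x ^ 2 := by
  let E := MvPolynomial.restrictTotalDegree (Fin 2) ℝ k
  have hint : ∀ p q : MvPolynomial (Fin 2) ℝ, IntegrableOn (fun x => evalFun p x * evalFun q x)
      (Metric.closedBall (0 : Plane) 1) := fun p q =>
    ((continuous_evalFun p).mul (continuous_evalFun q)).continuousOn.integrableOn_compact
      (isCompact_closedBall _ _)
  let core : InnerProductSpace.Core ℝ E :=
    { inner := fun p q => ∫ x in Metric.closedBall (0 : Plane) 1, evalFun p.1 x * evalFun q.1 x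
      conj_inner_symm := fun p q => by simp [mul_comm]
      re_inner_nonneg := fun p => integral_nonneg fun x => mul_self_nonneg _
      add_left := fun p q r => by
        rw [← integral_add (hint _ _) (hint _ _)]
        congr 1 with x
        simp [evalFun, add_mul]
      smul_left := fun p q r => by
        simp only [conj_trivial]
        rw [← integral_const_mul]
        congr 1 with x
        simp [evalFun, MvPolynomial.smul_eval, mul_assoc]
      -- A polynomial with zero `L²` norm vanishes almost everywhere, hence by continuity everywhere
      -- on the open disk, hence identically.
      definite := fun p hp => by
        have h0 : (fun x => evalFun p.1 x * evalFun p.1 x)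
            =ᵐ[volume.restrict (Metric.closedBall (0 : Plane) 1)] 0 :=
          (integral_eq_zero_iff_of_nonneg (fun x => mul_self_nonneg _) (hint _ _)).1 hp
        have h1 := ae_restrict_of_ae_restrict_of_subset Metric.ball_subset_closedBall h0
        have h2 := Measure.eqOn_open_of_ae_eq h1 Metric.isOpen_ball
          ((continuous_evalFun p.1).mul (continuous_evalFun p.1)).continuousOn
          continuousOn_const
        exact Subtype.ext (evalFun_injective_of_eqOn_ball one_pos
          fun x hx => mul_self_eq_zero.1 (h2 hx)) }
  have : CompactSpace (Metric.closedBall (0 : Plane) R) :=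
    isCompact_iff_compactSpace.1 (isCompact_closedBall _ _)
  let L : E →ₗ[ℝ] C(Metric.closedBall (0 : Plane) R, ℝ) :=
    { toFun := fun p => ⟨fun y => evalFun p.1 y,
        (continuous_evalFun p.1).comp continuous_subtype_val⟩
      map_add' := fun p q => by ext; simp [evalFun]
      map_smul' := fun r p => by ext; simp [evalFun, MvPolynomial.smul_eval] }
  obtain ⟨C, hC, h⟩ := core.exists_norm_sq_le L
  refine ⟨C, hC, fun p hp y hy => ?_⟩
  let P : E := ⟨p, (MvPolynomial.mem_restrictTotalDegree _ _ _).2 hp⟩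
  have h1 : |evalFun p y| ≤ ‖L P‖ := (L P).norm_coe_le_norm ⟨y, hy⟩
  rw [← sq_abs]
  calc |evalFun p y| ^ 2 ≤ ‖L P‖ ^ 2 := by gcongr
    _ ≤ C * ∫ x in Metric.closedBall (0 : Plane) 1, evalFun p x * evalFun p x := h P
    _ = _ := by simp only [sq]

theorem setIntegral_closedBall_comp (F : Plane → ℝ) (c : Plane) {ρ : ℝ} (hρ : 0 < ρ) :
    ∫ y in Metric.closedBall (0 : Plane) 1, F (c + ρ • y)
      = (ρ ^ 2)⁻¹ * ∫ x in Metric.closedBall c ρ, F x := by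
  rw [← integral_indicator Metric.isClosed_closedBall.measurableSet,
    ← integral_indicator Metric.isClosed_closedBall.measurableSet,
    ← integral_add_left_eq_self (fun x => (Metric.closedBall c ρ).indicator F x) c]
  have h := Measure.integral_comp_smul (volume : Measure Plane)
    (fun x => (Metric.closedBall c ρ).indicator F (c + x)) ρ
  rw [finrank_euclideanSpace_fin, abs_of_nonneg (by positivity), smul_eq_mul] at h
  rw [← h]
  congr 1 with y
  have : c + ρ • y ∈ Metric.closedBall c ρ ↔ y ∈ Metric.closedBall (0 : Plane) 1 := by
    simp [norm_smul, abs_of_pos hρ, hρ]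
  by_cases hy : y ∈ Metric.closedBall (0 : Plane) 1
  · rw [indicator_of_mem hy, indicator_of_mem (this.2 hy)]
  · rw [indicator_of_notMem hy, indicator_of_notMem (mt this.1 hy)]

/-- An inverse inequality for the gradients of polynomials, on a disk of any size. -/
theorem exists_norm_sq_gradient_evalFun_le (k : ℕ) (R : ℝ) : ∃ C : ℝ, 0 ≤ C ∧
    ∀ p : MvPolynomial (Fin 2) ℝ, p.totalDegree ≤ k → ∀ (c : Plane) (ρ : ℝ), 0 < ρ →
      ∀ y ∈ Metric.closedBall c (R * ρ), ‖gradient (evalFun p) y‖ ^ 2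
        ≤ C / ρ ^ 2 * ∫ x in Metric.closedBall c ρ, ‖gradient (evalFun p) x‖ ^ 2 := by
  obtain ⟨C, hC, h⟩ := exists_sq_evalFun_le_integral k R
  refine ⟨C, hC, fun p hp c ρ hρ y hy => ?_⟩
  have hq : ∀ i, evalFun (MvPolynomial.pderiv i p) y ^ 2 ≤ C / ρ ^ 2 *
      ∫ x in Metric.closedBall c ρ, evalFun (MvPolynomial.pderiv i p) x ^ 2 := fun i => by
    -- The unit disk estimate is applied to the partial derivatives themselves, so rescaling
    -- contributes only the area factor `ρ ^ 2`.
    obtain ⟨q, hq, hqe⟩ := exists_affine_substitution (MvPolynomial.pderiv i p) c ρ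
    have h1 := h q (hq.trans ((totalDegree_pderiv_le i p).trans hp)) (ρ⁻¹ • (y - c)) ?_
    · simp only [hqe] at h1
      rw [setIntegral_closedBall_comp (fun x => evalFun (MvPolynomial.pderiv i p) x ^ 2) c hρ,
        smul_inv_smul₀ hρ.ne', add_sub_cancel] at h1
      rw [div_eq_mul_inv, mul_assoc]
      exact h1
    · rw [mem_closedBall_zero_iff, norm_smul, norm_inv, Real.norm_of_nonneg hρ.le,
        inv_mul_le_iff₀ hρ, mul_comm]
      simpa [dist_eq_norm] using hy
  have hi : ∀ i, IntegrableOn (fun x => evalFun (MvPolynomial.pderiv i p) x ^ 2)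
      (Metric.closedBall c ρ) := fun i =>
    ((continuous_evalFun _).pow 2).continuousOn.integrableOn_compact (isCompact_closedBall _ _)
  simp only [norm_sq_gradient_evalFun]
  rw [integral_add (hi 0) (hi 1), mul_add]
  exact add_le_add (hq 0) (hq 1)

/-! ### The correction polynomials of a single triangle -/

section

theorem exists_evalFun_eq_affineMap (f : Plane →ᵃ[ℝ] ℝ) :
    ∃ p : MvPolynomial (Fin 2) ℝ, p.totalDegree ≤ 1 ∧ ∀ x, evalFun p x = f x := by
  refine ⟨MvPolynomial.C (f 0) + ∑ i, MvPolynomial.C (f.linear (EuclideanSpace.single i 1)) *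
    MvPolynomial.X i, ?_, fun x => ?_⟩
  · refine (MvPolynomial.totalDegree_add _ _).trans (max_le (by simp) ?_)
    refine MvPolynomial.totalDegree_finsetSum_le fun i _ => ?_
    exact (MvPolynomial.totalDegree_mul _ _).trans (by simp)
  · have h1 : f x = f.linear x + f 0 := by
      have := f.map_vadd 0 x
      simpa using this
    have h2 : x = ∑ i, x i • EuclideanSpace.single i (1 : ℝ) := by
      ext j
      fin_cases j <;> simp
    rw [h1]
    conv_rhs => rw [h2, map_sum]
    simp only [evalFun, map_add, map_sum, map_mul, MvPolynomial.eval_C, MvPolynomial.eval_X,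
      map_smul, smul_eq_mul, mul_comm]
    ring

/-- The point dividing the edge opposite to the vertex `β 0` in the ratio `j : k - j`. -/
def edgePoint (β : AffineBasis (Fin 3) ℝ Plane) (k j : ℕ) : Plane :=
  AffineMap.lineMap (β 1) (β 2) ((j : ℝ) / k)

/-- The factor of `edgeBump` that vanishes on the line through `β 0` and `edgePoint β k i`. -/
def edgeFactor (β : AffineBasis (Fin 3) ℝ Plane) (k j i : ℕ) (x : Plane) : ℝ :=
  (((k : ℝ) - i) * β.coord 2 x - i * β.coord 1 x) / ((j : ℝ) - i)

/-- The polynomial, homogeneous of degree `k` with respect to the vertex `β 0`, that takes the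
value `1` at `edgePoint β k j` and vanishes at the other points of this kind. -/
def edgeBump (β : AffineBasis (Fin 3) ℝ Plane) (k j : ℕ) (x : Plane) : ℝ :=
  ∏ i ∈ (Finset.range (k + 1)).erase j, edgeFactor β k j i x

variable {β : AffineBasis (Fin 3) ℝ Plane} {k : ℕ}

theorem coord_lineMap_zero (i : Fin 3) (hi : i ≠ 0) (x : Plane) (τ : ℝ) :
    β.coord i (AffineMap.lineMap (β 0) x τ) = τ * β.coord i x := by
  rw [AffineMap.apply_lineMap, AffineMap.lineMap_apply, β.coord_apply_ne hi]
  simp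

theorem coord_one_edgePoint (j : ℕ) : β.coord 1 (edgePoint β k j) = 1 - (j : ℝ) / k := by
  rw [edgePoint, AffineMap.apply_lineMap, AffineMap.lineMap_apply, β.coord_apply_eq,
    β.coord_apply_ne (by decide)]
  simp
  ring

theorem coord_two_edgePoint (j : ℕ) : β.coord 2 (edgePoint β k j) = (j : ℝ) / k := by
  rw [edgePoint, AffineMap.apply_lineMap, AffineMap.lineMap_apply, β.coord_apply_eq,
    β.coord_apply_ne (by decide)]
  simp

theorem coord_zero_edgePoint (j : ℕ) : β.coord 0 (edgePoint β k j) = 0 := by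
  rw [edgePoint, AffineMap.apply_lineMap, AffineMap.lineMap_apply, β.coord_apply_ne (by decide),
    β.coord_apply_ne (by decide)]
  simp

theorem edgePoint_mem (hk : 0 < k) {j : ℕ} (hj : j ≤ k) :
    edgePoint β k j ∈ segment ℝ (β 1) (β 2) := by
  rw [segment_eq_image_lineMap]
  refine ⟨(j : ℝ) / k, ⟨by positivity, ?_⟩, rfl⟩
  rw [div_le_one (by exact_mod_cast hk)]
  exact_mod_cast hj

theorem exists_evalFun_eq_edgeBump {j : ℕ} (hj : j ≤ k) :
    ∃ p : MvPolynomial (Fin 2) ℝ, p.totalDegree ≤ k ∧ ∀ x, evalFun p x = edgeBump β k j x := by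
  obtain ⟨p1, hp1, h1⟩ := exists_evalFun_eq_affineMap (β.coord 1)
  obtain ⟨p2, hp2, h2⟩ := exists_evalFun_eq_affineMap (β.coord 2)
  refine ⟨∏ i ∈ (Finset.range (k + 1)).erase j, (((k - i) / (j - i) : ℝ) • p2 -
    ((i / (j - i) : ℝ)) • p1), ?_, fun x => ?_⟩
  · refine (MvPolynomial.totalDegree_finsetProd _ _).trans ?_
    have hcard : ((Finset.range (k + 1)).erase j).card = k := by
      rw [Finset.card_erase_of_mem (by simpa using Nat.lt_succ_of_le hj)]
      simp
    refine (Finset.sum_le_card_nsmul _ _ 1 fun i _ => ?_).trans (by simp [hcard])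
    refine (MvPolynomial.totalDegree_sub _ _).trans (max_le ?_ ?_)
    · exact (MvPolynomial.totalDegree_smul_le _ _).trans hp2
    · exact (MvPolynomial.totalDegree_smul_le _ _).trans hp1
  · simp only [evalFun, map_prod, edgeBump]
    refine Finset.prod_congr rfl fun i _ => ?_
    rw [edgeFactor, ← h1, ← h2]
    simp only [evalFun, map_sub, MvPolynomial.smul_eval]
    ring

/-- The factor of index `0` is a multiple of the coordinate `2`; likewise the factor of index `k` is
a multiple of the coordinate `1`. For `0 < j < k` both occur, so the bump vanishes on the two edges
through `β 0` and can be continued by zero across them. -/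
theorem edgeBump_eq_zero_of_coord_two {j : ℕ} (hj : 0 < j) {x : Plane} (hx : β.coord 2 x = 0) :
    edgeBump β k j x = 0 :=
  Finset.prod_eq_zero (i := 0) (by simp [hj.ne]) (by simp [edgeFactor, hx])

theorem edgeBump_eq_zero_of_coord_one {j : ℕ} (hj : j < k) {x : Plane} (hx : β.coord 1 x = 0) :
    edgeBump β k j x = 0 :=
  Finset.prod_eq_zero (i := k) (by simp [hj.ne']) (by simp [edgeFactor, hx])

/-- The `k` factors are linear forms in the coordinates `1` and `2`, which scale by `τ` along lines
through `β 0`. This homogeneity relates the value at a curved node to the value at the edge point on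
the same line. -/
theorem edgeBump_lineMap {j : ℕ} (hj : j ≤ k) (x : Plane) (τ : ℝ) :
    edgeBump β k j (AffineMap.lineMap (β 0) x τ) = τ ^ k * edgeBump β k j x := by
  have hcard : ((Finset.range (k + 1)).erase j).card = k := by
    rw [Finset.card_erase_of_mem (by simpa using Nat.lt_succ_of_le hj)]
    simp
  rw [edgeBump, edgeBump]
  have hprod : τ ^ k = ∏ _i ∈ (Finset.range (k + 1)).erase j, τ := by
    rw [Finset.prod_const, hcard]
  rw [hprod, ← Finset.prod_mul_distrib]
  refine Finset.prod_congr rfl fun i _ => ?_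
  rw [edgeFactor, edgeFactor, coord_lineMap_zero 2 (by decide), coord_lineMap_zero 1 (by decide)]
  ring

/-- At the edge point `i` the factor of index `l` equals `(i - l) / (j - l)`, so the product is a
Lagrange basis polynomial on the edge. -/
theorem edgeBump_edgePoint (hk : 0 < k) {i j : ℕ} (hi : i ≤ k) :
    edgeBump β k j (edgePoint β k i) = if i = j then 1 else 0 := by
  have hk' : (k : ℝ) ≠ 0 := by exact_mod_cast hk.ne'
  have hf : ∀ l, edgeFactor β k j l (edgePoint β k i) = ((i : ℝ) - l) / ((j : ℝ) - l) := fun l => by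
    rw [edgeFactor, coord_one_edgePoint, coord_two_edgePoint]
    congr 1
    field_simp
    ring
  split_ifs with h
  · subst h
    refine Finset.prod_eq_one fun l hl => ?_
    rw [hf, div_self]
    rw [sub_ne_zero]
    exact_mod_cast (Finset.ne_of_mem_erase hl).symm
  · refine Finset.prod_eq_zero (i := i) ?_ (by rw [hf]; simp)
    simp [h, Nat.lt_succ_of_le hi]

theorem coord_mem_Icc {x : Plane} (hx : x ∈ convexHull ℝ (range β)) (i : Fin 3) :
    β.coord i x ∈ Icc (0 : ℝ) 1 := by
  rw [β.convexHull_eq_nonneg_coord] at hx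
  have h := β.sum_coord_apply_eq_one x
  rw [Fin.sum_univ_three] at h
  have h0 := hx 0
  have h1 := hx 1
  have h2 := hx 2
  fin_cases i <;> constructor <;> simp <;> linarith

/-- The derivative of a barycentric coordinate. -/
def coordDeriv (β : AffineBasis (Fin 3) ℝ Plane) (i : Fin 3) : Plane →L[ℝ] ℝ :=
  LinearMap.toContinuousLinearMap (β.coord i).linear

theorem hasFDerivAt_coord (i : Fin 3) (x : Plane) :
    HasFDerivAt (β.coord i) (coordDeriv β i) x := by
  have h : (β.coord i : Plane → ℝ) = fun y => coordDeriv β i y + β.coord i 0 := by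
    ext y
    have := (β.coord i).map_vadd 0 y
    simpa [coordDeriv] using this
  rw [h]
  exact (coordDeriv β i).hasFDerivAt.add_const _

/-- A barycentric coordinate stays in `[0, 1]` on the triangle, so it changes by at most `1` between
the centre of the disk and a point at distance `ρ` in any direction. -/
theorem norm_coordDeriv_le {c : Plane} {ρ : ℝ} (hρ : 0 < ρ)
    (hball : Metric.closedBall c ρ ⊆ convexHull ℝ (range β)) (i : Fin 3) :
    ‖coordDeriv β i‖ ≤ 1 / ρ := by
  refine ContinuousLinearMap.opNorm_le_bound _ (by positivity) fun v => ?_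
  rcases eq_or_ne v 0 with rfl | hv
  · simp
  have hv' : 0 < ‖v‖ := norm_pos_iff.2 hv
  have h1 := coord_mem_Icc (hball (Metric.mem_closedBall_self hρ.le)) i
  have hmem : (ρ / ‖v‖) • v + c ∈ Metric.closedBall c ρ := by
    rw [mem_closedBall_iff_norm]
    simp [norm_smul, abs_of_pos hρ, hv'.ne']
  have h2 := coord_mem_Icc (hball hmem) i
  have h3 : β.coord i ((ρ / ‖v‖) • v + c) = (ρ / ‖v‖) * coordDeriv β i v + β.coord i c := by
    have := (β.coord i).map_vadd c ((ρ / ‖v‖) • v)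
    simpa [coordDeriv] using this
  rw [h3] at h2
  have h4 : |(ρ / ‖v‖) * coordDeriv β i v| ≤ 1 :=
    abs_le.2 ⟨by linarith [h1.2, h2.1], by linarith [h1.1, h2.2]⟩
  rw [abs_mul, abs_of_pos (by positivity)] at h4
  rw [Real.norm_eq_abs]
  calc |coordDeriv β i v| = (‖v‖ / ρ) * (ρ / ‖v‖ * |coordDeriv β i v|) := by field_simp
    _ ≤ (‖v‖ / ρ) * 1 := by gcongr
    _ = _ := by ring

/-- The product rule gives `k` terms, each with `k - 1` factors of size at most `k` and one
differentiated factor of size at most `k / ρ`; the denominators `j - i` are nonzero integers and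
only help. -/
theorem norm_gradient_edgeBump_le {c : Plane} {ρ : ℝ} (hρ : 0 < ρ)
    (hball : Metric.closedBall c ρ ⊆ convexHull ℝ (range β)) {j : ℕ} (hk : 0 < k)
    (hj : j ≤ k) {x : Plane} (hx : x ∈ convexHull ℝ (range β)) :
    DifferentiableAt ℝ (edgeBump β k j) x ∧
      ‖gradient (edgeBump β k j) x‖ ≤ (k : ℝ) ^ (k + 1) / ρ := by
  classical
  have hk1 : (1 : ℝ) ≤ k := by exact_mod_cast hk
  let L : ℕ → Plane →L[ℝ] ℝ := fun i =>
    ((j : ℝ) - i)⁻¹ • (((k : ℝ) - i) • coordDeriv β 2 - (i : ℝ) • coordDeriv β 1)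
  have hL : ∀ i, HasFDerivAt (edgeFactor β k j i) (L i) x := fun i => by
    have := (((hasFDerivAt_coord (β := β) 2 x).const_smul ((k : ℝ) - i)).sub
      ((hasFDerivAt_coord (β := β) 1 x).const_smul (i : ℝ))).const_smul ((j : ℝ) - i)⁻¹
    refine this.congr_of_eventuallyEq (Eventually.of_forall fun y => ?_)
    simp [edgeFactor, div_eq_inv_mul]
  have hinv : ∀ i ∈ (Finset.range (k + 1)).erase j, |((j : ℝ) - i)⁻¹| ≤ 1 := fun i hi => by
    rw [abs_inv]
    refine inv_le_one_of_one_le₀ ?_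
    have h1 : (j : ℤ) - i ≠ 0 := by
      have := (Finset.mem_erase.1 hi).1
      omega
    have := Int.one_le_abs h1
    exact_mod_cast this
  have hik : ∀ i ∈ (Finset.range (k + 1)).erase j, (i : ℝ) ≤ k := fun i hi => by
    have := Finset.mem_range.1 (Finset.mem_erase.1 hi).2
    exact_mod_cast Nat.lt_succ_iff.1 this
  have hLn : ∀ i ∈ (Finset.range (k + 1)).erase j, ‖L i‖ ≤ k / ρ := fun i hi => by
    have h1 := hik i hi
    have hd1 := norm_coordDeriv_le hρ hball 1
    have hd2 := norm_coordDeriv_le hρ hball 2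
    rw [norm_smul, Real.norm_eq_abs]
    refine (mul_le_of_le_one_left (norm_nonneg _) (hinv i hi)).trans ?_
    refine (norm_sub_le _ _).trans ?_
    rw [norm_smul, norm_smul, Real.norm_of_nonneg (by linarith), Real.norm_of_nonneg (by simp)]
    calc ((k : ℝ) - i) * ‖coordDeriv β 2‖ + i * ‖coordDeriv β 1‖
        ≤ ((k : ℝ) - i) * (1 / ρ) + i * (1 / ρ) := by gcongr
      _ = k / ρ := by ring
  have hfn : ∀ i ∈ (Finset.range (k + 1)).erase j, ‖edgeFactor β k j i x‖ ≤ k := fun i hi => by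
    have h1 := hik i hi
    have hc1 := coord_mem_Icc hx 1
    have hc2 := coord_mem_Icc hx 2
    rw [edgeFactor, div_eq_inv_mul, norm_mul, Real.norm_eq_abs]
    refine (mul_le_of_le_one_left (norm_nonneg _) (hinv i hi)).trans ?_
    have hi0 : (0 : ℝ) ≤ i := by positivity
    rw [Real.norm_eq_abs, abs_le]
    constructor <;> nlinarith [hc1.1, hc1.2, hc2.1, hc2.2]
  have hcard : ((Finset.range (k + 1)).erase j).card = k := by
    rw [Finset.card_erase_of_mem (by simpa using Nat.lt_succ_of_le hj)]
    simp
  have hder : HasFDerivAt (edgeBump β k j) (∑ i ∈ (Finset.range (k + 1)).erase j,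
      (∏ l ∈ ((Finset.range (k + 1)).erase j).erase i, edgeFactor β k j l x) • L i) x :=
    HasFDerivAt.finsetProd fun i _ => hL i
  refine ⟨hder.differentiableAt, ?_⟩
  rw [norm_gradient_eq_norm_fderiv, hder.fderiv]
  refine (norm_sum_le_of_le (n := fun _ => (k : ℝ) ^ k / ρ) _ fun i hi => ?_).trans ?_
  · rw [norm_smul, norm_prod]
    have h1 : ∏ l ∈ ((Finset.range (k + 1)).erase j).erase i, ‖edgeFactor β k j l x‖
        ≤ (k : ℝ) ^ (k - 1) := by
      have := Finset.prod_le_prod (s := ((Finset.range (k + 1)).erase j).erase i)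
        (f := fun l => ‖edgeFactor β k j l x‖) (g := fun _ => (k : ℝ)) (fun l _ => norm_nonneg _)
        (fun l hl => hfn l (Finset.mem_of_mem_erase hl))
      rwa [Finset.prod_const, Finset.card_erase_of_mem hi, hcard] at this
    calc _ ≤ (k : ℝ) ^ (k - 1) * (k / ρ) := by
          gcongr
          exact hLn i hi
      _ = (k : ℝ) ^ k / ρ := by
          obtain ⟨m, rfl⟩ : ∃ m, k = m + 1 := ⟨k - 1, by omega⟩
          rw [Nat.add_sub_cancel, pow_succ]
          ring
  · rw [Finset.sum_const, hcard, nsmul_eq_mul, pow_succ]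
    exact le_of_eq (by ring)

/-- The combination of the functions `edgeBump β k j` that has prescribed values at the points
`edgePoint β k j`, for `0 < j < k`. -/
def edgeCorrection (β : AffineBasis (Fin 3) ℝ Plane) (k : ℕ) (y : ℕ → ℝ) (x : Plane) : ℝ :=
  ∑ j ∈ Finset.Ioo 0 k, y j * edgeBump β k j x

theorem norm_gradient_edgeCorrection_le {c : Plane} {ρ : ℝ} (hρ : 0 < ρ)
    (hball : Metric.closedBall c ρ ⊆ convexHull ℝ (range β)) (hk : 0 < k) {y : ℕ → ℝ} {m : ℝ}
    (hm : 0 ≤ m) (hy : ∀ j ∈ Finset.Ioo 0 k, |y j| ≤ m)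
    {x : Plane} (hx : x ∈ convexHull ℝ (range β)) :
    ‖gradient (edgeCorrection β k y) x‖ ≤ (k : ℝ) ^ (k + 2) * m / ρ := by
  have hd : ∀ j ∈ Finset.Ioo 0 k, HasFDerivAt (fun x => y j * edgeBump β k j x)
      (y j • fderiv ℝ (edgeBump β k j) x) x := fun j hj =>
    ((norm_gradient_edgeBump_le hρ hball hk (Finset.mem_Ioo.1 hj).2.le
      hx).1.hasFDerivAt.const_mul _)
  have hder : HasFDerivAt (edgeCorrection β k y) (∑ j ∈ Finset.Ioo 0 k,
      y j • fderiv ℝ (edgeBump β k j) x) x := HasFDerivAt.fun_sum hd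
  rw [norm_gradient_eq_norm_fderiv, hder.fderiv]
  refine (norm_sum_le_of_le (n := fun _ => m * ((k : ℝ) ^ (k + 1) / ρ)) _ fun j hj => ?_).trans ?_
  · rw [norm_smul, ← norm_gradient_eq_norm_fderiv, Real.norm_eq_abs]
    have := (norm_gradient_edgeBump_le hρ hball hk (Finset.mem_Ioo.1 hj).2.le hx).2
    exact mul_le_mul (hy j hj) this (norm_nonneg _) hm
  · rw [Finset.sum_const, nsmul_eq_mul]
    have : ((Finset.Ioo 0 k).card : ℝ) ≤ k := by
      rw [Nat.card_Ioo]
      exact_mod_cast (by omega : k - 0 - 1 ≤ k)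
    calc _ ≤ (k : ℝ) * (m * ((k : ℝ) ^ (k + 1) / ρ)) := by gcongr
      _ = _ := by ring

/-! ### Smallness of the correction in one triangle -/

/-- On a shape-regular triangle, a polynomial that vanishes close to the points of an edge is almost
zero at these points, and the energy of the corresponding correction is small. -/
theorem exists_edgeCorrection_estimate (k : ℕ) (hk : 0 < k) (σ : ℝ) (hσ : 0 ≤ σ) :
    ∃ C : ℝ, 0 ≤ C ∧ ∀ (β : AffineBasis (Fin 3) ℝ Plane) (c : Plane) (ρ : ℝ), 0 < ρ →
      Metric.closedBall c ρ ⊆ convexHull ℝ (range β) →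
      Metric.diam (convexHull ℝ (range β)) ≤ σ * ρ →
      ∀ p : MvPolynomial (Fin 2) ℝ, p.totalDegree ≤ k → ∀ ε : ℝ, 0 ≤ ε → ε ≤ 1 →
      (∀ j ∈ Finset.Ioo 0 k, ∃ s : ℝ, |s| ≤ ε ∧
        evalFun p (AffineMap.lineMap (β 0) (edgePoint β k j) (1 + s)) = 0) →
      (∀ j ∈ Finset.Ioo 0 k, evalFun p (edgePoint β k j) ^ 2
        ≤ (C * ε) ^ 2 * ∫ x in convexHull ℝ (range β), ‖gradient (evalFun p) x‖ ^ 2) ∧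
      ∫ x in convexHull ℝ (range β), ‖gradient (edgeCorrection β k fun j => evalFun p (edgePoint β k j)) x‖ ^ 2
        ≤ (C * ε) ^ 2 * ∫ x in convexHull ℝ (range β), ‖gradient (evalFun p) x‖ ^ 2 := by
  -- The disk of radius `2 σ ρ` about `c` contains the triangle and also the nodes, which lie at
  -- most `ε σ ρ ≤ σ ρ` beyond an edge point.
  obtain ⟨C₀, hC₀, hinv⟩ := exists_norm_sq_gradient_evalFun_le k (2 * σ)
  let V : ℝ := volume.real (Metric.closedBall (0 : Plane) 1)
  have hV : 0 ≤ V := measureReal_nonneg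
  let D : ℝ := σ * Real.sqrt C₀
  have hD : 0 ≤ D := by positivity
  let G : ℝ := (k : ℝ) ^ (k + 2) * D * (σ * Real.sqrt V)
  have hG : 0 ≤ G := by positivity
  refine ⟨D + G, by positivity, fun β c ρ hρ hball hdiam p hp ε hε hε1 hnode => ?_⟩
  set T := convexHull ℝ (range β) with hT
  have hTc : IsCompact T := (finite_range β).isCompact_convexHull ℝ
  set I := ∫ x in T, ‖gradient (evalFun p) x‖ ^ 2 with hI
  have hI0 : 0 ≤ I := integral_nonneg fun x => sq_nonneg _
  have hint : IntegrableOn (fun x => ‖gradient (evalFun p) x‖ ^ 2) T :=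
    ((continuous_gradient_evalFun p).norm.pow 2).continuousOn.integrableOn_compact hTc
  have hIball : ∫ x in Metric.closedBall c ρ, ‖gradient (evalFun p) x‖ ^ 2 ≤ I :=
    setIntegral_mono_set hint (Eventually.of_forall fun x => sq_nonneg _) hball.eventuallyLE
  have hgrad : ∀ y ∈ Metric.closedBall c (2 * σ * ρ),
      ‖fderiv ℝ (evalFun p) y‖ ≤ Real.sqrt C₀ * Real.sqrt I / ρ := fun y hy => by
    rw [← norm_gradient_eq_norm_fderiv]
    refine (pow_le_pow_iff_left₀ (norm_nonneg _) (by positivity) two_ne_zero).1 ?_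
    rw [div_pow, mul_pow, Real.sq_sqrt hC₀, Real.sq_sqrt hI0]
    calc _ ≤ _ := hinv p hp c ρ hρ y hy
      _ ≤ C₀ / ρ ^ 2 * I := by gcongr
      _ = _ := by ring
  have hc : c ∈ T := hball (Metric.mem_closedBall_self hρ.le)
  have hO : β 0 ∈ T := subset_convexHull ℝ _ (mem_range_self 0)
  have hM : ∀ j ∈ Finset.Ioo 0 k, edgePoint β k j ∈ T := fun j hj =>
    (convex_convexHull ℝ _).segment_subset (subset_convexHull ℝ _ (mem_range_self 1))
      (subset_convexHull ℝ _ (mem_range_self 2)) (edgePoint_mem hk (Finset.mem_Ioo.1 hj).2.le)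
  -- Mean value theorem between the zero `P` of `p` and the edge point `M`: the distance is at most
  -- `ε σ ρ` and the gradient at most `√(C₀ I) / ρ`, so `ρ` cancels.
  have hval : ∀ j ∈ Finset.Ioo 0 k, |evalFun p (edgePoint β k j)| ≤ D * ε * Real.sqrt I := by
    intro j hj
    obtain ⟨s, hs, hps⟩ := hnode j hj
    set M := edgePoint β k j with hMdef
    set P : Plane := AffineMap.lineMap (β 0) M (1 + s) with hP
    have hMc : dist M c ≤ σ * ρ := (Metric.dist_le_diam_of_mem hTc.isBounded (hM j hj) hc).trans hdiam
    have hMO : dist (β 0) M ≤ σ * ρ :=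
      (Metric.dist_le_diam_of_mem hTc.isBounded hO (hM j hj)).trans hdiam
    have hPM : dist P M ≤ ε * (σ * ρ) := by
      rw [hP, dist_lineMap_right]
      simp only [sub_add_cancel_left, norm_neg, Real.norm_eq_abs]
      gcongr
    have hσρ : 0 ≤ σ * ρ := by positivity
    have hPc : P ∈ Metric.closedBall c (2 * σ * ρ) := by
      rw [Metric.mem_closedBall]
      calc dist P c ≤ dist P M + dist M c := dist_triangle _ _ _
        _ ≤ ε * (σ * ρ) + σ * ρ := by gcongr
        _ ≤ 1 * (σ * ρ) + σ * ρ := by gcongr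
        _ = _ := by ring
    have hMc' : M ∈ Metric.closedBall c (2 * σ * ρ) := by
      rw [Metric.mem_closedBall]
      linarith
    have h := (convex_closedBall c (2 * σ * ρ)).norm_image_sub_le_of_norm_fderiv_le
      (fun y _ => differentiable_evalFun p y) hgrad hPc hMc'
    rw [hps, sub_zero, Real.norm_eq_abs, ← dist_eq_norm, dist_comm] at h
    calc _ ≤ _ := h
      _ ≤ Real.sqrt C₀ * Real.sqrt I / ρ * (ε * (σ * ρ)) := by gcongr
      _ = D * ε * Real.sqrt I := by
        simp only [D]
        field_simp
  refine ⟨fun j hj => ?_, ?_⟩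
  · rw [← sq_abs]
    calc |evalFun p (edgePoint β k j)| ^ 2 ≤ (D * ε * Real.sqrt I) ^ 2 := by
          gcongr
          exact hval j hj
      _ = (D * ε) ^ 2 * I := by rw [mul_pow, Real.sq_sqrt hI0]
      _ ≤ ((D + G) * ε) ^ 2 * I := by
          gcongr
          linarith
  -- The area is of order `ρ ^ 2`, which absorbs the `1 / ρ ^ 2` of the squared gradient bound.
  · have hvol : volume.real T ≤ (σ * ρ) ^ 2 * V := by
      have h1 : T ⊆ Metric.closedBall c (σ * ρ) := fun y hy =>
        (Metric.dist_le_diam_of_mem hTc.isBounded hy hc).trans hdiam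
      refine (measureReal_mono h1 measure_closedBall_lt_top.ne).trans_eq ?_
      simp only [V, measureReal_def]
      rw [Measure.addHaar_closedBall' volume c (by positivity : 0 ≤ σ * ρ), ENNReal.toReal_mul,
        finrank_euclideanSpace_fin, ENNReal.toReal_ofReal (by positivity)]
    have hb : ∀ x ∈ T, ‖gradient (edgeCorrection β k fun j => evalFun p (edgePoint β k j)) x‖ ^ 2
        ≤ ((k : ℝ) ^ (k + 2) * (D * ε * Real.sqrt I) / ρ) ^ 2 := fun x hx => by
      gcongr
      exact norm_gradient_edgeCorrection_le hρ hball hk (by positivity) hval hx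
    have h2 := norm_setIntegral_le_of_norm_le_const (μ := volume) hTc.measure_lt_top
      (fun x hx => (Real.norm_of_nonneg (sq_nonneg _)).trans_le (hb x hx))
    refine (Real.le_norm_self _).trans (h2.trans ?_)
    calc _ ≤ ((k : ℝ) ^ (k + 2) * (D * ε * Real.sqrt I) / ρ) ^ 2 * ((σ * ρ) ^ 2 * V) := by gcongr
      _ = (G * ε) ^ 2 * I := by
        have hG2 : G ^ 2 = ((k : ℝ) ^ (k + 2)) ^ 2 * D ^ 2 * (σ ^ 2 * V) := by
          simp only [G]
          rw [mul_pow, mul_pow, mul_pow σ (Real.sqrt V), Real.sq_sqrt hV]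
        rw [mul_pow G, hG2, div_pow, mul_pow _ (D * ε * _), mul_pow (D * ε), Real.sq_sqrt hI0]
        field_simp
      _ ≤ ((D + G) * ε) ^ 2 * I := by
        gcongr
        linarith

end

/-! ### Position of the boundary nodes -/

/-- Near a boundary point, a `C¹` boundary is the zero set of a strictly differentiable function
with nonvanishing differential. -/
theorem HasC1Boundary.exists_local_equation {Ω : Set Plane} (hΩ : IsOpen Ω)
    (hC : HasC1Boundary Ω) {x₀ : Plane} (hx₀ : x₀ ∈ frontier Ω) :
    ∃ (G : Plane → ℝ) (l : Plane →L[ℝ] ℝ) (e : Plane) (r : ℝ), Continuous G ∧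
      HasStrictFDerivAt G l x₀ ∧ ‖e‖ = 1 ∧ l e = 1 ∧ 0 < r ∧
      ∀ y ∈ Metric.ball x₀ r, (y ∈ frontier Ω ↔ G y = 0) := by
  obtain ⟨r, hr, R, g, hg, hR⟩ := hC x₀ hx₀
  let p : Fin 2 → Plane →L[ℝ] ℝ := fun i =>
    (EuclideanSpace.proj i : Plane →L[ℝ] ℝ).comp (R.toContinuousLinearEquiv : Plane →L[ℝ] Plane)
  have hp : ∀ i y, p i y = R y i := fun i y => rfl
  let e : Plane := R.symm (EuclideanSpace.single 1 1)
  have he0 : p 0 e = 0 := by simp [hp, e]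
  have he1 : p 1 e = 1 := by simp [hp, e]
  let G : Plane → ℝ := fun y => p 1 y - g (p 0 y)
  have hG : Continuous G := (p 1).continuous.sub (hg.continuous.comp (p 0).continuous)
  have hgd : HasStrictDerivAt g (deriv g (p 0 x₀)) (p 0 x₀) :=
    hg.contDiffAt.hasStrictDerivAt one_ne_zero
  have hmem : ∀ y ∈ Metric.ball x₀ r, (y ∈ Ω ↔ 0 < G y) := fun y hy => by
    rw [hR y hy]
    simp [G, hp]
  refine ⟨G, p 1 - deriv g (p 0 x₀) • p 0, e, r, hG,
    (p 1).hasStrictFDerivAt.sub (hgd.comp_hasStrictFDerivAt x₀ (p 0).hasStrictFDerivAt),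
    by simp [e], by simp [he0, he1], hr, fun y hy => ?_⟩
  rw [hΩ.frontier_eq]
  constructor
  · rintro ⟨hcl, hn⟩
    rw [hmem y hy, not_lt] at hn
    refine hn.antisymm (not_lt.1 fun hlt => ?_)
    have hnhds : {z | G z < 0} ∩ Metric.ball x₀ r ∈ 𝓝 y :=
      inter_mem ((isOpen_lt hG continuous_const).mem_nhds hlt) (Metric.isOpen_ball.mem_nhds hy)
    obtain ⟨z, ⟨hz1, hz2⟩, hz3⟩ := mem_closure_iff_nhds.1 hcl _ hnhds
    exact lt_asymm hz1 ((hmem z hz2).1 hz3)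
  · intro h0
    refine ⟨?_, fun hy' => ((hmem y hy).1 hy').ne' h0⟩
    -- A zero of `G` is approached from inside `Ω` along `e`, the upward direction of the graph,
    -- because `G (y + t • e) = G y + t`.
    have hcont : Continuous fun t : ℝ => y + t • e := by fun_prop
    have htend : Tendsto (fun t : ℝ => y + t • e) (𝓝[>] 0) (𝓝 y) := by
      have := hcont.tendsto 0
      simp only [zero_smul, add_zero] at this
      exact this.mono_left nhdsWithin_le_nhds
    refine mem_closure_of_tendsto htend ?_
    filter_upwards [htend.eventually (Metric.isOpen_ball.mem_nhds hy), self_mem_nhdsWithin]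
      with t ht ht0
    refine (hmem _ ht).2 ?_
    have : G (y + t • e) = G y + t := by
      simp only [G, map_add, map_smul, he0, he1, smul_eq_mul, mul_zero, mul_one, add_zero]
      ring
    rw [this, h0, zero_add]
    exact ht0

/-- A curve that is almost straight near the edge of a shape-regular triangle meets a line through
the opposite vertex close to the edge, in exactly one point. -/
theorem exists_isNearestIntersection_of_approx {Γ U : Set Plane} {G : Plane → ℝ}
    {l : Plane →L[ℝ] ℝ} {e : Plane} {ε σ : ℝ} (hσ : 0 < σ) (hε : 0 < ε) (hε1 : ε ≤ 1)
    (hG : Continuous G) (he : ‖e‖ = 1) (hle : l e = 1) (hΓ : ∀ y ∈ U, (y ∈ Γ ↔ G y = 0))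
    (happ : ∀ y ∈ U, ∀ z ∈ U, |G y - G z - l (y - z)| ≤ ε / (8 * σ) * ‖y - z‖)
    {β : AffineBasis (Fin 3) ℝ Plane} {c : Plane} {ρ : ℝ} (hρ : 0 < ρ)
    (hball : Metric.closedBall c ρ ⊆ convexHull ℝ (range β))
    (hdiam : Metric.diam (convexHull ℝ (range β)) ≤ σ * ρ)
    (hU : Metric.closedBall (β 1) (2 * Metric.diam (convexHull ℝ (range β))) ⊆ U)
    (h1 : β 1 ∈ Γ) (h2 : β 2 ∈ Γ) {t : ℝ} (ht : t ∈ Icc (0 : ℝ) 1) :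
    ∃ s : ℝ, |s| ≤ ε ∧ ∀ P, IsNearestIntersection Γ (β 0) (AffineMap.lineMap (β 1) (β 2) t) P ↔
      P = AffineMap.lineMap (β 0) (AffineMap.lineMap (β 1) (β 2) t : Plane) (1 + s) := by
  set T := convexHull ℝ (range β) with hT
  set h := Metric.diam T with hh
  set M : Plane := AffineMap.lineMap (β 1) (β 2) t with hM
  set D : Plane := M - β 0 with hD
  have hTb : Bornology.IsBounded T := ((finite_range β).isCompact_convexHull ℝ).isBounded
  have hv : ∀ i, β i ∈ T := fun i => subset_convexHull ℝ _ (mem_range_self i)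
  have hMT : M ∈ T := (convex_convexHull ℝ _).segment_subset (hv 1) (hv 2) (by
    rw [segment_eq_image_lineMap]
    exact ⟨t, ht, rfl⟩)
  have hdist : ∀ x ∈ T, ∀ y ∈ T, ‖x - y‖ ≤ h := fun x hx y hy => by
    rw [← dist_eq_norm]
    exact Metric.dist_le_diam_of_mem hTb hx hy
  have h0 : 0 ≤ h := Metric.diam_nonneg
  have hTU : ∀ x ∈ T, x ∈ U := fun x hx => hU (by
    rw [mem_closedBall_iff_norm]
    linarith [hdist x hx _ (hv 1)])
  have hη : ε / (8 * σ) * h ≤ ε * ρ / 8 := by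
    calc _ ≤ ε / (8 * σ) * (σ * ρ) := by gcongr
      _ = _ := by field_simp
  have hη' : ε * ρ / 8 ≤ ρ / 8 := by nlinarith
  have hGA : G (β 1) = 0 := (hΓ _ (hTU _ (hv 1))).1 h1
  have hGB : G (β 2) = 0 := (hΓ _ (hTU _ (hv 2))).1 h2
  -- `G` vanishes at both endpoints of the edge, so the edge is almost tangent: `l` nearly
  -- annihilates it.
  have hlAB : |l (β 2 - β 1)| ≤ ε * ρ / 8 := by
    have := happ _ (hTU _ (hv 2)) _ (hTU _ (hv 1))
    rw [hGA, hGB, sub_zero, zero_sub, abs_neg] at this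
    refine this.trans (le_trans ?_ hη)
    gcongr
    exact hdist _ (hv 2) _ (hv 1)
  have hMA : M - β 1 = t • (β 2 - β 1) := by
    rw [hM, AffineMap.lineMap_apply]
    simp
  have hGM : |G M| ≤ ε * ρ / 4 := by
    have h3 := happ _ (hTU _ hMT) _ (hTU _ (hv 1))
    rw [hGA, sub_zero] at h3
    have h4 : |l (M - β 1)| ≤ ε * ρ / 8 := by
      rw [hMA, map_smul, smul_eq_mul, abs_mul, abs_of_nonneg ht.1]
      exact (mul_le_of_le_one_left (abs_nonneg _) ht.2).trans hlAB
    have h5 : ε / (8 * σ) * ‖M - β 1‖ ≤ ε * ρ / 8 := by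
      refine le_trans ?_ hη
      gcongr
      exact hdist _ hMT _ (hv 1)
    have h6 := abs_add_le (G M - l (M - β 1)) (l (M - β 1))
    rw [sub_add_cancel] at h6
    linarith
  -- Transversality of the line `OM`. As `c` and `c + ρ • e` lie in the triangle, `ρ • e` combines
  -- `D` and `β 2 - β 1` with coefficients at most `1` and `2`. Now `l (ρ • e) = ρ`, while the edge
  -- contributes at most `2 (ερ/8) ≤ ρ/4`; the rest comes from `D`.
  have hlD : 3 * ρ / 4 ≤ |l D| := by
    have hcT : c ∈ T := hball (Metric.mem_closedBall_self hρ.le)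
    have hceT : c + ρ • e ∈ T := hball (by
      rw [mem_closedBall_iff_norm]
      simp [norm_smul, he, abs_of_pos hρ])
    set x : Fin 3 → ℝ := fun i => β.coord i (c + ρ • e) - β.coord i c with hx
    have hx1 : ∀ i, |x i| ≤ 1 := fun i => by
      have h3 := coord_mem_Icc hcT i
      have h4 := coord_mem_Icc hceT i
      exact abs_le.2 ⟨by linarith [h3.2, h4.1], by linarith [h3.1, h4.2]⟩
    have hsum : x 0 + x 1 + x 2 = 0 := by
      have h3 := β.sum_coord_apply_eq_one c
      have h4 := β.sum_coord_apply_eq_one (c + ρ • e)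
      rw [Fin.sum_univ_three] at h3 h4
      simp only [hx]
      linarith
    have hrep : ρ • e = x 0 • β 0 + x 1 • β 1 + x 2 • β 2 := by
      have h3 := β.linear_combination_coord_eq_self c
      have h4 := β.linear_combination_coord_eq_self (c + ρ • e)
      rw [Fin.sum_univ_three] at h3 h4
      have h5 : ρ • e = (c + ρ • e) - c := by simp
      calc ρ • e = (c + ρ • e) - c := h5
        _ = (β.coord 0 (c + ρ • e) • β 0 + β.coord 1 (c + ρ • e) • β 1
            + β.coord 2 (c + ρ • e) • β 2)
            - (β.coord 0 c • β 0 + β.coord 1 c • β 1 + β.coord 2 c • β 2) := by rw [h3, h4]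
        _ = _ := by simp only [hx]; module
    have hrep' : ρ • e = (-x 0) • D + (x 2 + x 0 * t) • (β 2 - β 1) := by
      have h3 : x 1 = -x 0 - x 2 := by linarith
      have h4 : M = β 1 + t • (β 2 - β 1) := by rw [← hMA]; abel
      rw [hrep, h3, hD, h4]
      module
    have h3 : ρ = (-x 0) * l D + (x 2 + x 0 * t) * l (β 2 - β 1) := by
      have := congrArg l hrep'
      simpa [hle] using this
    have h4 : |(-x 0) * l D| ≤ |l D| := by
      rw [abs_mul, abs_neg]
      exact mul_le_of_le_one_left (abs_nonneg _) (hx1 0)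
    have h5 : |(x 2 + x 0 * t) * l (β 2 - β 1)| ≤ 2 * (ε * ρ / 8) := by
      rw [abs_mul]
      have : |x 2 + x 0 * t| ≤ 2 := by
        refine (abs_add_le _ _).trans ?_
        rw [abs_mul, abs_of_nonneg ht.1]
        have := mul_le_one₀ (hx1 0) ht.1 ht.2
        linarith [hx1 2]
      exact mul_le_mul this hlAB (abs_nonneg _) zero_le_two
    linarith [le_abs_self ((-x 0) * l D), le_abs_self ((x 2 + x 0 * t) * l (β 2 - β 1))]
  have hpt : ∀ s : ℝ, (AffineMap.lineMap (β 0) M (1 + s) : Plane) = M + s • D := fun s => by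
    rw [AffineMap.lineMap_apply, hD, vsub_eq_sub, vadd_eq_add]
    module
  simp only [hpt]
  have hDn : ‖D‖ ≤ h := hdist _ hMT _ (hv 0)
  have hD0 : 0 < ‖D‖ := by
    rw [norm_pos_iff]
    rintro h3
    rw [h3, map_zero, abs_zero] at hlD
    linarith
  have hsU : ∀ s : ℝ, |s| ≤ 1 → M + s • D ∈ U := fun s hs => hU (by
    rw [mem_closedBall_iff_norm]
    have h3 : M + s • D - β 1 = (M - β 1) + s • D := by abel
    rw [h3]
    refine (norm_add_le _ _).trans ?_
    rw [norm_smul, Real.norm_eq_abs]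
    have := mul_le_of_le_one_left (norm_nonneg D) hs
    linarith [hdist _ hMT _ (hv 1)])
  have hφ : ∀ s s' : ℝ, |s| ≤ 1 → |s'| ≤ 1 →
      |G (M + s • D) - G (M + s' • D) - (s - s') * l D| ≤ ρ / 8 * |s - s'| := by
    intro s s' hs hs'
    have h3 := happ _ (hsU s hs) _ (hsU s' hs')
    have h4 : M + s • D - (M + s' • D) = (s - s') • D := by module
    rw [h4, map_smul, smul_eq_mul, norm_smul, Real.norm_eq_abs] at h3
    refine h3.trans ?_
    calc ε / (8 * σ) * (|s - s'| * ‖D‖) ≤ ε / (8 * σ) * (|s - s'| * h) := by gcongr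
      _ = (ε / (8 * σ) * h) * |s - s'| := by ring
      _ ≤ _ := by gcongr; linarith
  -- Along the line, `G` has slope `l D`, of size at least `3ρ/4`, up to an error `ρ/8`, hence at
  -- most one zero.
  have huniq : ∀ s s' : ℝ, |s| ≤ 1 → |s'| ≤ 1 → G (M + s • D) = 0 → G (M + s' • D) = 0 →
      s = s' := by
    intro s s' hs hs' h3 h4
    have h5 := hφ s s' hs hs'
    rw [h3, h4, sub_zero, zero_sub, abs_neg, abs_mul] at h5
    by_contra hne
    have h6 : 0 < |s - s'| := abs_pos.2 (sub_ne_zero.2 hne)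
    nlinarith
  -- Moving by `±ε` changes `G` by at least `3ερ/4 - ερ/8`, more than `|G M| ≤ ερ/4`, so the signs
  -- at the two ends differ.
  obtain ⟨s, hs, hGs⟩ : ∃ s ∈ Icc (-ε) ε, G (M + s • D) = 0 := by
    have hcont : ContinuousOn (fun s : ℝ => G (M + s • D)) (Icc (-ε) ε) :=
      (hG.comp (by fun_prop)).continuousOn
    have hεa : |ε| ≤ 1 := by rwa [abs_of_pos hε]
    have h3 := hφ ε 0 hεa (by simp)
    have h4 := hφ (-ε) 0 (by rwa [abs_neg]) (by simp)
    simp only [zero_smul, add_zero, sub_zero, abs_neg, abs_of_pos hε] at h3 h4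
    have h5 := abs_le.1 h3
    have h6 := abs_le.1 h4
    have h7 := abs_le.1 hGM
    have hερ : 0 < ε * ρ := by positivity
    rcases le_total 0 (l D) with hs | hs
    · rw [abs_of_nonneg hs] at hlD
      have h8 : ε * (3 * ρ / 4) ≤ ε * l D := by gcongr
      exact intermediate_value_Icc (by linarith) hcont ⟨by linarith, by linarith⟩
    · rw [abs_of_nonpos hs] at hlD
      have h8 : ε * (3 * ρ / 4) ≤ ε * (-l D) := by gcongr
      exact intermediate_value_Icc' (by linarith) hcont ⟨by linarith, by linarith⟩
  have hsε : |s| ≤ ε := abs_le.2 hs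
  have hs1 : |s| ≤ 1 := hsε.trans hε1
  refine ⟨s, hsε, fun P => ?_⟩
  have hdM : ∀ u : ℝ, dist M (M + u • D) = |u| * ‖D‖ := fun u => by
    rw [dist_eq_norm, sub_add_cancel_left, norm_neg, norm_smul, Real.norm_eq_abs]
  have hsΓ : M + s • D ∈ Γ := (hΓ _ (hsU s hs1)).2 hGs
  have hsl : ∀ u : ℝ, M + u • D ∈ line[ℝ, β 0, M] := fun u => by
    rw [mem_affineSpan_pair_iff_exists_lineMap_eq]
    exact ⟨1 + u, hpt u⟩
  have hline : ∀ Q ∈ line[ℝ, β 0, M], ∃ u : ℝ, Q = M + u • D := fun Q hQ => by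
    obtain ⟨u, rfl⟩ := (mem_affineSpan_pair_iff_exists_lineMap_eq).1 hQ
    refine ⟨u - 1, ?_⟩
    rw [← hpt]
    congr 1
    ring
  constructor
  · rintro ⟨hPΓ, hPl, hPmin⟩
    obtain ⟨u, rfl⟩ := hline P hPl
    have h3 := hPmin _ hsΓ (hsl s)
    rw [hdM, hdM] at h3
    have h4 : |u| ≤ |s| := le_of_mul_le_mul_right h3 hD0
    have h5 : |u| ≤ 1 := h4.trans hs1
    rw [huniq u s h5 hs1 ((hΓ _ (hsU u h5)).1 hPΓ) hGs]
  -- An intersection strictly closer to `M` would also have parameter at most `1` in absolute value,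
  -- where the zero is unique; farther intersections do not matter.
  · rintro rfl
    refine ⟨hsΓ, hsl s, fun Q hQΓ hQl => ?_⟩
    obtain ⟨u, rfl⟩ := hline Q hQl
    rw [hdM, hdM]
    refine mul_le_mul_of_nonneg_right (le_of_not_gt fun hlt => ?_) hD0.le
    have h5 : |u| ≤ 1 := hlt.le.trans hs1
    rw [huniq u s h5 hs1 ((hΓ _ (hsU u h5)).1 hQΓ) hGs] at hlt
    exact lt_irrefl _ hlt

/-- Strict differentiability gives the local approximation in a ball around each boundary point, and
a Lebesgue number of this cover of the compact boundary makes the radius uniform. -/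
theorem HasC1Boundary.exists_isNearestIntersection {Ω : Set Plane} (hΩ : IsOpen Ω)
    (hΩb : Bornology.IsBounded Ω) (hC : HasC1Boundary Ω) {σ ε : ℝ} (hσ : 0 < σ) (hε : 0 < ε)
    (hε1 : ε ≤ 1) :
    ∃ h₀ : ℝ, 0 < h₀ ∧ ∀ (β : AffineBasis (Fin 3) ℝ Plane) (c : Plane) (ρ : ℝ), 0 < ρ →
      Metric.closedBall c ρ ⊆ convexHull ℝ (range β) →
      Metric.diam (convexHull ℝ (range β)) ≤ σ * ρ →
      Metric.diam (convexHull ℝ (range β)) ≤ h₀ →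
      β 1 ∈ frontier Ω → β 2 ∈ frontier Ω → ∀ t ∈ Icc (0 : ℝ) 1,
      ∃ s : ℝ, |s| ≤ ε ∧ ∀ P,
        IsNearestIntersection (frontier Ω) (β 0) (AffineMap.lineMap (β 1) (β 2) t) P ↔
        P = AffineMap.lineMap (β 0) (AffineMap.lineMap (β 1) (β 2) t : Plane) (1 + s) := by
  have hloc : ∀ x₀ ∈ frontier Ω, ∃ (δ : ℝ) (G : Plane → ℝ) (l : Plane →L[ℝ] ℝ) (e : Plane), 0 < δ ∧
      Continuous G ∧ ‖e‖ = 1 ∧ l e = 1 ∧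
      (∀ y ∈ Metric.ball x₀ δ, (y ∈ frontier Ω ↔ G y = 0)) ∧
      ∀ y ∈ Metric.ball x₀ δ, ∀ z ∈ Metric.ball x₀ δ,
        |G y - G z - l (y - z)| ≤ ε / (8 * σ) * ‖y - z‖ := by
    intro x₀ hx₀
    obtain ⟨G, l, e, r, hG, hl, he, hle, hr, hΓ⟩ := hC.exists_local_equation hΩ hx₀
    have hpos : 0 < ε / (8 * σ) := by positivity
    obtain ⟨u, hu, happ⟩ := hl.approximates_deriv_on_nhds (c := ⟨ε / (8 * σ), hpos.le⟩)
      (Or.inr hpos)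
    obtain ⟨δ, hδ, hδu⟩ := Metric.mem_nhds_iff.1 hu
    refine ⟨min δ r, G, l, e, lt_min hδ hr, hG, he, hle,
      fun y hy => hΓ y (Metric.ball_subset_ball (min_le_right _ _) hy), fun y hy z hz => ?_⟩
    exact happ y (hδu (Metric.ball_subset_ball (min_le_left _ _) hy))
      z (hδu (Metric.ball_subset_ball (min_le_left _ _) hz))
  choose! δ G l e hδ hG he hle hΓ happ using hloc
  have hcpt : IsCompact (frontier Ω) :=
    Metric.isCompact_of_isClosed_isBounded isClosed_frontier
      (hΩb.closure.subset frontier_subset_closure)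
  obtain ⟨r, hr, hleb⟩ := lebesgue_number_lemma_of_metric (ι := frontier Ω)
    (c := fun x => Metric.ball x.1 (δ x.1)) hcpt (fun _ => Metric.isOpen_ball)
    (fun x hx => mem_iUnion.2 ⟨⟨x, hx⟩, Metric.mem_ball_self (hδ x hx)⟩)
  -- With diameter at most `r / 4`, the required ball about `β 1`, of radius twice the diameter, has
  -- radius at most `r / 2 < r`.
  refine ⟨r / 4, by positivity, fun β c ρ hρ hball hdiam hh h1 h2 t ht => ?_⟩
  obtain ⟨⟨x₀, hx₀⟩, hsub⟩ := hleb (β 1) h1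
  refine exists_isNearestIntersection_of_approx hσ hε hε1 (hG x₀ hx₀) (he x₀ hx₀) (hle x₀ hx₀)
    (hΓ x₀ hx₀) (happ x₀ hx₀) hρ hball hdiam ?_ h1 h2 ht
  exact (Metric.closedBall_subset_ball (by linarith)).trans hsub

/-! ### Triangles as affine bases -/

theorem exists_affineBasis_of_eq {T : Finset Plane} (hc : T.card = 3)
    (hi : AffineIndependent ℝ ((↑) : T → Plane)) {O A B : Plane} (hT : (T : Set Plane) = {O, A, B}) :
    ∃ β : AffineBasis (Fin 3) ℝ Plane, β 0 = O ∧ β 1 = A ∧ β 2 = B ∧ range β = T := by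
  classical
  have hT' : T = {O, A, B} := by
    rw [← Finset.coe_inj, hT]
    simp
  have hOA : O ≠ A := by
    rintro rfl
    have := Finset.card_le_two (a := O) (b := B)
    rw [hT'] at hc
    simp only [Finset.mem_insert, true_or, Finset.insert_eq_of_mem] at hc
    omega
  have hOB : O ≠ B := by
    rintro rfl
    have := Finset.card_le_two (a := A) (b := O)
    rw [hT'] at hc
    simp only [Finset.mem_insert, Finset.mem_singleton, or_true, Finset.insert_eq_of_mem] at hc
    omega
  have hAB : A ≠ B := by
    rintro rfl
    have := Finset.card_le_two (a := O) (b := A)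
    rw [hT'] at hc
    simp only [Finset.mem_singleton, Finset.insert_eq_of_mem] at hc
    omega
  let f : Fin 3 → Plane := ![O, A, B]
  have hf : ∀ i, f i ∈ T := fun i => by
    rw [hT']
    fin_cases i <;> simp [f]
  have hinj : Function.Injective fun i => (⟨f i, hf i⟩ : T) := by
    intro i j hij
    have : f i = f j := congrArg Subtype.val hij
    fin_cases i <;> fin_cases j <;> simp_all [f]
  have hind : AffineIndependent ℝ f := hi.comp_embedding ⟨_, hinj⟩
  have htop : affineSpan ℝ (range f) = ⊤ := by
    rw [hind.affineSpan_eq_top_iff_card_eq_finrank_add_one]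
    simp
  refine ⟨⟨f, hind, htop⟩, rfl, rfl, rfl, ?_⟩
  change range f = _
  rw [hT]
  ext x
  simp only [mem_range, mem_insert_iff, mem_singleton_iff]
  constructor
  · rintro ⟨i, rfl⟩
    fin_cases i <;> simp [f]
  · rintro (rfl | rfl | rfl)
    exacts [⟨0, rfl⟩, ⟨1, rfl⟩, ⟨2, rfl⟩]

theorem range_fin_three {α : Type*} (f : Fin 3 → α) : range f = {f 0, f 1, f 2} := by
  ext x
  simp only [mem_range, mem_insert_iff, mem_singleton_iff, Fin.exists_fin_succ]
  simp [eq_comm]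

/-- A coordinate is an affine function, so it is determined by its values at the other basis. This
compares two triangles sharing an edge. -/
theorem coord_eq_sum (β γ : AffineBasis (Fin 3) ℝ Plane) (i : Fin 3) (x : Plane) :
    β.coord i x = γ.coord 0 x * β.coord i (γ 0) + γ.coord 1 x * β.coord i (γ 1)
      + γ.coord 2 x * β.coord i (γ 2) := by
  have h := γ.affineCombination_coord_eq_self x
  have hs := γ.sum_coord_apply_eq_one x
  conv_lhs => rw [← h]
  rw [Finset.map_affineCombination _ _ _ hs,
    Finset.affineCombination_eq_linear_combination _ _ _ hs, Fin.sum_univ_three]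
  simp

theorem convexHull_subset_coord_eq_zero {β : AffineBasis (Fin 3) ℝ Plane} {i : Fin 3}
    {s : Set Plane} (hs : ∀ x ∈ s, β.coord i x = 0) {x : Plane} (hx : x ∈ convexHull ℝ s) :
    β.coord i x = 0 := by
  have hc : Convex ℝ {y | β.coord i y = 0} :=
    (convex_singleton (0 : ℝ)).affine_preimage (β.coord i)
  exact convexHull_min hs hc hx

theorem isOpen_setOf_coord_pos (β : AffineBasis (Fin 3) ℝ Plane) (i : Fin 3) :
    IsOpen {x | 0 < β.coord i x} :=
  isOpen_lt continuous_const (continuous_barycentric_coord β i)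

theorem mem_convexHull_iff_coord {β : AffineBasis (Fin 3) ℝ Plane} {x : Plane} :
    x ∈ convexHull ℝ (range β) ↔ 0 ≤ β.coord 0 x ∧ 0 ≤ β.coord 1 x ∧ 0 ≤ β.coord 2 x := by
  rw [β.convexHull_eq_nonneg_coord]
  exact ⟨fun h => ⟨h 0, h 1, h 2⟩, fun h i => by fin_cases i <;> simp [h]⟩

/-! ### Topology of the mesh and its boundary -/

namespace TriMesh

variable {𝒯 : TriMesh}

theorem exists_affineBasis {T : Finset Plane} (hT : T ∈ 𝒯.elements) {O A B : Plane}
    (h : (T : Set Plane) = {O, A, B}) :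
    ∃ β : AffineBasis (Fin 3) ℝ Plane, β 0 = O ∧ β 1 = A ∧ β 2 = B ∧ range β = T :=
  exists_affineBasis_of_eq (𝒯.card_eq T hT) (𝒯.indep T hT) h

theorem exists_affineBasis_of_mem {T : Finset Plane} (hT : T ∈ 𝒯.elements) {O : Plane}
    (hO : O ∈ T) : ∃ β : AffineBasis (Fin 3) ℝ Plane, β 0 = O ∧ range β = T := by
  classical
  have h2 : (T.erase O).card = 2 := by rw [Finset.card_erase_of_mem hO, 𝒯.card_eq T hT]
  obtain ⟨A, B, -, hAB⟩ := Finset.card_eq_two.1 h2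
  obtain ⟨β, h0, -, -, h⟩ := exists_affineBasis (O := O) (A := A) (B := B) hT (by
    rw [← Finset.insert_erase hO, hAB]
    simp)
  exact ⟨β, h0, h⟩

theorem exists_affineBasis_range {T : Finset Plane} (hT : T ∈ 𝒯.elements) :
    ∃ β : AffineBasis (Fin 3) ℝ Plane, range β = T := by
  obtain ⟨O, hO⟩ : T.Nonempty := Finset.card_pos.1 (by rw [𝒯.card_eq T hT]; norm_num)
  obtain ⟨β, -, h⟩ := exists_affineBasis_of_mem hT hO
  exact ⟨β, h⟩

theorem isCompact_tri (T : Finset Plane) : IsCompact (tri T) :=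
  T.finite_toSet.isCompact_convexHull ℝ

theorem isClosed_tri (T : Finset Plane) : IsClosed (tri T) := (isCompact_tri T).isClosed

theorem isCompact_carrier : IsCompact 𝒯.carrier :=
  𝒯.elements.isCompact_biUnion fun T _ => isCompact_tri T

theorem isClosed_carrier : IsClosed 𝒯.carrier := isCompact_carrier.isClosed

theorem tri_subset_carrier {T : Finset Plane} (hT : T ∈ 𝒯.elements) : tri T ⊆ 𝒯.carrier :=
  subset_biUnion_of_mem (u := fun T => tri T) hT

theorem mem_carrier {x : Plane} : x ∈ 𝒯.carrier ↔ ∃ T ∈ 𝒯.elements, x ∈ tri T := by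
  simp [carrier]

theorem isOpen_domain : IsOpen 𝒯.domain := isOpen_interior

theorem domain_subset_carrier : 𝒯.domain ⊆ 𝒯.carrier := interior_subset

theorem interior_tri_subset_domain {T : Finset Plane} (hT : T ∈ 𝒯.elements) :
    interior (tri T) ⊆ 𝒯.domain := interior_mono (tri_subset_carrier hT)

theorem interior_tri_nonempty {T : Finset Plane} (hT : T ∈ 𝒯.elements) :
    (interior (tri T)).Nonempty := by
  obtain ⟨β, hβ⟩ := exists_affineBasis_range hT
  rw [tri, ← hβ]
  exact ⟨_, β.centroid_mem_interior_convexHull⟩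

theorem closure_domain : closure 𝒯.domain = 𝒯.carrier := by
  refine (isClosed_carrier.closure_subset_iff.2 domain_subset_carrier).antisymm fun x hx => ?_
  obtain ⟨T, hT, hxT⟩ := mem_carrier.1 hx
  have h := (convex_convexHull ℝ (T : Set Plane)).closure_interior_eq_closure_of_nonempty_interior
    (interior_tri_nonempty hT)
  have h1 : x ∈ closure (interior (tri T)) := by
    change x ∈ closure (interior (convexHull ℝ (T : Set Plane)))
    rw [h]
    exact subset_closure hxT
  exact closure_mono (interior_tri_subset_domain hT) h1

theorem bdry_eq : 𝒯.bdry = 𝒯.carrier \ 𝒯.domain := by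
  rw [bdry, isOpen_domain.frontier_eq, closure_domain]

theorem isClosed_bdry : IsClosed 𝒯.bdry := isClosed_frontier

/-- A vertex with nonzero barycentric coordinate at a common point of two triangles is a common
vertex. -/
theorem mem_of_coord_ne_zero {S T : Finset Plane} (hS : S ∈ 𝒯.elements) (hT : T ∈ 𝒯.elements)
    {β : AffineBasis (Fin 3) ℝ Plane} (hβ : range β = T) {x : Plane} (hxS : x ∈ tri S)
    (hxT : x ∈ tri T) {i : Fin 3} (hi : β.coord i x ≠ 0) : β i ∈ S := by
  by_contra hn
  -- Conformity places `x` in the hull of the common vertices; were `β i` not among them, the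
  -- coordinate `i` would vanish on that hull.
  have hx : x ∈ convexHull ℝ ((S : Set Plane) ∩ T) := by
    rw [← 𝒯.conforming S hS T hT]
    exact ⟨hxS, hxT⟩
  refine hi (convexHull_subset_coord_eq_zero (fun y hy => ?_) hx)
  obtain ⟨hyS, hyT⟩ := hy
  rw [← hβ] at hyT
  obtain ⟨j, rfl⟩ := hyT
  refine β.coord_apply_ne fun hij => hn ?_
  rw [hij]
  exact hyS

theorem eq_of_subset {S T : Finset Plane} (hS : S ∈ 𝒯.elements) (hT : T ∈ 𝒯.elements)
    (h : T ⊆ S) : S = T :=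
  (Finset.eq_of_subset_of_card_le h (by rw [𝒯.card_eq S hS, 𝒯.card_eq T hT])).symm

/-- At an interior point of `T` all three coordinates are positive, so a common interior point would
make every vertex of `T` a vertex of `S`. -/
theorem disjoint_interior_tri {S T : Finset Plane} (hS : S ∈ 𝒯.elements) (hT : T ∈ 𝒯.elements)
    (hne : S ≠ T) : Disjoint (interior (tri S)) (interior (tri T)) := by
  rw [Set.disjoint_left]
  intro x hxS hxT
  obtain ⟨β, hβ⟩ := exists_affineBasis_range hT
  have hpos : ∀ i, 0 < β.coord i x := by
    rw [tri, ← hβ, β.interior_convexHull] at hxT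
    exact hxT
  refine hne (eq_of_subset hS hT fun y hy => ?_)
  have hy' : y ∈ range β := by rw [hβ]; exact hy
  obtain ⟨i, rfl⟩ := hy'
  exact mem_of_coord_ne_zero hS hT hβ (interior_subset hxS) (interior_subset hxT) (hpos i).ne'

/-- The relative interior of an edge common to two triangles lies in the open polygonal set. -/
theorem mem_domain_of_common_edge {S T : Finset Plane} (hS : S ∈ 𝒯.elements)
    (hT : T ∈ 𝒯.elements) (hne : S ≠ T) {β : AffineBasis (Fin 3) ℝ Plane} (hβ : range β = T)
    (h1 : β 1 ∈ S) (h2 : β 2 ∈ S) {x : Plane} (hx0 : β.coord 0 x = 0) (hx1 : 0 < β.coord 1 x)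
    (hx2 : 0 < β.coord 2 x) : x ∈ 𝒯.domain := by
  classical
  have h12 : β 1 ≠ β 2 := β.ind.injective.ne (by decide)
  have hcard : ((S.erase (β 1)).erase (β 2)).card = 1 := by
    rw [Finset.card_erase_of_mem (Finset.mem_erase.2 ⟨h12.symm, h2⟩),
      Finset.card_erase_of_mem h1, 𝒯.card_eq S hS]
  obtain ⟨O, hO⟩ := Finset.card_eq_one.1 hcard
  have hSe : (S : Set Plane) = {O, β 1, β 2} := by
    have : S = {O, β 1, β 2} := by
      rw [← Finset.insert_erase h1, ← Finset.insert_erase (Finset.mem_erase.2 ⟨h12.symm, h2⟩), hO]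
      ext
      simp
      tauto
    rw [this]
    simp
  obtain ⟨γ, -, hγ1, hγ2, hγ⟩ := exists_affineBasis hS hSe
  -- The coordinates opposite to the common edge are proportional with ratio `κ`. If `κ < 0` the
  -- triangles lie on opposite sides and together fill the neighbourhood `N` of `x`; if `κ > 0` they
  -- overlap near `x`, which conformity forbids.
  set κ := β.coord 0 (γ 0) with hκ
  have hrel : ∀ y, β.coord 0 y = γ.coord 0 y * κ := fun y => by
    rw [coord_eq_sum β γ 0 y, hγ1, hγ2, β.coord_apply_ne (by decide), β.coord_apply_ne (by decide)]
    ring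
  have hκ0 : κ ≠ 0 := fun h => by
    have := hrel (β 0)
    rw [h, mul_zero, β.coord_apply_eq] at this
    exact one_ne_zero this
  have hγx : ∀ i ∈ ({1, 2} : Finset (Fin 3)), γ.coord i x = β.coord i x := fun i hi => by
    rw [coord_eq_sum γ β i x, hx0, ← hγ1, ← hγ2]
    fin_cases hi
    · rw [γ.coord_apply_eq, γ.coord_apply_ne (by decide)]
      ring
    · rw [γ.coord_apply_eq, γ.coord_apply_ne (by decide)]
      ring
  let N : Set Plane := {y | 0 < β.coord 1 y} ∩ {y | 0 < β.coord 2 y} ∩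
    ({y | 0 < γ.coord 1 y} ∩ {y | 0 < γ.coord 2 y})
  have hNo : IsOpen N := ((isOpen_setOf_coord_pos β 1).inter (isOpen_setOf_coord_pos β 2)).inter
    ((isOpen_setOf_coord_pos γ 1).inter (isOpen_setOf_coord_pos γ 2))
  have hxN : x ∈ N := ⟨⟨hx1, hx2⟩, by
    change 0 < γ.coord 1 x
    rwa [hγx 1 (by simp)], by
    change 0 < γ.coord 2 x
    rwa [hγx 2 (by simp)]⟩
  have hmT : ∀ y ∈ N, 0 ≤ β.coord 0 y → y ∈ tri T := fun y hy h0 => by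
    rw [tri, ← hβ, mem_convexHull_iff_coord]
    exact ⟨h0, hy.1.1.le, hy.1.2.le⟩
  have hmS : ∀ y ∈ N, 0 ≤ γ.coord 0 y → y ∈ tri S := fun y hy h0 => by
    rw [tri, ← hγ, mem_convexHull_iff_coord]
    exact ⟨h0, hy.2.1.le, hy.2.2.le⟩
  rcases hκ0.lt_or_gt with hneg | hpos
  · refine mem_interior.2 ⟨N, fun y hy => ?_, hNo, hxN⟩
    rcases le_or_gt 0 (β.coord 0 y) with h | h
    · exact tri_subset_carrier hT (hmT y hy h)
    · refine tri_subset_carrier hS (hmS y hy ?_)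
      rw [hrel y] at h
      exact (pos_of_mul_neg_left h hneg.le).le
  · exfalso
    have hc : Tendsto (fun τ : ℝ => (AffineMap.lineMap x (β 0) τ : Plane)) (𝓝[>] 0) (𝓝 x) := by
      have h : Continuous fun τ : ℝ => (AffineMap.lineMap x (β 0) τ : Plane) :=
        AffineMap.lineMap_continuous
      have := h.tendsto 0
      rw [AffineMap.lineMap_apply_zero] at this
      exact this.mono_left nhdsWithin_le_nhds
    obtain ⟨τ, hτN, hτ⟩ := ((hc.eventually (hNo.mem_nhds hxN)).and self_mem_nhdsWithin).exists
    set y : Plane := AffineMap.lineMap x (β 0) τ with hy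
    have hτ' : (0 : ℝ) < τ := hτ
    have hy0 : β.coord 0 y = τ := by
      rw [hy, AffineMap.apply_lineMap, hx0, β.coord_apply_eq, AffineMap.lineMap_apply]
      simp
    have hyS : y ∈ tri S := by
      refine hmS y hτN ?_
      have := hrel y
      rw [hy0] at this
      rw [this] at hτ'
      exact (pos_of_mul_pos_left hτ' hpos.le).le
    have hyT : y ∈ tri T := hmT y hτN (by rw [hy0]; exact hτ'.le)
    have h0 : β 0 ∈ S := mem_of_coord_ne_zero hS hT hβ hyS hyT (by rw [hy0]; exact hτ'.ne')
    refine hne (eq_of_subset hS hT fun z hz => ?_)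
    have hz' : z ∈ range β := by rw [hβ]; exact hz
    rw [range_fin_three] at hz'
    rcases hz' with rfl | rfl | rfl
    exacts [h0, h1, h2]

theorem oppEdge_eq_segment {T : Finset Plane} {β : AffineBasis (Fin 3) ℝ Plane}
    (hβ : range β = T) : oppEdge T (β 0) = segment ℝ (β 1) (β 2) := by
  have h : (T : Set Plane) \ {β 0} = {β 1, β 2} := by
    have h1 : β 1 ≠ β 0 := β.ind.injective.ne (by decide)
    have h2 : β 2 ≠ β 0 := β.ind.injective.ne (by decide)
    rw [← hβ, range_fin_three]
    ext x
    simp only [Set.mem_sdiff, mem_insert_iff, mem_singleton_iff]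
    constructor
    · rintro ⟨h | h | h, h'⟩ <;> tauto
    · rintro (rfl | rfl) <;> tauto
  rw [oppEdge, h, convexHull_pair]

/-- An edge that belongs to one triangle only lies on the boundary. -/
theorem oppEdge_subset_bdry {T : Finset Plane} (hT : T ∈ 𝒯.elements)
    {β : AffineBasis (Fin 3) ℝ Plane} (hβ : range β = T)
    (h : ∀ S ∈ 𝒯.elements, β 1 ∈ S → β 2 ∈ S → S = T) : oppEdge T (β 0) ⊆ 𝒯.bdry := by
  rw [oppEdge_eq_segment hβ, ← closure_openSegment (𝕜 := ℝ)]
  refine isClosed_bdry.closure_subset_iff.2 fun x hx => ?_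
  rw [openSegment_eq_image_lineMap] at hx
  obtain ⟨t, ⟨ht0, ht1⟩, rfl⟩ := hx
  set x : Plane := AffineMap.lineMap (β 1) (β 2) t with hx
  have hx0 : β.coord 0 x = 0 := by
    rw [hx, AffineMap.apply_lineMap, AffineMap.lineMap_apply, β.coord_apply_ne (by decide),
      β.coord_apply_ne (by decide)]
    simp
  have hx1 : β.coord 1 x = 1 - t := by
    rw [hx, AffineMap.apply_lineMap, AffineMap.lineMap_apply, β.coord_apply_eq,
      β.coord_apply_ne (by decide)]
    simp
    ring
  have hx2 : β.coord 2 x = t := by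
    rw [hx, AffineMap.apply_lineMap, AffineMap.lineMap_apply, β.coord_apply_eq,
      β.coord_apply_ne (by decide)]
    simp
  have hxT : x ∈ tri T := by
    rw [tri, ← hβ, mem_convexHull_iff_coord, hx0, hx1, hx2]
    exact ⟨le_rfl, by linarith, ht0.le⟩
  rw [bdry_eq]
  refine ⟨tri_subset_carrier hT hxT, fun hxd => ?_⟩
  classical
  -- No other triangle contains `x`. If `x` were in the open polygon, it would thus be interior to
  -- `T`, contradicting the vanishing of its coordinate `0`.
  let K : Set Plane := ⋃ S ∈ 𝒯.elements.erase T, tri S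
  have hK : IsClosed K := isClosed_biUnion_finset fun S _ => isClosed_tri S
  have hxK : x ∉ K := by
    intro hxK
    obtain ⟨S, hS, hxS⟩ : ∃ S ∈ 𝒯.elements.erase T, x ∈ tri S := by simpa [K] using hxK
    obtain ⟨hne, hS⟩ := Finset.mem_erase.1 hS
    exact hne (h S hS
      (mem_of_coord_ne_zero hS hT hβ hxS hxT (by rw [hx1]; exact (sub_pos.2 ht1).ne'))
      (mem_of_coord_ne_zero hS hT hβ hxS hxT (by rw [hx2]; exact ht0.ne')))
  have hint : x ∈ interior (tri T) := by
    refine mem_interior.2 ⟨𝒯.domain ∩ Kᶜ, fun y hy => ?_, isOpen_domain.inter hK.isOpen_compl,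
      hxd, hxK⟩
    obtain ⟨S, hS, hyS⟩ := mem_carrier.1 (domain_subset_carrier hy.1)
    by_cases hST : S = T
    · rwa [← hST]
    · exact (hy.2 (mem_biUnion (Finset.mem_erase.2 ⟨hST, hS⟩) hyS)).elim
  rw [tri, ← hβ, β.interior_convexHull] at hint
  exact (hint 0).ne' hx0

/-- A boundary point in a triangle is a vertex or lies on an edge contained in the boundary. -/
theorem mem_bdry_cases {T : Finset Plane} (hT : T ∈ 𝒯.elements) {x : Plane} (hxT : x ∈ tri T)
    (hx : x ∈ 𝒯.bdry) : x ∈ T ∨ ∃ β : AffineBasis (Fin 3) ℝ Plane, range β = T ∧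
      oppEdge T (β 0) ⊆ 𝒯.bdry ∧ x ∈ segment ℝ (β 1) (β 2) := by
  rw [bdry_eq] at hx
  obtain ⟨β', hβ'⟩ := exists_affineBasis_range hT
  obtain ⟨i, hi⟩ : ∃ i, β'.coord i x = 0 := by
    by_contra! h
    refine hx.2 (interior_tri_subset_domain hT ?_)
    rw [tri, ← hβ'] at hxT
    rw [tri, ← hβ', β'.interior_convexHull]
    exact fun i => (coord_mem_Icc hxT i).1.lt_of_ne' (h i)
  -- Relabelling puts the vanishing coordinate at index `0`. If another one vanishes, `x` is a
  -- vertex; otherwise it is in the relative interior of the edge, which cannot be shared.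
  let β : AffineBasis (Fin 3) ℝ Plane := β'.reindex (Equiv.swap 0 i)
  have hβ : range β = T := by
    rw [← hβ']
    change range (β'.reindex (Equiv.swap 0 i)) = _
    rw [AffineBasis.coe_reindex, EquivLike.range_comp]
  have h0 : β.coord 0 x = 0 := by
    simp [β, AffineBasis.coord_reindex, hi]
  have hsum := β.sum_coord_apply_eq_one x
  have hlin := β.linear_combination_coord_eq_self x
  rw [Fin.sum_univ_three, h0, zero_add] at hsum
  rw [Fin.sum_univ_three, h0, zero_smul, zero_add] at hlin
  have hxT' := hxT
  rw [tri, ← hβ] at hxT'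
  have h1 := (coord_mem_Icc hxT' 1).1
  have h2 := (coord_mem_Icc hxT' 2).1
  have hmem : ∀ j, β j ∈ T := fun j => by
    rw [← Finset.mem_coe, ← hβ]
    exact mem_range_self j
  rcases h1.eq_or_lt with h1 | h1
  · rw [← h1, zero_smul, zero_add] at hlin
    rw [← h1, zero_add] at hsum
    rw [hsum, one_smul] at hlin
    exact Or.inl (hlin ▸ hmem 2)
  rcases h2.eq_or_lt with h2 | h2
  · rw [← h2, zero_smul, add_zero] at hlin
    rw [← h2, add_zero] at hsum
    rw [hsum, one_smul] at hlin
    exact Or.inl (hlin ▸ hmem 1)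
  refine Or.inr ⟨β, hβ, oppEdge_subset_bdry hT hβ fun S hS hS1 hS2 => ?_,
    ⟨_, _, h1.le, h2.le, hsum, hlin⟩⟩
  by_contra hne
  exact hx.2 (mem_domain_of_common_edge hS hT hne hβ hS1 hS2 h0 h1 h2)

/-- Two triangles cannot share an edge that lies on the boundary. -/
theorem not_common_of_oppEdge_subset_bdry {S T : Finset Plane} (hS : S ∈ 𝒯.elements)
    (hT : T ∈ 𝒯.elements) (hne : S ≠ T) {β : AffineBasis (Fin 3) ℝ Plane} (hβ : range β = T)
    (hb : oppEdge T (β 0) ⊆ 𝒯.bdry) : ¬ (β 1 ∈ S ∧ β 2 ∈ S) := by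
  rintro ⟨h1, h2⟩
  -- The midpoint of the edge serves as witness.
  have hM : edgePoint β 2 1 ∈ 𝒯.domain := by
    refine mem_domain_of_common_edge hS hT hne hβ h1 h2 (coord_zero_edgePoint 1) ?_ ?_
    · rw [coord_one_edgePoint]; norm_num
    · rw [coord_two_edgePoint]; norm_num
  have hM' := hb (by rw [oppEdge_eq_segment hβ]; exact edgePoint_mem two_pos one_le_two)
  rw [bdry_eq] at hM'
  exact hM'.2 hM

/-- A point with both coordinates nonzero would force `S` to share the boundary edge. Thus `T` meets
other triangles only where its edge correction vanishes. -/
theorem coord_eq_zero_of_mem_tri {S T : Finset Plane} (hS : S ∈ 𝒯.elements)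
    (hT : T ∈ 𝒯.elements) (hne : S ≠ T) {β : AffineBasis (Fin 3) ℝ Plane} (hβ : range β = T)
    (hb : oppEdge T (β 0) ⊆ 𝒯.bdry) {x : Plane} (hxS : x ∈ tri S) (hxT : x ∈ tri T) :
    β.coord 1 x = 0 ∨ β.coord 2 x = 0 := by
  by_contra! h
  exact not_common_of_oppEdge_subset_bdry hS hT hne hβ hb
    ⟨mem_of_coord_ne_zero hS hT hβ hxS hxT h.1, mem_of_coord_ne_zero hS hT hβ hxS hxT h.2⟩

/-- A point of the polygon farthest from the origin lies on `Γ_h`, so it is a boundary vertex or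
lies on an edge between two such vertices; these are on `∂Ω`, and disks are convex. The bound does
not depend on the mesh, although the polygon need not lie in `Ω`. -/
theorem norm_le_of_mem_carrier {Ω : Set Plane} (hfit : 𝒯.Fits Ω) {R : ℝ}
    (hR : frontier Ω ⊆ Metric.closedBall 0 R) {x : Plane} (hx : x ∈ 𝒯.carrier) : ‖x‖ ≤ R := by
  obtain ⟨y, hy, hmax⟩ := isCompact_carrier.exists_isMaxOn ⟨x, hx⟩ continuous_norm.continuousOn
  refine (hmax hx).trans ?_
  have hyb : y ∈ 𝒯.bdry := by
    rw [bdry_eq]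
    refine ⟨hy, fun hyd => ?_⟩
    have hsub : 𝒯.carrier ⊆ Metric.closedBall 0 ‖y‖ := fun z hz => by simpa using hmax hz
    have := interior_mono hsub hyd
    rw [interior_closedBall'] at this
    simp at this
  obtain ⟨T, hT, hyT⟩ := mem_carrier.1 hy
  rcases mem_bdry_cases hT hyT hyb with h | ⟨β, hβ, hb, hys⟩
  · simpa using hR (hfit.vertex_mem T hT y h hyb)
  · have hmem : ∀ j, β j ∈ T := fun j => by
      rw [← Finset.mem_coe, ← hβ]
      exact mem_range_self j
    rw [oppEdge_eq_segment hβ] at hb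
    have h1 := hR (hfit.vertex_mem T hT _ (hmem 1) (hb (left_mem_segment ℝ _ _)))
    have h2 := hR (hfit.vertex_mem T hT _ (hmem 2) (hb (right_mem_segment ℝ _ _)))
    simpa using (convex_closedBall (0 : Plane) R).segment_subset h1 h2 hys

end TriMesh

/-! ### Values of the correction polynomials along an edge -/

/-- Polynomials of degree at most `k` that agree at `k + 1` points of an edge agree on this edge. -/
theorem evalFun_eq_of_edgePoint {β : AffineBasis (Fin 3) ℝ Plane} {k : ℕ} (hk : 0 < k)
    {p q : MvPolynomial (Fin 2) ℝ} (hp : p.totalDegree ≤ k) (hq : q.totalDegree ≤ k)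
    (h : ∀ j ≤ k, evalFun p (edgePoint β k j) = evalFun q (edgePoint β k j)) {x : Plane}
    (hx : x ∈ segment ℝ (β 1) (β 2)) : evalFun p x = evalFun q x := by
  obtain ⟨P, hP, hPe⟩ := exists_polynomial_lineMap p (β 1) (β 2)
  obtain ⟨Q, hQ, hQe⟩ := exists_polynomial_lineMap q (β 1) (β 2)
  have hk' : (k : ℝ) ≠ 0 := by exact_mod_cast hk.ne'
  have hPQ : P = Q := by
    refine Polynomial.eq_of_natDegree_lt_card_of_eval_eq P Q
      (f := fun i : Fin (k + 1) => (i : ℝ) / k) (fun i j hij => ?_) (fun i => ?_) ?_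
    · have h1 : (i : ℝ) = j := (div_left_inj' hk').1 hij
      exact Fin.ext (by exact_mod_cast h1)
    · rw [hPe, hQe]
      exact h i (Nat.lt_succ_iff.1 i.2)
    · rw [Fintype.card_fin, Nat.lt_succ_iff]
      exact max_le (hP.trans hp) (hQ.trans hq)
  rw [segment_eq_image_lineMap] at hx
  obtain ⟨t, -, rfl⟩ := hx
  rw [← hPe, ← hQe, hPQ]

theorem edgeCorrection_eq_zero {β : AffineBasis (Fin 3) ℝ Plane} {k : ℕ} {y : ℕ → ℝ} {x : Plane}
    (hx : β.coord 1 x = 0 ∨ β.coord 2 x = 0) : edgeCorrection β k y x = 0 := by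
  refine Finset.sum_eq_zero fun j hj => ?_
  obtain ⟨hj0, hjk⟩ := Finset.mem_Ioo.1 hj
  rcases hx with hx | hx
  · rw [edgeBump_eq_zero_of_coord_one hjk hx, mul_zero]
  · rw [edgeBump_eq_zero_of_coord_two hj0 hx, mul_zero]

theorem edgeCorrection_edgePoint {β : AffineBasis (Fin 3) ℝ Plane} {k : ℕ} {y : ℕ → ℝ} {i : ℕ}
    (hi : i ∈ Finset.Ioo 0 k) : edgeCorrection β k y (edgePoint β k i) = y i := by
  obtain ⟨hi0, hik⟩ := Finset.mem_Ioo.1 hi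
  rw [edgeCorrection, Finset.sum_eq_single i]
  · rw [edgeBump_edgePoint (hi0.trans hik) hik.le, if_pos rfl, mul_one]
  · intro j _ hji
    rw [edgeBump_edgePoint (hi0.trans hik) hik.le, if_neg hji.symm, mul_zero]
  · exact fun h => (h hi).elim

theorem edgeCorrection_lineMap {β : AffineBasis (Fin 3) ℝ Plane} {k : ℕ} (y : ℕ → ℝ) (x : Plane)
    (τ : ℝ) : edgeCorrection β k y (AffineMap.lineMap (β 0) x τ)
      = τ ^ k * edgeCorrection β k y x := by
  rw [edgeCorrection, edgeCorrection, Finset.mul_sum]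
  refine Finset.sum_congr rfl fun j hj => ?_
  rw [edgeBump_lineMap (Finset.mem_Ioo.1 hj).2.le]
  ring

theorem exists_evalFun_eq_edgeCorrection (β : AffineBasis (Fin 3) ℝ Plane) (k : ℕ) (y : ℕ → ℝ) :
    ∃ p : MvPolynomial (Fin 2) ℝ, p.totalDegree ≤ k ∧
      ∀ x, evalFun p x = edgeCorrection β k y x := by
  have h : ∀ j, ∃ p : MvPolynomial (Fin 2) ℝ, j ≤ k → p.totalDegree ≤ k ∧
      ∀ x, evalFun p x = edgeBump β k j x := fun j => by
    by_cases hj : j ≤ k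
    · obtain ⟨p, hp⟩ := exists_evalFun_eq_edgeBump (β := β) hj
      exact ⟨p, fun _ => hp⟩
    · exact ⟨0, fun h => (hj h).elim⟩
  choose p hp using h
  refine ⟨∑ j ∈ Finset.Ioo 0 k, y j • p j, ?_, fun x => ?_⟩
  · refine MvPolynomial.totalDegree_finsetSum_le fun j hj => ?_
    exact (MvPolynomial.totalDegree_smul_le _ _).trans (hp j (Finset.mem_Ioo.1 hj).2.le).1
  · rw [edgeCorrection, evalFun, map_sum]
    refine Finset.sum_congr rfl fun j hj => ?_
    rw [MvPolynomial.smul_eval, ← (hp j (Finset.mem_Ioo.1 hj).2.le).2]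
    rfl

/-! ### The global correction, and passage between trial and test functions -/

namespace TriMesh

variable {𝒯 : TriMesh} {k : ℕ}

/-- The vertices of `T` are listed by `β`, and the edge opposite to `β 0` is on the boundary. -/
def IsEdgeBasis (𝒯 : TriMesh) (T : Finset Plane) (β : AffineBasis (Fin 3) ℝ Plane) : Prop :=
  range β = T ∧ oppEdge T (β 0) ⊆ 𝒯.bdry

theorem nonempty_affineBasis : Nonempty (AffineBasis (Fin 3) ℝ Plane) :=
  AffineBasis.exists_affineBasis_of_finiteDimensional (by simp)

/-- A listing of the vertices of a triangle with a boundary edge, starting with the vertex opposite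
to this edge. -/
def edgeBasis (𝒯 : TriMesh) (T : Finset Plane) : AffineBasis (Fin 3) ℝ Plane :=
  @Classical.epsilon _ nonempty_affineBasis (𝒯.IsEdgeBasis T)

open Classical in
/-- The triangles with a boundary edge. -/
def bdryElements (𝒯 : TriMesh) : Finset (Finset Plane) :=
  {T ∈ 𝒯.elements | ∃ β, 𝒯.IsEdgeBasis T β}

theorem mem_bdryElements {T : Finset Plane} :
    T ∈ 𝒯.bdryElements ↔ T ∈ 𝒯.elements ∧ ∃ β, 𝒯.IsEdgeBasis T β := by
  classical
  exact Finset.mem_filter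

theorem mem_elements_of_mem_bdryElements {T : Finset Plane} (hT : T ∈ 𝒯.bdryElements) :
    T ∈ 𝒯.elements := (mem_bdryElements.1 hT).1

theorem isEdgeBasis_edgeBasis {T : Finset Plane} (hT : T ∈ 𝒯.bdryElements) :
    𝒯.IsEdgeBasis T (𝒯.edgeBasis T) :=
  Classical.epsilon_spec (mem_bdryElements.1 hT).2

theorem IsEdgeBasis.mem {T : Finset Plane} {β : AffineBasis (Fin 3) ℝ Plane}
    (h : 𝒯.IsEdgeBasis T β) (i : Fin 3) : β i ∈ T := by
  rw [← Finset.mem_coe, ← h.1]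
  exact mem_range_self i

theorem IsEdgeBasis.segment_subset_bdry {T : Finset Plane} {β : AffineBasis (Fin 3) ℝ Plane}
    (h : 𝒯.IsEdgeBasis T β) : segment ℝ (β 1) (β 2) ⊆ 𝒯.bdry := by
  rw [← oppEdge_eq_segment h.1]
  exact h.2

theorem IsEdgeBasis.segment_subset_tri {T : Finset Plane} {β : AffineBasis (Fin 3) ℝ Plane}
    (h : 𝒯.IsEdgeBasis T β) : segment ℝ (β 1) (β 2) ⊆ tri T :=
  (convex_convexHull ℝ _).segment_subset (subset_convexHull ℝ _ (h.mem 1))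
    (subset_convexHull ℝ _ (h.mem 2))

/-- The piecewise polynomial function, supported by the triangles with a boundary edge, that is
given in each of them by `edgeCorrection`. -/
def correction (𝒯 : TriMesh) (k : ℕ) (Y : Finset Plane → ℕ → ℝ) (x : Plane) : ℝ :=
  ∑ T ∈ 𝒯.bdryElements, (tri T).indicator (edgeCorrection (𝒯.edgeBasis T) k (Y T)) x

theorem correction_of_notMem_carrier {Y : Finset Plane → ℕ → ℝ} {x : Plane}
    (hx : x ∉ 𝒯.carrier) : 𝒯.correction k Y x = 0 :=
  Finset.sum_eq_zero fun _ hT => indicator_of_notMem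
    (fun h => hx (tri_subset_carrier (mem_elements_of_mem_bdryElements hT) h)) _

theorem indicator_edgeCorrection_eq_zero {S T : Finset Plane} (hS : S ∈ 𝒯.bdryElements)
    (hT : T ∈ 𝒯.elements) (hne : S ≠ T) (y : ℕ → ℝ) {x : Plane} (hx : x ∈ tri T) :
    (tri S).indicator (edgeCorrection (𝒯.edgeBasis S) k y) x = 0 := by
  by_cases hxS : x ∈ tri S
  · have h := isEdgeBasis_edgeBasis hS
    rw [indicator_of_mem hxS]
    exact edgeCorrection_eq_zero (coord_eq_zero_of_mem_tri hT
      (mem_elements_of_mem_bdryElements hS) hne.symm h.1 h.2 hx hxS)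
  · exact indicator_of_notMem hxS _

theorem correction_of_mem {Y : Finset Plane → ℕ → ℝ} {T : Finset Plane}
    (hT : T ∈ 𝒯.bdryElements) {x : Plane} (hx : x ∈ tri T) :
    𝒯.correction k Y x = edgeCorrection (𝒯.edgeBasis T) k (Y T) x := by
  rw [correction, Finset.sum_eq_single_of_mem T hT fun S hS hne =>
    indicator_edgeCorrection_eq_zero hS (mem_elements_of_mem_bdryElements hT) hne _ hx,
    indicator_of_mem hx]

theorem correction_of_notMem {Y : Finset Plane → ℕ → ℝ} {T : Finset Plane}
    (hT : T ∈ 𝒯.elements) (hT' : T ∉ 𝒯.bdryElements) {x : Plane} (hx : x ∈ tri T) :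
    𝒯.correction k Y x = 0 :=
  Finset.sum_eq_zero fun _ hS => indicator_edgeCorrection_eq_zero hS hT
    (fun h => hT' (h ▸ hS)) _ hx

theorem correction_vertex {Y : Finset Plane → ℕ → ℝ} {T : Finset Plane} (hT : T ∈ 𝒯.elements)
    {A : Plane} (hA : A ∈ T) : 𝒯.correction k Y A = 0 := by
  have hAT : A ∈ tri T := subset_convexHull ℝ _ hA
  by_cases hT' : T ∈ 𝒯.bdryElements
  · have h := isEdgeBasis_edgeBasis hT'
    rw [correction_of_mem hT' hAT]
    refine edgeCorrection_eq_zero ?_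
    have hA' : A ∈ range (𝒯.edgeBasis T) := by rw [h.1]; exact hA
    obtain ⟨i, rfl⟩ := hA'
    by_cases hi : i = 1
    · subst hi
      exact Or.inr (AffineBasis.coord_apply_ne _ (by decide))
    · exact Or.inl (AffineBasis.coord_apply_ne _ (Ne.symm hi))
  · exact correction_of_notMem hT hT' hAT

theorem exists_isPolyOn_correction (Y : Finset Plane → ℕ → ℝ) {T : Finset Plane}
    (hT : T ∈ 𝒯.elements) : ∃ p, IsPolyOn k T (𝒯.correction k Y) p := by
  by_cases hT' : T ∈ 𝒯.bdryElements
  · obtain ⟨p, hp, hpe⟩ := exists_evalFun_eq_edgeCorrection (𝒯.edgeBasis T) k (Y T)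
    refine ⟨p, hp, fun x hx => ?_⟩
    rw [correction_of_mem hT' hx, ← hpe]
    rfl
  · refine ⟨0, by simp, fun x hx => ?_⟩
    rw [correction_of_notMem hT hT' hx]
    simp

theorem continuousOn_carrier {f : Plane → ℝ} (h : ∀ T ∈ 𝒯.elements, ContinuousOn f (tri T)) :
    ContinuousOn f 𝒯.carrier := by
  have h1 : 𝒯.carrier = ⋃ T : 𝒯.elements, tri T.1 := by
    ext x
    simp [carrier]
  rw [h1]
  exact (locallyFinite_of_finite _).continuousOn_iUnion (fun T => isClosed_tri T.1)
    fun T => h T.1 T.2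

/-- The continuous functions on the closed polygon that are polynomial in each triangle. -/
def lagrangeSpace (𝒯 : TriMesh) (k : ℕ) : Submodule ℝ (Plane → ℝ) where
  carrier := {w | ContinuousOn w 𝒯.carrier ∧ (∀ x, x ∉ 𝒯.carrier → w x = 0) ∧
    ∀ T ∈ 𝒯.elements, ∃ p, IsPolyOn k T w p}
  zero_mem' := ⟨continuousOn_const, fun _ _ => rfl, fun T _ => ⟨0, IsPolyOn.zero k T⟩⟩
  add_mem' := by
    rintro v w ⟨hv, hv0, hvp⟩ ⟨hw, hw0, hwp⟩
    refine ⟨hv.add hw, fun x hx => by simp [hv0 x hx, hw0 x hx], fun T hT => ?_⟩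
    obtain ⟨p, hp⟩ := hvp T hT
    obtain ⟨q, hq⟩ := hwp T hT
    exact ⟨p + q, hp.add hq⟩
  smul_mem' := by
    rintro c v ⟨hv, hv0, hvp⟩
    refine ⟨hv.const_smul c, fun x hx => by simp [hv0 x hx], fun T hT => ?_⟩
    obtain ⟨p, hp⟩ := hvp T hT
    exact ⟨c • p, hp.smul c⟩

theorem testSpace_le_lagrangeSpace : 𝒯.testSpace k ≤ 𝒯.lagrangeSpace k := fun _ hv =>
  ⟨hv.1, fun x hx => hv.2.1 x fun h => hx (domain_subset_carrier h), hv.2.2⟩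

theorem trialSpace_le_lagrangeSpace {Γ : Set Plane} : 𝒯.trialSpace Γ k ≤ 𝒯.lagrangeSpace k :=
  fun _ hw => ⟨hw.1, hw.2.1, fun T hT => by
    obtain ⟨p, hp, -⟩ := hw.2.2.2 T hT
    exact ⟨p, hp⟩⟩

theorem correction_mem_lagrangeSpace (Y : Finset Plane → ℕ → ℝ) :
    𝒯.correction k Y ∈ 𝒯.lagrangeSpace k := by
  refine ⟨continuousOn_carrier fun T hT => ?_, fun x hx => correction_of_notMem_carrier hx,
    fun T hT => exists_isPolyOn_correction Y hT⟩
  obtain ⟨p, -, hp⟩ := exists_isPolyOn_correction (k := k) Y hT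
  exact (continuous_evalFun p).continuousOn.congr hp

/-- The values of `w` at the points of the boundary edges. -/
def edgeValues (𝒯 : TriMesh) (k : ℕ) (w : Plane → ℝ) (T : Finset Plane) (j : ℕ) : ℝ :=
  w (edgePoint (𝒯.edgeBasis T) k j)

/-- A triangle has at most one boundary edge, so the apex of the arbitrarily chosen `edgeBasis` is
forced. -/
theorem Fits.eq_edgeBasis_zero {Ω : Set Plane} (hfit : 𝒯.Fits Ω) {T : Finset Plane}
    (hT : T ∈ 𝒯.bdryElements) {O : Plane} (hO : O ∈ T) (hOb : oppEdge T O ⊆ 𝒯.bdry) :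
    O = 𝒯.edgeBasis T 0 :=
  hfit.one_edge T (mem_elements_of_mem_bdryElements hT) O hO _
    ((isEdgeBasis_edgeBasis hT).mem 0) hOb (isEdgeBasis_edgeBasis hT).2

theorem segment_edgeBasis_eq {Ω : Set Plane} (hfit : 𝒯.Fits Ω) {T : Finset Plane}
    {β : AffineBasis (Fin 3) ℝ Plane} (hT : T ∈ 𝒯.bdryElements) (hβ : 𝒯.IsEdgeBasis T β) :
    segment ℝ (β 1) (β 2) = segment ℝ (𝒯.edgeBasis T 1) (𝒯.edgeBasis T 2) := by
  rw [← oppEdge_eq_segment hβ.1, ← oppEdge_eq_segment (isEdgeBasis_edgeBasis hT).1,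
    hfit.eq_edgeBasis_zero hT (hβ.mem 0) hβ.2]

/-- On a boundary edge `w` and its correction are polynomials of degree at most `k` that agree at `k
+ 1` points: the interior edge points by construction, and the two endpoints, where both vanish. -/
theorem sub_correction_mem_testSpace {Ω Γ : Set Plane} (hfit : 𝒯.Fits Ω) (hk : 0 < k)
    {w : Plane → ℝ} (hw : w ∈ 𝒯.trialSpace Γ k) :
    w - 𝒯.correction k (𝒯.edgeValues k w) ∈ 𝒯.testSpace k := by
  have hL := (𝒯.lagrangeSpace k).sub_mem (trialSpace_le_lagrangeSpace hw)
    (correction_mem_lagrangeSpace (𝒯.edgeValues k w))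
  refine ⟨hL.1, fun x hx => ?_, hL.2.2⟩
  by_cases hxc : x ∈ 𝒯.carrier
  · have hxb : x ∈ 𝒯.bdry := by
      rw [bdry_eq]
      exact ⟨hxc, hx⟩
    obtain ⟨T, hT, hxT⟩ := mem_carrier.1 hxc
    rcases mem_bdry_cases hT hxT hxb with h | ⟨β, hβ, hb, hxs⟩
    · rw [Pi.sub_apply, correction_vertex hT h, hw.2.2.1 T hT x h hxb, sub_zero]
    · have hT' : T ∈ 𝒯.bdryElements := mem_bdryElements.2 ⟨hT, β, hβ, hb⟩
      have hE := isEdgeBasis_edgeBasis hT'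
      rw [segment_edgeBasis_eq hfit hT' ⟨hβ, hb⟩] at hxs
      obtain ⟨p, hp, -⟩ := hw.2.2.2 T hT
      obtain ⟨q, hq, hqe⟩ := exists_evalFun_eq_edgeCorrection (𝒯.edgeBasis T) k
        (𝒯.edgeValues k w T)
      rw [Pi.sub_apply, sub_eq_zero, hp.2 x hxT, correction_of_mem hT' hxT, ← hqe]
      refine evalFun_eq_of_edgePoint hk hp.1 hq (fun j hj => ?_) hxs
      have hM := edgePoint_mem (β := 𝒯.edgeBasis T) hk hj
      have hMT := hE.segment_subset_tri hM
      rw [hqe]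
      refine (hp.2 _ hMT).symm.trans ?_
      have hvert : ∀ i, w (𝒯.edgeBasis T i) = 0 ∨ i = 0 := fun i => by
        by_cases hi : i = 0
        · exact Or.inr hi
        · refine Or.inl (hw.2.2.1 T hT _ (hE.mem i) (hE.segment_subset_bdry ?_))
          fin_cases i
          · exact (hi rfl).elim
          · exact left_mem_segment ℝ _ _
          · exact right_mem_segment ℝ _ _
      rcases Nat.eq_zero_or_pos j with rfl | hj0
      · have h1 : edgePoint (𝒯.edgeBasis T) k 0 = 𝒯.edgeBasis T 1 := by simp [edgePoint]
        rw [h1, (hvert 1).resolve_right (by decide), edgeCorrection_eq_zero]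
        exact Or.inr (AffineBasis.coord_apply_ne _ (by decide))
      rcases hj.eq_or_lt with rfl | hjk
      · have h1 : edgePoint (𝒯.edgeBasis T) j j = 𝒯.edgeBasis T 2 := by
          simp [edgePoint, hj0.ne']
        rw [h1, (hvert 2).resolve_right (by decide), edgeCorrection_eq_zero]
        exact Or.inl (AffineBasis.coord_apply_ne _ (by decide))
      · rw [edgeCorrection_edgePoint (Finset.mem_Ioo.2 ⟨hj0, hjk⟩)]
        rfl
  · exact hL.2.1 x hxc

/-- The nodes of a boundary triangle are the unique nearest intersections, at relative distance at
most `ε` from the edge. -/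
def HasNodes (𝒯 : TriMesh) (Γ : Set Plane) (k : ℕ) (ε : ℝ) : Prop :=
  ∀ T ∈ 𝒯.bdryElements, ∀ j ∈ Finset.Ioo 0 k, ∃ s : ℝ, |s| ≤ ε ∧
    ∀ P, IsNearestIntersection Γ (𝒯.edgeBasis T 0) (edgePoint (𝒯.edgeBasis T) k j) P ↔
      P = AffineMap.lineMap (𝒯.edgeBasis T 0) (edgePoint (𝒯.edgeBasis T) k j) (1 + s)

/-- The nodes are defined with any listing `O, A, B` of the vertices. The apex is forced, and
exchanging `A` and `B` turns the index `i` into `k - i`. -/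
theorem exists_eq_edgePoint_of_mem_nodes {Ω Γ : Set Plane} (hfit : 𝒯.Fits Ω) {T : Finset Plane}
    (hT : T ∈ 𝒯.elements) {P : Plane} (hP : P ∈ 𝒯.nodes Γ k T) :
    T ∈ 𝒯.bdryElements ∧ ∃ j ∈ Finset.Ioo 0 k,
      IsNearestIntersection Γ (𝒯.edgeBasis T 0) (edgePoint (𝒯.edgeBasis T) k j) P := by
  obtain ⟨O, A, B, hOAB, hb, i, hi0, hik, hP⟩ := hP
  obtain ⟨β, rfl, rfl, rfl, hβ⟩ := exists_affineBasis hT hOAB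
  have hT' : T ∈ 𝒯.bdryElements := mem_bdryElements.2 ⟨hT, β, hβ, hb⟩
  have hE := isEdgeBasis_edgeBasis hT'
  have hβE : 𝒯.IsEdgeBasis T β := ⟨hβ, hb⟩
  have h0 := hfit.eq_edgeBasis_zero hT' (hβE.mem 0) hb
  refine ⟨hT', ?_⟩
  have hne : ∀ i j : Fin 3, i ≠ j → β i ≠ β j := fun i j h => β.ind.injective.ne h
  have hne' : ∀ i j : Fin 3, i ≠ j → 𝒯.edgeBasis T i ≠ 𝒯.edgeBasis T j := fun i j h =>
    (𝒯.edgeBasis T).ind.injective.ne h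
  have hm : ∀ i, 𝒯.edgeBasis T i ∈ ({β 0, β 1, β 2} : Set Plane) := fun i => by
    rw [← range_fin_three, hβ, ← hE.1]
    exact mem_range_self i
  simp only [mem_insert_iff, mem_singleton_iff] at hm
  have h01 := hne' 0 1 (by decide)
  have h02 := hne' 0 2 (by decide)
  have h12 := hne' 1 2 (by decide)
  rw [h0] at hP
  have hcases : (𝒯.edgeBasis T 1 = β 1 ∧ 𝒯.edgeBasis T 2 = β 2) ∨
      (𝒯.edgeBasis T 1 = β 2 ∧ 𝒯.edgeBasis T 2 = β 1) := by
    rw [← h0] at h01 h02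
    rcases hm 1 with h1 | h1 | h1
    · exact (h01 h1.symm).elim
    · rcases hm 2 with h2 | h2 | h2
      · exact (h02 h2.symm).elim
      · exact (h12 (h1.trans h2.symm)).elim
      · exact Or.inl ⟨h1, h2⟩
    · rcases hm 2 with h2 | h2 | h2
      · exact (h02 h2.symm).elim
      · exact Or.inr ⟨h1, h2⟩
      · exact (h12 (h1.trans h2.symm)).elim
  rcases hcases with ⟨h1, h2⟩ | ⟨h1, h2⟩
  · refine ⟨i, Finset.mem_Ioo.2 ⟨hi0, hik⟩, ?_⟩
    rw [edgePoint, h1, h2]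
    exact hP
  · refine ⟨k - i, Finset.mem_Ioo.2 ⟨by omega, by omega⟩, ?_⟩
    have hk' : (k : ℝ) ≠ 0 := by exact_mod_cast (hi0.trans hik).ne'
    have h3 : (((k - i : ℕ) : ℝ) / k) = 1 - (i : ℝ) / k := by
      rw [Nat.cast_sub hik.le]
      field_simp
    rw [edgePoint, h1, h2, h3, AffineMap.lineMap_apply_one_sub]
    exact hP

/-- To `v` one adds a correction that makes the sum vanish at the nodes. By homogeneity the node on
the line through an edge point sees only the coefficient of that edge point, so the system is
diagonal. -/
theorem exists_trialSpace_sub_correction_eq {Ω Γ : Set Plane} (hfit : 𝒯.Fits Ω) {ε : ℝ}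
    (hε : ε < 1) (hn : 𝒯.HasNodes Γ k ε) {v : Plane → ℝ} (hv : v ∈ 𝒯.testSpace k) :
    ∃ w ∈ 𝒯.trialSpace Γ k, w - 𝒯.correction k (𝒯.edgeValues k w) = v := by
  have hpoly : ∀ T, ∃ p, T ∈ 𝒯.elements → IsPolyOn k T v p := fun T => by
    by_cases hT : T ∈ 𝒯.elements
    · obtain ⟨p, hp⟩ := hv.2.2 T hT
      exact ⟨p, fun _ => hp⟩
    · exact ⟨0, fun h => (hT h).elim⟩
  choose p hp using hpoly
  choose! s hs hsP using hn
  -- Solves `p(P) + (1 + s)^k Y = 0` at the node `P`; the factor is nonzero because `|s| ≤ ε < 1`.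
  let Y : Finset Plane → ℕ → ℝ := fun T j =>
    -(evalFun (p T) (AffineMap.lineMap (𝒯.edgeBasis T 0) (edgePoint (𝒯.edgeBasis T) k j)
      (1 + s T j)) / (1 + s T j) ^ k)
  have hbd : ∀ x ∈ 𝒯.bdry, v x = 0 := fun x hx => hv.2.1 x (by
    rw [bdry_eq] at hx
    exact hx.2)
  have hL := (𝒯.lagrangeSpace k).add_mem (testSpace_le_lagrangeSpace hv)
    (correction_mem_lagrangeSpace Y)
  refine ⟨v + 𝒯.correction k Y, ⟨hL.1, hL.2.1, fun T hT A hA hAb => ?_, fun T hT => ?_⟩, ?_⟩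
  · rw [Pi.add_apply, correction_vertex hT hA, hbd A hAb, add_zero]
  · by_cases hT' : T ∈ 𝒯.bdryElements
    · obtain ⟨q, hq, hqe⟩ := exists_evalFun_eq_edgeCorrection (𝒯.edgeBasis T) k (Y T)
      refine ⟨p T + q, (hp T hT).add ⟨hq, fun x hx => ?_⟩, fun P hP => ?_⟩
      · rw [correction_of_mem hT' hx, ← hqe]
        rfl
      · obtain ⟨-, j, hj, hPj⟩ := exists_eq_edgePoint_of_mem_nodes hfit hT hP
        have hPe := (hsP T hT' j hj P).1 hPj
        have hsj := hs T hT' j hj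
        have h1 : 1 + s T j ≠ 0 := by
          have := abs_le.1 hsj
          exact (by linarith : 0 < 1 + s T j).ne'
        have h2 : evalFun q P = (1 + s T j) ^ k * Y T j := by
          rw [hqe, hPe, edgeCorrection_lineMap, edgeCorrection_edgePoint hj]
        change evalFun (p T + q) P = 0
        have h3 : evalFun (p T + q) P = evalFun (p T) P + evalFun q P := by simp [evalFun]
        rw [h3, h2]
        simp only [Y]
        rw [← hPe]
        field_simp
        ring
    · refine ⟨p T, ⟨(hp T hT).1, fun x hx => ?_⟩, fun P hP => ?_⟩
      · rw [Pi.add_apply, correction_of_notMem hT hT' hx, add_zero]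
        exact (hp T hT).2 x hx
      · exact (hT' (exists_eq_edgePoint_of_mem_nodes hfit hT hP).1).elim
  -- Since `v` vanishes on the boundary edges, the edge values of the sum are the coefficients `Y`.
  · have hc : 𝒯.correction k (𝒯.edgeValues k (v + 𝒯.correction k Y)) = 𝒯.correction k Y := by
      ext x
      refine Finset.sum_congr rfl fun T hT => ?_
      have hE := isEdgeBasis_edgeBasis hT
      congr 1
      ext z
      refine Finset.sum_congr rfl fun j hj => ?_
      obtain ⟨hj0, hjk⟩ := Finset.mem_Ioo.1 hj
      have hM := edgePoint_mem (β := 𝒯.edgeBasis T) (hj0.trans hjk) hjk.le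
      rw [edgeValues, Pi.add_apply, hbd _ (hE.segment_subset_bdry hM), zero_add,
        correction_of_mem hT (hE.segment_subset_tri hM), edgeCorrection_edgePoint hj]
    rw [hc, add_sub_cancel_right]

end TriMesh

/-! ### Integrals over the mesh and the bilinear form -/

theorem abs_integral_inner_le {α : Type*} {m : MeasurableSpace α} {μ : Measure α}
    {F G : α → Plane} (hF : MemLp F 2 μ) (hG : MemLp G 2 μ) :
    |∫ x, inner ℝ (F x) (G x) ∂μ|
      ≤ Real.sqrt (∫ x, ‖F x‖ ^ 2 ∂μ) * Real.sqrt (∫ x, ‖G x‖ ^ 2 ∂μ) := by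
  have hint : Integrable (fun x => |‖F x‖| * |‖G x‖|) μ :=
    hF.norm.abs.integrable_mul hG.norm.abs
  rw [← Real.norm_eq_abs]
  refine (norm_integral_le_of_norm_le hint (Eventually.of_forall fun x => ?_)).trans
    (integral_mul_le_sqrt_mul_sqrt hF.norm hG.norm)
  simpa using norm_inner_le_norm (𝕜 := ℝ) (F x) (G x)

namespace TriMesh

variable {𝒯 : TriMesh} {k : ℕ}

theorem volume_tri_sdiff_interior (T : Finset Plane) :
    volume (tri T \ interior (tri T)) = 0 := by
  have h : volume (frontier (tri T)) = 0 :=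
    (convex_convexHull ℝ (T : Set Plane)).addHaar_frontier volume
  rwa [IsClosed.frontier_eq (isClosed_tri T)] at h

theorem volume_carrier_sdiff : volume (𝒯.carrier \ ⋃ T ∈ 𝒯.elements, interior (tri T)) = 0 := by
  refine measure_mono_null (t := ⋃ T ∈ 𝒯.elements, (tri T \ interior (tri T))) ?_ ?_
  · rintro x ⟨hx, hn⟩
    obtain ⟨T, hT, hxT⟩ := mem_carrier.1 hx
    refine mem_biUnion hT ⟨hxT, fun h => hn (mem_biUnion hT h)⟩
  · exact (measure_biUnion_null_iff 𝒯.elements.countable_toSet).2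
      fun T _ => volume_tri_sdiff_interior T

theorem ae_mem_interior_tri :
    ∀ᵐ x ∂volume.restrict 𝒯.domain, ∃ T ∈ 𝒯.elements, x ∈ interior (tri T) := by
  rw [ae_restrict_iff' isOpen_domain.measurableSet]
  have h : ∀ᵐ x ∂(volume : Measure Plane), x ∉ 𝒯.carrier \ ⋃ T ∈ 𝒯.elements, interior (tri T) :=
    measure_eq_zero_iff_ae_notMem.1 volume_carrier_sdiff
  filter_upwards [h] with x hx hxd
  by_contra hn
  refine hx ⟨domain_subset_carrier hxd, fun h => hn ?_⟩
  simpa using h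

instance : IsFiniteMeasure (volume.restrict 𝒯.domain) :=
  ⟨by simpa using (measure_mono domain_subset_carrier).trans_lt isCompact_carrier.measure_lt_top⟩

theorem ae_restrict_tri (T : Finset Plane) :
    ∀ᵐ x ∂volume.restrict (tri T), x ∈ interior (tri T) := by
  rw [ae_restrict_iff' (isClosed_tri T).measurableSet]
  have h : ∀ᵐ x ∂(volume : Measure Plane), x ∉ tri T \ interior (tri T) :=
    measure_eq_zero_iff_ae_notMem.1 (volume_tri_sdiff_interior T)
  filter_upwards [h] with x hx hxT
  by_contra hn
  exact hx ⟨hxT, hn⟩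

theorem gradient_congr_of_eqOn_tri {T : Finset Plane} {f g : Plane → ℝ}
    (h : ∀ x ∈ tri T, f x = g x) {x : Plane} (hx : x ∈ interior (tri T)) :
    gradient f x = gradient g x :=
  Filter.EventuallyEq.gradient_eq
    (eventually_of_mem (isOpen_interior.mem_nhds hx) fun y hy => h y (interior_subset hy))

theorem setIntegral_tri_gradient_congr {T : Finset Plane} {f g : Plane → ℝ}
    (h : ∀ x ∈ tri T, f x = g x) :
    ∫ x in tri T, ‖gradient f x‖ ^ 2 = ∫ x in tri T, ‖gradient g x‖ ^ 2 := by
  refine integral_congr_ae ?_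
  filter_upwards [ae_restrict_tri T] with x hx
  rw [gradient_congr_of_eqOn_tri h hx]

theorem setIntegral_domain_eq_sum {f : Plane → ℝ} (hf : IntegrableOn f 𝒯.domain) :
    ∫ x in 𝒯.domain, f x = ∑ T ∈ 𝒯.elements, ∫ x in tri T, f x := by
  have h1 : (𝒯.domain : Set Plane) =ᵐ[volume] ⋃ T ∈ 𝒯.elements, interior (tri T) := by
    refine Filter.EventuallyLE.antisymm ?_ ?_
    · have h : ∀ᵐ x ∂(volume : Measure Plane),
          x ∉ 𝒯.carrier \ ⋃ T ∈ 𝒯.elements, interior (tri T) :=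
        measure_eq_zero_iff_ae_notMem.1 volume_carrier_sdiff
      filter_upwards [h] with x hx hxd
      by_contra hn
      exact hx ⟨domain_subset_carrier hxd, hn⟩
    · have h : (⋃ T ∈ 𝒯.elements, interior (tri T)) ⊆ 𝒯.domain :=
        iUnion₂_subset fun T hT => interior_tri_subset_domain hT
      exact h.eventuallyLE
  rw [setIntegral_congr_set h1, integral_biUnion_finset _
    (fun T _ => isOpen_interior.measurableSet)
    (fun S hS T hT hne => disjoint_interior_tri hS hT hne)
    (fun T hT => hf.mono_set (interior_tri_subset_domain hT))]
  refine Finset.sum_congr rfl fun T _ => ?_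
  refine setIntegral_congr_set (interior_subset.eventuallyLE.antisymm ?_)
  have h := (ae_restrict_iff' (isClosed_tri T).measurableSet).1 (ae_restrict_tri T)
  filter_upwards [h] with x hx hxT using hx hxT

theorem exists_bound_gradient {w : Plane → ℝ} (hw : w ∈ 𝒯.lagrangeSpace k) :
    ∃ C : ℝ, ∀ T ∈ 𝒯.elements, ∀ x ∈ interior (tri T),
      DifferentiableAt ℝ w x ∧ ‖gradient w x‖ ≤ C := by
  have h : ∀ T : Finset Plane, ∃ C : ℝ, T ∈ 𝒯.elements → ∀ x ∈ interior (tri T),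
      DifferentiableAt ℝ w x ∧ ‖gradient w x‖ ≤ C := fun T => by
    by_cases hT : T ∈ 𝒯.elements
    · obtain ⟨p, hp⟩ := hw.2.2 T hT
      obtain ⟨C, hC⟩ := (isCompact_tri T).exists_bound_of_continuousOn
        (continuous_gradient_evalFun p).continuousOn
      refine ⟨C, fun _ x hx => ⟨?_, ?_⟩⟩
      · refine (differentiable_evalFun p x).congr_of_eventuallyEq ?_
        exact eventually_of_mem (isOpen_interior.mem_nhds hx) fun y hy =>
          hp.2 y (interior_subset hy)
      · rw [gradient_congr_of_eqOn_tri (g := evalFun p) hp.2 hx]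
        exact hC x (interior_subset hx)
    · exact ⟨0, fun h => (hT h).elim⟩
  choose C hC using h
  refine ⟨∑ T ∈ 𝒯.elements, |C T|, fun T hT x hx => ⟨(hC T hT x hx).1, ?_⟩⟩
  exact (hC T hT x hx).2.trans ((le_abs_self _).trans
    (Finset.single_le_sum (f := fun T => |C T|) (fun S _ => abs_nonneg _) hT))

theorem ae_differentiableAt {w : Plane → ℝ} (hw : w ∈ 𝒯.lagrangeSpace k) :
    ∀ᵐ x ∂volume.restrict 𝒯.domain, DifferentiableAt ℝ w x := by
  obtain ⟨C, hC⟩ := exists_bound_gradient hw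
  filter_upwards [ae_mem_interior_tri] with x ⟨T, hT, hx⟩ using (hC T hT x hx).1

theorem memLp_gradient {w : Plane → ℝ} (hw : w ∈ 𝒯.lagrangeSpace k) :
    MemLp (gradient w) 2 (volume.restrict 𝒯.domain) := by
  obtain ⟨C, hC⟩ := exists_bound_gradient hw
  refine MemLp.of_bound (measurable_gradient w).aestronglyMeasurable C ?_
  filter_upwards [ae_mem_interior_tri] with x ⟨T, hT, hx⟩ using (hC T hT x hx).2

theorem memLp_of_continuousOn {E : Type*} [NormedAddCommGroup E] {v : Plane → E}
    (hv : ContinuousOn v 𝒯.carrier) : MemLp v 2 (volume.restrict 𝒯.domain) := by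
  obtain ⟨C, hC⟩ := isCompact_carrier.exists_bound_of_continuousOn hv
  have : SecondCountableTopologyEither Plane E := ⟨Or.inl inferInstance⟩
  refine MemLp.of_bound ((hv.mono domain_subset_carrier).aestronglyMeasurable
    isOpen_domain.measurableSet) C ?_
  exact (ae_restrict_iff' isOpen_domain.measurableSet).2
    (Eventually.of_forall fun x hx => hC x (domain_subset_carrier hx))

theorem memLp_inner_gradient {b : Plane → Plane} (hb : Continuous b) {w : Plane → ℝ}
    (hw : w ∈ 𝒯.lagrangeSpace k) :
    MemLp (fun x => inner ℝ (b x) (gradient w x)) 2 (volume.restrict 𝒯.domain) := by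
  obtain ⟨B, hB⟩ := isCompact_carrier.exists_bound_of_continuousOn (hb.continuousOn (s := 𝒯.carrier))
  refine (memLp_gradient hw).of_le_mul (c := B)
    (hb.aestronglyMeasurable.inner (measurable_gradient w).aestronglyMeasurable) ?_
  refine (ae_restrict_iff' isOpen_domain.measurableSet).2 (Eventually.of_forall fun x hx => ?_)
  refine (norm_inner_le_norm _ _).trans ?_
  gcongr
  exact hB x (domain_subset_carrier hx)

theorem integrable_inner_gradient {w v : Plane → ℝ} (hw : w ∈ 𝒯.lagrangeSpace k)
    (hv : v ∈ 𝒯.lagrangeSpace k) :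
    Integrable (fun x => inner ℝ (gradient w x) (gradient v x)) (volume.restrict 𝒯.domain) := by
  have hint : Integrable (fun x => ‖gradient w x‖ * ‖gradient v x‖) (volume.restrict 𝒯.domain) :=
    (memLp_gradient hw).norm.integrable_mul (memLp_gradient hv).norm
  refine hint.mono' ((measurable_gradient w).aestronglyMeasurable.inner
    (measurable_gradient v).aestronglyMeasurable) (Eventually.of_forall fun x => ?_)
  exact norm_inner_le_norm _ _

theorem integrable_convection {b : Plane → Plane} (hb : Continuous b) {w v : Plane → ℝ}
    (hw : w ∈ 𝒯.lagrangeSpace k) (hv : v ∈ 𝒯.lagrangeSpace k) :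
    Integrable (fun x => inner ℝ (b x) (gradient w x) * v x) (volume.restrict 𝒯.domain) :=
  (memLp_inner_gradient hb hw).integrable_mul (memLp_of_continuousOn hv.1)

theorem form_eq {ν : ℝ} {b : Plane → Plane} (hb : Continuous b) {w v : Plane → ℝ}
    (hw : w ∈ 𝒯.lagrangeSpace k) (hv : v ∈ 𝒯.lagrangeSpace k) :
    𝒯.form ν b w v = ν * (∫ x in 𝒯.domain, inner ℝ (gradient w x) (gradient v x))
      + ∫ x in 𝒯.domain, inner ℝ (b x) (gradient w x) * v x := by
  rw [form, integral_add ((integrable_inner_gradient hw hv).const_mul ν)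
    (integrable_convection hb hw hv), integral_const_mul]

theorem integrable_form {ν : ℝ} {b : Plane → Plane} (hb : Continuous b) {w v : Plane → ℝ}
    (hw : w ∈ 𝒯.lagrangeSpace k) (hv : v ∈ 𝒯.lagrangeSpace k) :
    Integrable (fun x => ν * inner ℝ (gradient w x) (gradient v x)
      + inner ℝ (b x) (gradient w x) * v x) (volume.restrict 𝒯.domain) :=
  ((integrable_inner_gradient hw hv).const_mul ν).add (integrable_convection hb hw hv)

theorem gradient_add_apply {f g : Plane → ℝ} {x : Plane} (hf : DifferentiableAt ℝ f x)
    (hg : DifferentiableAt ℝ g x) : gradient (f + g) x = gradient f x + gradient g x := by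
  rw [gradient, fderiv_add hf hg, map_add]
  rfl

theorem gradient_smul_apply (c : ℝ) {f : Plane → ℝ} {x : Plane} (hf : DifferentiableAt ℝ f x) :
    gradient (c • f) x = c • gradient f x := by
  rw [gradient, fderiv_const_smul hf, map_smulₛₗ]
  rfl

theorem form_add_left {ν : ℝ} {b : Plane → Plane} (hb : Continuous b) {w w' v : Plane → ℝ}
    (hw : w ∈ 𝒯.lagrangeSpace k) (hw' : w' ∈ 𝒯.lagrangeSpace k) (hv : v ∈ 𝒯.lagrangeSpace k) :
    𝒯.form ν b (w + w') v = 𝒯.form ν b w v + 𝒯.form ν b w' v := by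
  rw [form, form, form, ← integral_add (integrable_form hb hw hv) (integrable_form hb hw' hv)]
  refine integral_congr_ae ?_
  filter_upwards [ae_differentiableAt hw, ae_differentiableAt hw'] with x hx hx'
  rw [gradient_add_apply hx hx', inner_add_left, inner_add_right]
  ring

theorem form_smul_left {ν : ℝ} {b : Plane → Plane} (c : ℝ) {w v : Plane → ℝ}
    (hw : w ∈ 𝒯.lagrangeSpace k) : 𝒯.form ν b (c • w) v = c * 𝒯.form ν b w v := by
  rw [form, form, ← integral_const_mul]
  refine integral_congr_ae ?_
  filter_upwards [ae_differentiableAt hw] with x hx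
  rw [gradient_smul_apply c hx, real_inner_smul_left, real_inner_smul_right]
  ring

theorem form_add_right {ν : ℝ} {b : Plane → Plane} (hb : Continuous b) {w v v' : Plane → ℝ}
    (hw : w ∈ 𝒯.lagrangeSpace k) (hv : v ∈ 𝒯.lagrangeSpace k) (hv' : v' ∈ 𝒯.lagrangeSpace k) :
    𝒯.form ν b w (v + v') = 𝒯.form ν b w v + 𝒯.form ν b w v' := by
  rw [form, form, form, ← integral_add (integrable_form hb hw hv) (integrable_form hb hw hv')]
  refine integral_congr_ae ?_
  filter_upwards [ae_differentiableAt hv, ae_differentiableAt hv'] with x hx hx'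
  rw [gradient_add_apply hx hx', inner_add_right, Pi.add_apply]
  ring

theorem form_smul_right {ν : ℝ} {b : Plane → Plane} (c : ℝ) {w v : Plane → ℝ}
    (hv : v ∈ 𝒯.lagrangeSpace k) : 𝒯.form ν b w (c • v) = c * 𝒯.form ν b w v := by
  rw [form, form, ← integral_const_mul]
  refine integral_congr_ae ?_
  filter_upwards [ae_differentiableAt hv] with x hx
  rw [gradient_smul_apply c hx, real_inner_smul_right, Pi.smul_apply, smul_eq_mul]
  ring

theorem gradNorm_nonneg (w : Plane → ℝ) : 0 ≤ 𝒯.gradNorm w := Real.sqrt_nonneg _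

theorem gradNorm_sq (w : Plane → ℝ) :
    𝒯.gradNorm w ^ 2 = ∫ x in 𝒯.domain, ‖gradient w x‖ ^ 2 :=
  Real.sq_sqrt (integral_nonneg fun _ => sq_nonneg _)

theorem integrable_norm_sq_gradient {w : Plane → ℝ} (hw : w ∈ 𝒯.lagrangeSpace k) :
    Integrable (fun x => ‖gradient w x‖ ^ 2) (volume.restrict 𝒯.domain) :=
  (memLp_gradient hw).norm.integrable_sq

theorem gradNorm_sq_eq_sum {w : Plane → ℝ} (hw : w ∈ 𝒯.lagrangeSpace k) :
    𝒯.gradNorm w ^ 2 = ∑ T ∈ 𝒯.elements, ∫ x in tri T, ‖gradient w x‖ ^ 2 := by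
  rw [gradNorm_sq, setIntegral_domain_eq_sum (integrable_norm_sq_gradient hw)]

theorem gradNorm_add_le {w v : Plane → ℝ} (hw : w ∈ 𝒯.lagrangeSpace k)
    (hv : v ∈ 𝒯.lagrangeSpace k) : 𝒯.gradNorm (w + v) ≤ 𝒯.gradNorm w + 𝒯.gradNorm v := by
  have h1 : 𝒯.gradNorm (w + v) ^ 2 = 𝒯.gradNorm w ^ 2
      + 2 * (∫ x in 𝒯.domain, inner ℝ (gradient w x) (gradient v x)) + 𝒯.gradNorm v ^ 2 := by
    simp only [gradNorm_sq]
    have hsum : Integrable (fun x => ‖gradient w x‖ ^ 2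
        + 2 * inner ℝ (gradient w x) (gradient v x)) (volume.restrict 𝒯.domain) :=
      (integrable_norm_sq_gradient hw).add ((integrable_inner_gradient hw hv).const_mul 2)
    rw [← integral_const_mul, ← integral_add (integrable_norm_sq_gradient hw)
      ((integrable_inner_gradient hw hv).const_mul 2), ← integral_add hsum
      (integrable_norm_sq_gradient hv)]
    refine integral_congr_ae ?_
    filter_upwards [ae_differentiableAt hw, ae_differentiableAt hv] with x hx hx'
    rw [gradient_add_apply hx hx']
    exact norm_add_sq_real _ _
  have h2 := abs_integral_inner_le (memLp_gradient hw) (memLp_gradient hv)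
  have h3 := le_abs_self (∫ x in 𝒯.domain, inner ℝ (gradient w x) (gradient v x))
  change _ ≤ 𝒯.gradNorm w * 𝒯.gradNorm v at h2
  have h4 := gradNorm_nonneg (𝒯 := 𝒯) w
  have h5 := gradNorm_nonneg (𝒯 := 𝒯) v
  nlinarith [gradNorm_nonneg (𝒯 := 𝒯) (w + v)]

/-- The plane is covered by the triangles, where `v` is a polynomial on a compact convex set, and by
the complement of the domain, where `v` vanishes. Integration by parts can then take place on the
whole plane, with no boundary terms. -/
theorem exists_lipschitzWith_of_mem_testSpace {v : Plane → ℝ} (hv : v ∈ 𝒯.testSpace k) :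
    ∃ C : ℝ≥0, LipschitzWith C v := by
  have h : ∀ T : Finset Plane, ∃ C : ℝ≥0, T ∈ 𝒯.elements → LipschitzOnWith C v (tri T) := fun T => by
    by_cases hT : T ∈ 𝒯.elements
    · obtain ⟨p, hp⟩ := hv.2.2 T hT
      obtain ⟨C, hC⟩ := (isCompact_tri T).exists_bound_of_continuousOn
        ((contDiff_evalFun p).continuous_fderiv (by simp)).continuousOn
      have hlip : LipschitzOnWith C.toNNReal (evalFun p) (tri T) :=
        (convex_convexHull ℝ _).lipschitzOnWith_of_nnnorm_fderiv_le
          (fun x _ => differentiable_evalFun p x) fun x hx => by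
            rw [← NNReal.coe_le_coe, coe_nnnorm]
            exact (hC x hx).trans (Real.le_coe_toNNReal C)
      exact ⟨C.toNNReal, fun _ x hx y hy => by
        rw [hp.2 x hx, hp.2 y hy]
        exact hlip hx hy⟩
    · exact ⟨0, fun h => (hT h).elim⟩
  choose C hC using h
  classical
  -- The index `none` stands for the complement of the domain; the sum of the constants dominates
  -- each of them.
  refine ⟨∑ T ∈ 𝒯.elements, C T, lipschitzWith_of_finset_isClosed_cover
    (K := fun o : Option (Finset Plane) => o.elim 𝒯.domainᶜ tri)
    (insert none (𝒯.elements.image some)) ?_ ?_ ?_⟩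
  · rintro (_ | T) _
    · exact isOpen_domain.isClosed_compl
    · exact isClosed_tri T
  · intro x
    by_cases hx : x ∈ 𝒯.domain
    · obtain ⟨T, hT, hxT⟩ := mem_carrier.1 (domain_subset_carrier hx)
      exact ⟨some T, by simp [hT], hxT⟩
    · exact ⟨none, by simp, hx⟩
  · rintro (_ | T) hT
    · intro x hx y hy
      rw [hv.2.1 x hx, hv.2.1 y hy]
      simp
    · have hT' : T ∈ 𝒯.elements := by simpa using hT
      exact (hC T hT').weaken (Finset.single_le_sum (f := C) (fun _ _ => zero_le) hT')

theorem hasCompactSupport_of_mem_testSpace {v : Plane → ℝ} (hv : v ∈ 𝒯.testSpace k) :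
    HasCompactSupport v :=
  HasCompactSupport.intro isCompact_carrier fun x hx =>
    hv.2.1 x fun h => hx (domain_subset_carrier h)

theorem ae_gradient_eq_zero {v : Plane → ℝ} (hv : v ∈ 𝒯.testSpace k) :
    ∀ᵐ x ∂(volume : Measure Plane), x ∉ 𝒯.domain → gradient v x = 0 := by
  have h : ∀ᵐ x ∂(volume : Measure Plane), x ∉ 𝒯.carrier \ ⋃ T ∈ 𝒯.elements, interior (tri T) :=
    measure_eq_zero_iff_ae_notMem.1 volume_carrier_sdiff
  filter_upwards [h] with x hx hxd
  have hxc : x ∉ 𝒯.carrier := fun hxc => hx ⟨hxc, fun h => by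
    obtain ⟨T, hT, hxT⟩ : ∃ T ∈ 𝒯.elements, x ∈ interior (tri T) := by simpa using h
    exact hxd (interior_tri_subset_domain hT hxT)⟩
  have : gradient v x = gradient (fun _ => (0 : ℝ)) x :=
    Filter.EventuallyEq.gradient_eq (eventually_of_mem
      (isClosed_carrier.isOpen_compl.mem_nhds hxc) fun y hy =>
        hv.2.1 y fun h => hy (domain_subset_carrier h))
  rw [this]
  simp [gradient]

/-- `2 (b·∇v) v = b·∇(v²)`, and `v²` is Lipschitz with compact support. -/
theorem setIntegral_convection_self {b : Plane → Plane} (hb : Continuous b)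
    (hdiv : IsSolenoidal b) {v : Plane → ℝ} (hv : v ∈ 𝒯.testSpace k) :
    ∫ x in 𝒯.domain, inner ℝ (b x) (gradient v x) * v x = 0 := by
  obtain ⟨C, hC⟩ := exists_lipschitzWith_of_mem_testSpace hv
  have hc := hasCompactSupport_of_mem_testSpace hv
  obtain ⟨B, hB⟩ := hC.exists_bound_of_hasCompactSupport hc
  have h1 := hdiv.integral_gradient_eq_zero hb (hC.sq_of_bounded hB)
    (hc.comp_left (g := fun t : ℝ => t ^ 2) (by simp))
  have h2 : ∀ᵐ x ∂(volume : Measure Plane),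
      inner ℝ (b x) (gradient (fun y => v y ^ 2) x) = 2 * (inner ℝ (b x) (gradient v x) * v x) := by
    filter_upwards [hC.ae_differentiableAt (μ := volume)] with x hx
    rw [gradient_sq_eq hx, real_inner_smul_right]
    ring
  rw [integral_congr_ae h2, integral_const_mul] at h1
  rw [setIntegral_eq_integral_of_ae_compl_eq_zero]
  · simpa using h1
  · filter_upwards with x hx
    rw [hv.2.1 x hx, mul_zero]

theorem sqrt_integral_sq_le_gradNorm {v : Plane → ℝ} (hv : v ∈ 𝒯.testSpace k) {R : ℝ}
    (hR : 0 ≤ R) (hs : ∀ x ∈ 𝒯.carrier, ‖x‖ ≤ R) :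
    Real.sqrt (∫ x in 𝒯.domain, v x ^ 2) ≤ 2 * R * 𝒯.gradNorm v := by
  obtain ⟨C, hC⟩ := exists_lipschitzWith_of_mem_testSpace hv
  have h := integral_sq_le_of_lipschitz hC (hasCompactSupport_of_mem_testSpace hv) hR
    fun x hx => hs x (domain_subset_carrier (by
      by_contra hn
      exact hx (hv.2.1 x hn)))
  rw [gradNorm, setIntegral_eq_integral_of_ae_compl_eq_zero,
    setIntegral_eq_integral_of_ae_compl_eq_zero]
  · exact h
  · filter_upwards [ae_gradient_eq_zero hv] with x hx hxd
    simp [hx hxd]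
  · filter_upwards with x hx
    rw [hv.2.1 x hx]
    simp

theorem eq_zero_of_gradNorm_eq_zero {v : Plane → ℝ} (hv : v ∈ 𝒯.testSpace k)
    (h : 𝒯.gradNorm v = 0) : v = 0 := by
  obtain ⟨C, hC⟩ := exists_lipschitzWith_of_mem_testSpace hv
  have hc := hasCompactSupport_of_mem_testSpace hv
  obtain ⟨R, hR⟩ := (isCompact_carrier (𝒯 := 𝒯)).isBounded.subset_closedBall (0 : Plane)
  have h1 := sqrt_integral_sq_le_gradNorm hv (le_max_right R 0) fun x hx => by
    have := hR hx
    rw [mem_closedBall_zero_iff] at this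
    exact this.trans (le_max_left _ _)
  rw [h, mul_zero, setIntegral_eq_integral_of_ae_compl_eq_zero
    (Eventually.of_forall fun x hx => by rw [hv.2.1 x hx]; simp)] at h1
  have h2 : ∫ x, v x ^ 2 = 0 :=
    (Real.sqrt_eq_zero (integral_nonneg fun _ => sq_nonneg _)).1
      (h1.antisymm (Real.sqrt_nonneg _))
  rw [integral_eq_zero_iff_of_nonneg (fun _ => sq_nonneg _)
    (hC.memLp_two_of_hasCompactSupport hc).integrable_sq] at h2
  have h3 := (Continuous.ae_eq_iff_eq volume (hC.continuous.pow 2) continuous_const).1 h2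
  ext x
  exact pow_eq_zero_iff two_ne_zero |>.1 (congrFun h3 x)

theorem form_self {ν : ℝ} {b : Plane → Plane} (hb : Continuous b) (hdiv : IsSolenoidal b)
    {v : Plane → ℝ} (hv : v ∈ 𝒯.testSpace k) : 𝒯.form ν b v v = ν * 𝒯.gradNorm v ^ 2 := by
  have hL := testSpace_le_lagrangeSpace hv
  rw [form_eq hb hL hL, setIntegral_convection_self hb hdiv hv, add_zero, gradNorm_sq]
  simp

/-- Cauchy–Schwarz in both terms. Poincaré's inequality is used for `v` only, so `w` may be a
correction that does not vanish on `Γ_h`. -/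
theorem abs_form_le {ν : ℝ} (hν : 0 ≤ ν) {b : Plane → Plane} (hb : Continuous b) {R B : ℝ}
    (hR : 0 ≤ R) (hB0 : 0 ≤ B) (hs : ∀ x ∈ 𝒯.carrier, ‖x‖ ≤ R)
    (hB : ∀ x ∈ 𝒯.carrier, ‖b x‖ ≤ B) {w v : Plane → ℝ} (hw : w ∈ 𝒯.lagrangeSpace k)
    (hv : v ∈ 𝒯.testSpace k) :
    |𝒯.form ν b w v| ≤ (ν + 2 * R * B) * 𝒯.gradNorm w * 𝒯.gradNorm v := by
  have hL := testSpace_le_lagrangeSpace hv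
  have h1 : |∫ x in 𝒯.domain, inner ℝ (gradient w x) (gradient v x)|
      ≤ 𝒯.gradNorm w * 𝒯.gradNorm v :=
    abs_integral_inner_le (memLp_gradient hw) (memLp_gradient hL)
  have hvm := memLp_of_continuousOn (𝒯 := 𝒯) hL.1
  have h2 : |∫ x in 𝒯.domain, inner ℝ (b x) (gradient w x) * v x|
      ≤ B * (𝒯.gradNorm w * (2 * R * 𝒯.gradNorm v)) := by
    have hint : Integrable (fun x => |‖gradient w x‖| * |v x|) (volume.restrict 𝒯.domain) :=
      (memLp_gradient hw).norm.abs.integrable_mul hvm.abs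
    have h3 : ‖∫ x in 𝒯.domain, inner ℝ (b x) (gradient w x) * v x‖
        ≤ ∫ x in 𝒯.domain, B * (|‖gradient w x‖| * |v x|) := by
      refine norm_integral_le_of_norm_le (hint.const_mul B) ?_
      refine (ae_restrict_iff' isOpen_domain.measurableSet).2
        (Eventually.of_forall fun x hx => ?_)
      rw [norm_mul, abs_norm, ← mul_assoc, Real.norm_eq_abs (v x)]
      gcongr
      refine (norm_inner_le_norm _ _).trans ?_
      gcongr
      exact hB x (domain_subset_carrier hx)
    rw [integral_const_mul] at h3
    refine h3.trans ?_
    gcongr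
    refine (integral_mul_le_sqrt_mul_sqrt (memLp_gradient hw).norm hvm).trans ?_
    change 𝒯.gradNorm w * _ ≤ _
    gcongr
    · exact gradNorm_nonneg w
    · exact sqrt_integral_sq_le_gradNorm hv hR hs
  rw [form_eq hb hw hL]
  refine (abs_add_le _ _).trans ?_
  rw [abs_mul, abs_of_nonneg hν]
  calc _ ≤ ν * (𝒯.gradNorm w * 𝒯.gradNorm v) + B * (𝒯.gradNorm w * (2 * R * 𝒯.gradNorm v)) := by
        gcongr
    _ = _ := by ring


/-! ### Shape regularity and smallness of the global correction -/

/-- A disk of diameter greater than half the supremum replaces the largest one; passing to its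
radius `ρ` gives the factor `4`, and the `+ 1` makes the constant positive for every `σ`. -/
theorem IsShapeRegular.exists_closedBall {σ : ℝ} (h : 𝒯.IsShapeRegular σ) {T : Finset Plane}
    (hT : T ∈ 𝒯.elements) : ∃ (c : Plane) (ρ : ℝ), 0 < ρ ∧ Metric.closedBall c ρ ⊆ tri T ∧
      Metric.diam (tri T) ≤ (4 * |σ| + 1) * ρ := by
  have hd : 0 < Metric.diam (tri T) := by
    refine Metric.diam_pos ?_ (isCompact_tri T).isBounded
    have hv := fun x (hx : x ∈ T) => subset_convexHull ℝ (T : Set Plane) hx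
    obtain ⟨A, hA, B, hB, hAB⟩ := Finset.one_lt_card.1
      (by rw [𝒯.card_eq T hT]; norm_num : 1 < T.card)
    exact ⟨A, hv A hA, B, hv B hB, hAB⟩
  have hreg := h T hT
  have hI0 : 0 ≤ inDiam T := by
    obtain ⟨c, hc⟩ := interior_tri_nonempty hT
    refine Real.sSup_nonneg' ⟨0, ⟨c, ?_⟩, le_rfl⟩
    simpa using interior_subset hc
  -- Positivity follows from regularity and the positive diameter; this also excludes the default
  -- value `0` of an unbounded `sSup`.
  have hI : 0 < inDiam T := by
    refine hI0.lt_of_ne fun h0 => ?_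
    rw [← h0, mul_zero] at hreg
    exact hreg.not_gt hd
  obtain ⟨d, ⟨c, hc⟩, hdI⟩ : ∃ d ∈ {d : ℝ | ∃ c : Plane, Metric.closedBall c (d / 2) ⊆ tri T},
      inDiam T / 2 < d := by
    by_contra! hn
    have : inDiam T ≤ inDiam T / 2 := Real.sSup_le hn (by positivity)
    linarith
  refine ⟨c, d / 2, by linarith, hc, ?_⟩
  have hσ := le_abs_self σ
  have h0 := abs_nonneg σ
  calc Metric.diam (tri T) ≤ σ * inDiam T := hreg
    _ ≤ |σ| * inDiam T := by gcongr
    _ ≤ |σ| * (4 * (d / 2)) := by gcongr; linarith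
    _ ≤ _ := by nlinarith

theorem diam_tri_le_size {T : Finset Plane} (hT : T ∈ 𝒯.elements) :
    Metric.diam (tri T) ≤ 𝒯.size :=
  le_csSup (𝒯.elements.finite_toSet.image _).bddAbove (mem_image_of_mem _ hT)

/-- The gradient of the correction is small compared with that of the trial function. -/
theorem exists_gradNorm_correction_le (k : ℕ) (hk : 0 < k) (σ : ℝ) : ∃ C : ℝ, 0 ≤ C ∧
    ∀ (𝒯 : TriMesh) (Γ : Set Plane) (ε : ℝ), 0 ≤ ε → ε ≤ 1 → 𝒯.IsShapeRegular σ →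
      𝒯.HasNodes Γ k ε → ∀ w ∈ 𝒯.trialSpace Γ k,
      𝒯.gradNorm (𝒯.correction k (𝒯.edgeValues k w)) ≤ C * ε * 𝒯.gradNorm w ∧
      (𝒯.gradNorm w = 0 → 𝒯.correction k (𝒯.edgeValues k w) = 0) := by
  obtain ⟨C, hC, hest⟩ := exists_edgeCorrection_estimate k hk (4 * |σ| + 1) (by positivity)
  refine ⟨C, hC, fun 𝒯 Γ ε hε hε1 hreg hn w hw => ?_⟩
  have hwL := trialSpace_le_lagrangeSpace hw
  have hloc : ∀ T ∈ 𝒯.bdryElements,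
      (∀ j ∈ Finset.Ioo 0 k, 𝒯.edgeValues k w T j ^ 2
        ≤ (C * ε) ^ 2 * ∫ x in tri T, ‖gradient w x‖ ^ 2) ∧
      ∫ x in tri T, ‖gradient (𝒯.correction k (𝒯.edgeValues k w)) x‖ ^ 2
        ≤ (C * ε) ^ 2 * ∫ x in tri T, ‖gradient w x‖ ^ 2 := by
    intro T hT
    have hTe := mem_elements_of_mem_bdryElements hT
    have hE := isEdgeBasis_edgeBasis hT
    have htri : convexHull ℝ (range (𝒯.edgeBasis T)) = tri T := by rw [hE.1, tri]
    obtain ⟨c, ρ, hρ, hball, hdiam⟩ := hreg.exists_closedBall hTe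
    obtain ⟨p, hp, hp0⟩ := hw.2.2.2 T hTe
    have hval : ∀ j ∈ Finset.Ioo 0 k,
        evalFun p (edgePoint (𝒯.edgeBasis T) k j) = 𝒯.edgeValues k w T j := fun j hj =>
      (hp.2 _ (hE.segment_subset_tri (edgePoint_mem hk (Finset.mem_Ioo.1 hj).2.le))).symm
    have h := hest (𝒯.edgeBasis T) c ρ hρ (by rwa [htri]) (by rwa [htri]) p hp.1 ε hε hε1
      fun j hj => by
        obtain ⟨s, hs, hsP⟩ := hn T hT j hj
        obtain ⟨hj0, hjk⟩ := Finset.mem_Ioo.1 hj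
        exact ⟨s, hs, hp0 _ ⟨_, _, _, by rw [← range_fin_three, hE.1], hE.2, j, hj0, hjk,
          (hsP _).2 rfl⟩⟩
    rw [htri] at h
    have hcorr : edgeCorrection (𝒯.edgeBasis T) k
        (fun j => evalFun p (edgePoint (𝒯.edgeBasis T) k j))
        = edgeCorrection (𝒯.edgeBasis T) k (𝒯.edgeValues k w T) := by
      ext x
      exact Finset.sum_congr rfl fun j hj => by beta_reduce; rw [hval j hj]
    rw [hcorr] at h
    rw [setIntegral_tri_gradient_congr (f := w) (g := evalFun p) hp.2,
      setIntegral_tri_gradient_congr (f := 𝒯.correction k (𝒯.edgeValues k w))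
        fun x hx => correction_of_mem hT hx]
    exact ⟨fun j hj => by rw [← hval j hj]; exact h.1 j hj, h.2⟩
  constructor
  · refine (pow_le_pow_iff_left₀ (gradNorm_nonneg _)
      (mul_nonneg (mul_nonneg hC hε) (gradNorm_nonneg _)) two_ne_zero).1 ?_
    rw [mul_pow, gradNorm_sq_eq_sum (correction_mem_lagrangeSpace (k := k) _),
      gradNorm_sq_eq_sum hwL, Finset.mul_sum]
    refine Finset.sum_le_sum fun T hT => ?_
    by_cases hT' : T ∈ 𝒯.bdryElements
    · exact (hloc T hT').2
    · rw [setIntegral_tri_gradient_congr (g := 0) fun x hx => correction_of_notMem hT hT' hx]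
      have h0 : ∀ x, gradient (0 : Plane → ℝ) x = 0 := fun x => by simp [gradient]
      simp only [h0, norm_zero, ne_eq, two_ne_zero, not_false_eq_true, zero_pow, integral_zero]
      exact mul_nonneg (sq_nonneg _) (integral_nonneg fun _ => sq_nonneg _)
  -- The edge values themselves are controlled by the local energy, so they vanish with it. The
  -- gradient bound alone would not show that the correction is zero as a function.
  · intro h0
    have hz : ∀ T ∈ 𝒯.elements, ∫ x in tri T, ‖gradient w x‖ ^ 2 = 0 := by
      have := gradNorm_sq_eq_sum hwL
      rw [h0, zero_pow two_ne_zero] at this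
      exact (Finset.sum_eq_zero_iff_of_nonneg
        fun T _ => integral_nonneg fun _ => sq_nonneg _).1 this.symm
    ext x
    refine Finset.sum_eq_zero fun T hT => ?_
    have : edgeCorrection (𝒯.edgeBasis T) k (𝒯.edgeValues k w T) = 0 := by
      ext y
      refine Finset.sum_eq_zero fun j hj => ?_
      have h1 := (hloc T hT).1 j hj
      rw [hz T (mem_elements_of_mem_bdryElements hT), mul_zero] at h1
      rw [pow_eq_zero_iff two_ne_zero |>.1 (h1.antisymm (sq_nonneg _)), zero_mul]
    rw [this]
    simp

/-! ### Dimension count and unique solvability -/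

/-- The space lies in the range of a linear map from tuples of polynomials of bounded degree. At a
point common to several triangles the map picks one of them; for the tuple of an actual `w` the
choice is immaterial. -/
theorem finiteDimensional_lagrangeSpace : FiniteDimensional ℝ (𝒯.lagrangeSpace k) := by
  classical
  let glue : (𝒯.elements → MvPolynomial.restrictTotalDegree (Fin 2) ℝ k) →ₗ[ℝ] (Plane → ℝ) :=
    { toFun := fun P x => if h : ∃ T : 𝒯.elements, x ∈ tri T.1 then evalFun (P h.choose).1 x else 0
      map_add' := fun P Q => by
        ext x
        by_cases h : ∃ T : 𝒯.elements, x ∈ tri T.1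
        · simp only [Pi.add_apply, dif_pos h]
          simp [evalFun]
        · simp only [Pi.add_apply, dif_neg h, add_zero]
      map_smul' := fun c P => by
        ext x
        by_cases h : ∃ T : 𝒯.elements, x ∈ tri T.1
        · simp only [Pi.smul_apply, dif_pos h]
          simp [evalFun, MvPolynomial.smul_eval]
        · simp only [Pi.smul_apply, dif_neg h, smul_zero] }
  have hle : 𝒯.lagrangeSpace k ≤ LinearMap.range glue := by
    intro w hw
    have hp : ∀ T : 𝒯.elements, ∃ p, IsPolyOn k T.1 w p := fun T => hw.2.2 T.1 T.2
    choose p hp using hp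
    refine ⟨fun T => ⟨p T, (MvPolynomial.mem_restrictTotalDegree _ _ _).2 (hp T).1⟩, ?_⟩
    ext x
    by_cases h : ∃ T : 𝒯.elements, x ∈ tri T.1
    · simp only [glue, LinearMap.coe_mk, AddHom.coe_mk, dif_pos h]
      exact ((hp h.choose).2 x h.choose_spec).symm
    · simp only [glue, LinearMap.coe_mk, AddHom.coe_mk, dif_neg h]
      refine (hw.2.1 x fun hx => h ?_).symm
      obtain ⟨T, hT, hxT⟩ := mem_carrier.1 hx
      exact ⟨⟨T, hT⟩, hxT⟩
  exact Submodule.finiteDimensional_of_le hle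

theorem correction_add (Y Z : Finset Plane → ℕ → ℝ) :
    𝒯.correction k (Y + Z) = 𝒯.correction k Y + 𝒯.correction k Z := by
  ext x
  simp only [correction, Pi.add_apply, ← Finset.sum_add_distrib]
  refine Finset.sum_congr rfl fun T _ => ?_
  by_cases hx : x ∈ tri T
  · simp only [indicator_of_mem hx, edgeCorrection, Pi.add_apply, add_mul, Finset.sum_add_distrib]
  · simp only [indicator_of_notMem hx, add_zero]

theorem correction_smul (c : ℝ) (Y : Finset Plane → ℕ → ℝ) :
    𝒯.correction k (c • Y) = c • 𝒯.correction k Y := by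
  ext x
  simp only [correction, Pi.smul_apply, smul_eq_mul, Finset.mul_sum]
  refine Finset.sum_congr rfl fun T _ => ?_
  by_cases hx : x ∈ tri T
  · simp only [indicator_of_mem hx, edgeCorrection, Pi.smul_apply, smul_eq_mul, Finset.mul_sum,
      mul_assoc]
  · simp only [indicator_of_notMem hx, mul_zero]

/-- The test function associated with a trial function: their values differ in the triangles with a
boundary edge only, by a correction that makes the function vanish on that edge. -/
def toTest {Ω Γ : Set Plane} (hfit : 𝒯.Fits Ω) (hk : 0 < k) :
    𝒯.trialSpace Γ k →ₗ[ℝ] 𝒯.testSpace k where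
  toFun w := ⟨w.1 - 𝒯.correction k (𝒯.edgeValues k w.1),
    sub_correction_mem_testSpace hfit hk w.2⟩
  map_add' w w' := Subtype.ext (by
    have h : 𝒯.edgeValues k (w.1 + w'.1) = 𝒯.edgeValues k w.1 + 𝒯.edgeValues k w'.1 := rfl
    simp only [Submodule.coe_add, h, correction_add]
    abel)
  map_smul' c w := Subtype.ext (by
    have h : 𝒯.edgeValues k (c • w.1) = c • 𝒯.edgeValues k w.1 := rfl
    simp only [Submodule.coe_smul, h, correction_smul, smul_sub, RingHom.id_apply])

theorem finrank_testSpace_le {Ω Γ : Set Plane} (hfit : 𝒯.Fits Ω) (hk : 0 < k) {ε : ℝ}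
    (hε : ε < 1) (hn : 𝒯.HasNodes Γ k ε) :
    Module.finrank ℝ (𝒯.testSpace k) ≤ Module.finrank ℝ (𝒯.trialSpace Γ k) := by
  have := finiteDimensional_lagrangeSpace (𝒯 := 𝒯) (k := k)
  have : FiniteDimensional ℝ (𝒯.trialSpace Γ k) :=
    Submodule.finiteDimensional_of_le trialSpace_le_lagrangeSpace
  refine LinearMap.finrank_le_finrank_of_surjective (f := toTest hfit hk) fun v => ?_
  obtain ⟨w, hw, hwv⟩ := exists_trialSpace_sub_correction_eq hfit hε hn v.2
  exact ⟨⟨w, hw⟩, Subtype.ext hwv⟩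

/-- Injectivity gives `dim W_h ≤ dim V_h`; with the opposite inequality the operator from `W_h` to
the dual of `V_h` is bijective. -/
theorem exists_unique_solution {Γ : Set Plane} {ν : ℝ} {b : Plane → Plane} (hb : Continuous b)
    (hdim : Module.finrank ℝ (𝒯.testSpace k) ≤ Module.finrank ℝ (𝒯.trialSpace Γ k))
    (hinj : ∀ w ∈ 𝒯.trialSpace Γ k, (∀ v ∈ 𝒯.testSpace k, 𝒯.form ν b w v = 0) → w = 0)
    {f : Plane → ℝ} (hf : MemLp f 2 (volume.restrict 𝒯.domain)) :
    ∃! u : Plane → ℝ, u ∈ 𝒯.trialSpace Γ k ∧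
      ∀ v ∈ 𝒯.testSpace k, 𝒯.form ν b u v = 𝒯.load f v := by
  have := finiteDimensional_lagrangeSpace (𝒯 := 𝒯) (k := k)
  have : FiniteDimensional ℝ (𝒯.trialSpace Γ k) :=
    Submodule.finiteDimensional_of_le trialSpace_le_lagrangeSpace
  have : FiniteDimensional ℝ (𝒯.testSpace k) :=
    Submodule.finiteDimensional_of_le testSpace_le_lagrangeSpace
  have hW : ∀ w : 𝒯.trialSpace Γ k, w.1 ∈ 𝒯.lagrangeSpace k := fun w =>
    trialSpace_le_lagrangeSpace w.2
  have hV : ∀ v : 𝒯.testSpace k, v.1 ∈ 𝒯.lagrangeSpace k := fun v =>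
    testSpace_le_lagrangeSpace v.2
  let Φ : 𝒯.trialSpace Γ k →ₗ[ℝ] Module.Dual ℝ (𝒯.testSpace k) :=
    LinearMap.mk₂ ℝ (fun w v => 𝒯.form ν b w.1 v.1)
      (fun w w' v => form_add_left hb (hW w) (hW w') (hV v))
      (fun c w v => form_smul_left c (hW w))
      (fun w v v' => form_add_right hb (hW w) (hV v) (hV v'))
      (fun c w v => form_smul_right c (hV v))
  have hΦ : Function.Injective Φ := by
    rw [injective_iff_map_eq_zero]
    intro w hw
    exact Subtype.ext (hinj w.1 w.2 fun v hv => congrArg (fun g => g ⟨v, hv⟩) hw)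
  have hrank : Module.finrank ℝ (𝒯.trialSpace Γ k)
      = Module.finrank ℝ (Module.Dual ℝ (𝒯.testSpace k)) := by
    refine (LinearMap.finrank_le_finrank_of_injective hΦ).antisymm ?_
    rw [Subspace.dual_finrank_eq]
    exact hdim
  have hsurj := (LinearMap.injective_iff_surjective_of_finrank_eq_finrank hrank).1 hΦ
  have hint : ∀ v : 𝒯.testSpace k, Integrable (fun x => f x * v.1 x) (volume.restrict 𝒯.domain) :=
    fun v => hf.integrable_mul (memLp_of_continuousOn (hV v).1)
  let F : Module.Dual ℝ (𝒯.testSpace k) :=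
    { toFun := fun v => 𝒯.load f v.1
      map_add' := fun v v' => by
        simp only [load]
        rw [← integral_add (hint v) (hint v')]
        congr 1 with x
        simp [mul_add]
      map_smul' := fun c v => by
        simp only [load, RingHom.id_apply, smul_eq_mul]
        rw [← integral_const_mul]
        congr 1 with x
        simp only [Submodule.coe_smul, Pi.smul_apply, smul_eq_mul]
        ring }
  obtain ⟨u, hu⟩ := hsurj F
  have hu' : ∀ v (hv : v ∈ 𝒯.testSpace k), 𝒯.form ν b u.1 v = 𝒯.load f v := fun v hv =>
    congrArg (fun g => g ⟨v, hv⟩) hu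
  refine ⟨u.1, ⟨u.2, hu'⟩, fun u₂ ⟨hu₂, h₂⟩ => ?_⟩
  have : Φ ⟨u₂, hu₂⟩ = Φ u := by
    ext v
    exact (h₂ v.1 v.2).trans (hu' v.1 v.2).symm
  exact congrArg Subtype.val (hΦ this)

theorem gradNorm_zero : 𝒯.gradNorm 0 = 0 := by
  have h0 : ∀ x, gradient (0 : Plane → ℝ) x = 0 := fun x => by simp [gradient]
  simp [gradNorm, h0]

/-! ### The inf-sup condition -/

/-- The discrete inf-sup condition, under the assumption that corrections are small. -/
theorem exists_testSpace_form_ge {Ω Γ : Set Plane} (hfit : 𝒯.Fits Ω) (hk : 0 < k) {ν : ℝ}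
    (hν : 0 < ν) {b : Plane → Plane} (hb : Continuous b) (hdiv : IsSolenoidal b) {R B κ : ℝ}
    (hR : 0 ≤ R) (hB0 : 0 ≤ B) (hs : ∀ x ∈ 𝒯.carrier, ‖x‖ ≤ R)
    (hB : ∀ x ∈ 𝒯.carrier, ‖b x‖ ≤ B) (hκ : κ * (2 * ν + 2 * R * B) ≤ 3 * ν / 5)
    {w : Plane → ℝ} (hw : w ∈ 𝒯.trialSpace Γ k) (hw0 : w ≠ 0)
    (hc : 𝒯.gradNorm (𝒯.correction k (𝒯.edgeValues k w)) ≤ κ * 𝒯.gradNorm w)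
    (hc0 : 𝒯.gradNorm w = 0 → 𝒯.correction k (𝒯.edgeValues k w) = 0) :
    ∃ v ∈ 𝒯.testSpace k, v ≠ 0 ∧ 0 < 𝒯.gradNorm w * 𝒯.gradNorm v ∧
      2 * ν / 5 ≤ 𝒯.form ν b w v / (𝒯.gradNorm w * 𝒯.gradNorm v) := by
  set c := 𝒯.correction k (𝒯.edgeValues k w) with hcdef
  have hv : w - c ∈ 𝒯.testSpace k := sub_correction_mem_testSpace hfit hk hw
  set v := w - c with hvdef
  have hwvc : w = v + c := by rw [hvdef, sub_add_cancel]
  have hvL := testSpace_le_lagrangeSpace hv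
  have hcL : c ∈ 𝒯.lagrangeSpace k := correction_mem_lagrangeSpace _
  -- If the norm were zero, the correction would vanish and `w` would be a test function, hence zero
  -- by Poincaré's inequality.
  have hNw : 0 < 𝒯.gradNorm w := by
    refine (gradNorm_nonneg w).lt_of_ne fun h => hw0 ?_
    have h1 := hc0 h.symm
    have h2 : v = w := by rw [hvdef, h1, sub_zero]
    rw [← h2]
    exact eq_zero_of_gradNorm_eq_zero hv (by rw [h2, ← h])
  have htri : 𝒯.gradNorm w ≤ 𝒯.gradNorm v + 𝒯.gradNorm c := by
    conv_lhs => rw [hwvc]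
    exact gradNorm_add_le hvL hcL
  -- Hence `‖∇v‖ ≥ (7/10) ‖∇w‖`, so the quotient is well defined.
  have hκ1 : κ ≤ 3 / 10 := by
    by_contra! h
    have : 3 / 10 * (2 * ν) < κ * (2 * ν + 2 * R * B) := by
      have h1 : 0 ≤ 2 * R * B := by positivity
      nlinarith
    linarith
  have hNv : 0 < 𝒯.gradNorm v := by nlinarith
  have hform : ν * 𝒯.gradNorm v ^ 2 - (ν + 2 * R * B) * 𝒯.gradNorm c * 𝒯.gradNorm v
      ≤ 𝒯.form ν b w v := by
    have h1 : 𝒯.form ν b w v = 𝒯.form ν b v v + 𝒯.form ν b c v := by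
      conv_lhs => rw [hwvc]
      exact form_add_left hb hvL hcL hvL
    have h2 := neg_abs_le (𝒯.form ν b c v)
    have h3 := abs_form_le hν.le hb hR hB0 hs hB hcL hv
    rw [h1, form_self hb hdiv hv]
    linarith
  refine ⟨v, hv, ?_, mul_pos hNw hNv, ?_⟩
  · intro h
    rw [h, gradNorm_zero] at hNv
    exact lt_irrefl _ hNv
  · rw [le_div_iff₀ (mul_pos hNw hNv)]
    refine le_trans ?_ hform
    have hRB : 0 ≤ 2 * R * B := by positivity
    -- Replacing `ν ‖∇v‖` by `ν ‖∇w‖ - ν ‖∇c‖` leaves a loss of at most `κ (2ν + 2RB) ‖∇w‖ ≤ (3ν/5)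
    -- ‖∇w‖`.
    have h1 : (2 * ν / 5) * 𝒯.gradNorm w ≤ ν * 𝒯.gradNorm v - (ν + 2 * R * B) * 𝒯.gradNorm c := by
      have h2 : (ν + (ν + 2 * R * B)) * 𝒯.gradNorm c
          ≤ (ν + (ν + 2 * R * B)) * (κ * 𝒯.gradNorm w) := by gcongr
      have h3 : ν * 𝒯.gradNorm w ≤ ν * (𝒯.gradNorm v + 𝒯.gradNorm c) := by gcongr
      have h4 : κ * (2 * ν + 2 * R * B) * 𝒯.gradNorm w ≤ 3 * ν / 5 * 𝒯.gradNorm w := by gcongr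
      linarith
    calc 2 * ν / 5 * (𝒯.gradNorm w * 𝒯.gradNorm v)
        = (2 * ν / 5 * 𝒯.gradNorm w) * 𝒯.gradNorm v := by ring
      _ ≤ (ν * 𝒯.gradNorm v - (ν + 2 * R * B) * 𝒯.gradNorm c) * 𝒯.gradNorm v := by gcongr
      _ = _ := by ring

end TriMesh

/-! ### Choice of the mesh threshold and conclusion -/

theorem HasC1Boundary.exists_hasNodes {Ω : Set Plane} (hΩ : IsOpen Ω)
    (hΩb : Bornology.IsBounded Ω) (hC : HasC1Boundary Ω) (σ : ℝ) {ε : ℝ} (hε : 0 < ε)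
    (hε1 : ε ≤ 1) (k : ℕ) : ∃ h₀ : ℝ, 0 < h₀ ∧ ∀ 𝒯 : TriMesh, 𝒯.Fits Ω → 𝒯.IsShapeRegular σ →
      𝒯.size ≤ h₀ → 𝒯.HasNodes (frontier Ω) k ε := by
  obtain ⟨h₀, hh₀, h⟩ := hC.exists_isNearestIntersection hΩ hΩb
    (by positivity : 0 < 4 * |σ| + 1) hε hε1
  refine ⟨h₀, hh₀, fun 𝒯 hfit hreg hsize T hT j hj => ?_⟩
  have hTe := TriMesh.mem_elements_of_mem_bdryElements hT
  have hE := TriMesh.isEdgeBasis_edgeBasis hT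
  have htri : convexHull ℝ (range (𝒯.edgeBasis T)) = tri T := by rw [hE.1, tri]
  obtain ⟨c, ρ, hρ, hball, hdiam⟩ := hreg.exists_closedBall hTe
  obtain ⟨hj0, hjk⟩ := Finset.mem_Ioo.1 hj
  refine h (𝒯.edgeBasis T) c ρ hρ (by rwa [htri]) (by rwa [htri])
    (by rw [htri]; exact (TriMesh.diam_tri_le_size hTe).trans hsize)
    (hfit.vertex_mem T hTe _ (hE.mem 1) (hE.segment_subset_bdry (left_mem_segment ℝ _ _)))
    (hfit.vertex_mem T hTe _ (hE.mem 2) (hE.segment_subset_bdry (right_mem_segment ℝ _ _)))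
    ((j : ℝ) / k) ⟨by positivity, ?_⟩
  have hk : (0 : ℝ) < k := by exact_mod_cast hj0.trans hjk
  rw [div_le_one hk]
  exact_mod_cast hjk.le

end

theorem mainTheorem3 (Ω : Set Plane) (hΩ_open : IsOpen Ω) (hΩ_conn : IsConnected Ω)
    (hΩ_bdd : Bornology.IsBounded Ω) (hΩ_bdry : HasC1Boundary Ω)
    (k : ℕ) (hk : 2 ≤ k) (ν : ℝ) (hν : 0 < ν)
    (b : Plane → Plane) (hb : Continuous b) (hb_div : IsSolenoidal b) (σ : ℝ) :
    ∃ h₀ : ℝ, 0 < h₀ ∧ ∀ 𝒯 : TriMesh, 𝒯.Fits Ω → 𝒯.IsShapeRegular σ → 𝒯.size ≤ h₀ →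
      (∀ f : Plane → ℝ,
        MeasureTheory.MemLp f 2 (MeasureTheory.volume.restrict 𝒯.domain) →
        ∃! u : Plane → ℝ, u ∈ 𝒯.trialSpace (frontier Ω) k ∧
          ∀ v ∈ 𝒯.testSpace k, 𝒯.form ν b u v = 𝒯.load f v) ∧
      ∀ w ∈ 𝒯.trialSpace (frontier Ω) k, w ≠ 0 →
        ((2 * ν / 5 : ℝ) : EReal) ≤
          ⨆ v ∈ {v : Plane → ℝ | v ∈ 𝒯.testSpace k ∧ v ≠ 0},
            ((𝒯.form ν b w v / (𝒯.gradNorm w * 𝒯.gradNorm v) : ℝ) : EReal) := by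
  have hk0 : 0 < k := by omega
  obtain ⟨R₀, hR₀⟩ := (hΩ_bdd.closure.subset frontier_subset_closure).subset_closedBall (0 : Plane)
  set R := max R₀ 0 with hRdef
  have hR0 : 0 ≤ R := le_max_right _ _
  have hR : frontier Ω ⊆ Metric.closedBall 0 R :=
    hR₀.trans (Metric.closedBall_subset_closedBall (le_max_left _ _))
  obtain ⟨B₀, hB₀⟩ := (isCompact_closedBall (0 : Plane) R).exists_bound_of_continuousOn
    hb.continuousOn
  set B := max B₀ 0 with hBdef
  have hB0 : 0 ≤ B := le_max_right _ _
  obtain ⟨C, hC, hcorr⟩ := TriMesh.exists_gradNorm_correction_le k hk0 σ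
  have hD : 0 < 2 * ν + 2 * R * B := by positivity
  -- The first bound keeps `1 + s` away from zero; the second gives `C ε (2ν + 2RB) ≤ 3ν/5`, with `C
  -- + 1` in place of `C` to avoid division by zero. Only `Ω`, `k`, `ν`, `b` and `σ` enter.
  set ε : ℝ := min (1 / 2) (3 * ν / 5 / ((C + 1) * (2 * ν + 2 * R * B))) with hεdef
  have hε0 : 0 < ε := by positivity
  have hε2 : ε ≤ 1 / 2 := min_le_left _ _
  have hκ : C * ε * (2 * ν + 2 * R * B) ≤ 3 * ν / 5 := by
    calc C * ε * (2 * ν + 2 * R * B) ≤ (C + 1) * ε * (2 * ν + 2 * R * B) := by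
          gcongr
          linarith
      _ ≤ (C + 1) * (3 * ν / 5 / ((C + 1) * (2 * ν + 2 * R * B))) * (2 * ν + 2 * R * B) := by
          gcongr
          exact min_le_right _ _
      _ = 3 * ν / 5 := by field_simp
  obtain ⟨h₀, hh₀, hnodes⟩ := hΩ_bdry.exists_hasNodes hΩ_open hΩ_bdd σ hε0 (by linarith) k
  refine ⟨h₀, hh₀, fun 𝒯 hfit hreg hsize => ?_⟩
  have hn := hnodes 𝒯 hfit hreg hsize
  have hs : ∀ x ∈ 𝒯.carrier, ‖x‖ ≤ R := fun x hx => TriMesh.norm_le_of_mem_carrier hfit hR hx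
  have hB : ∀ x ∈ 𝒯.carrier, ‖b x‖ ≤ B := fun x hx =>
    (hB₀ x (by simpa using hs x hx)).trans (le_max_left _ _)
  have key : ∀ w ∈ 𝒯.trialSpace (frontier Ω) k, w ≠ 0 → ∃ v ∈ 𝒯.testSpace k, v ≠ 0 ∧
      0 < 𝒯.gradNorm w * 𝒯.gradNorm v ∧
      2 * ν / 5 ≤ 𝒯.form ν b w v / (𝒯.gradNorm w * 𝒯.gradNorm v) := fun w hw hw0 => by
    obtain ⟨h1, h2⟩ := hcorr 𝒯 (frontier Ω) ε hε0.le (by linarith) hreg hn w hw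
    exact TriMesh.exists_testSpace_form_ge hfit hk0 hν hb hb_div hR0 hB0 hs hB hκ hw hw0 h1 h2
  refine ⟨fun f hf => ?_, fun w hw hw0 => ?_⟩
  · refine TriMesh.exists_unique_solution hb
      (TriMesh.finrank_testSpace_le hfit hk0 (by linarith) hn) (fun w hw h => ?_) hf
    by_contra hw0
    obtain ⟨v, hv, -, -, hle⟩ := key w hw hw0
    -- A nonzero `w` in the kernel would give `2ν/5 ≤ 0`.
    rw [h v hv, zero_div] at hle
    linarith
  · obtain ⟨v, hv, hv0, -, hle⟩ := key w hw hw0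
    exact le_iSup₂_of_le v ⟨hv, hv0⟩ (EReal.coe_le_coe_iff.2 hle)
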